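/- **Model.** In the Energy Word RAM a machine has variables and memory words, each a $w$-bit word, and the memory is addressed by words (directly or through a variable). One word operation takes one unit of time. The operations are in-place addition and subtraction (of a word or of a constant), negation of a bit, swap, adding to or subtracting from a word the outcome of a comparison ($\le$ or $=$), and the irreversible operations bitwise And, bitwise Or and Set (overwrite); the operands of an operation must be distinct locations, and no variable is both operand and address. The energy of an operation is $\lg(|X|/|f(X)|)$ bits, where $X$ is its input space and $f(X)$ its output space. Branches and loops are reversible, at no energy, if the place where two paths meet carries a test (a "comefrom" condition) that tells the paths apart; a conventional branch or loop costs one bit each time two paths meet. Tests take time equal to their size. Time, energy and memory use of a program are those of its run, a run that violates a requirement being undefined. **Data structure.** A reversible AVL tree lives in memory: word $0$ is the pointer to the root, and each node is a two-way node, with its key, the pointers to its left and right child, and the pointer to its parent in consecutive words; all these words have distinct addresses. The linked nodes form an AVL tree (a binary search tree with distinct keys in which the heights of the two subtrees of every node differ by at most $1$). Everything else that is stored in memory (balance information, rotation log, bookkeeping) is called the log, and its size in bits is the total number of binary digits of these words. The space used is the length of the shortest initial segment of memory outside which all words are blank. **Theorem.** There are programs $\mathrm{Insert}$ and $\mathrm{Uninsert}$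 and constants $c > 0$, $C \in \mathbb N$ such that the following holds for every word size $w$ and every $n \ge 0$ with $C(n+1) \le 2^w$. Let $M$ be the contents of memory after $n$ distinct $w$-bit keys have been inserted with $\mathrm{Insert}$, one after the other, starting from blank memory, and let $x$ be a $w$-bit key that is not among them. (Each operation starts with its argument in one variable, and ends with the argument still there; all other variables are zero before and after it.) Then 1. $M$ holds a reversible AVL tree with exactly the $n$ inserted keys. Started on $M$ with the argument $x$, $\mathrm{Insert}$ halts with memory contents $M'$ that hold a reversible AVL tree whose keys are the $n$ inserted keys and $x$. Started on $M'$ with the argument $x$, $\mathrm{Uninsert}$ halts and restores $M$. 2. Both runs use $0$ energy and take $\Theta(\lg n)$ time: their times lie between $c \lg(n+2)$ and $C \lg(n+2)$. 3. The space stays $\Theta(n)$ words: the space used by $M$ lies between $cn$ and $Cn$, the space used by $M'$ lies between $c(n+1)$ and $C(n+1)$, and both runs access only the first $C(n+1)$ words of memory. 4. The log grows by $O(\lg n)$ bits: the size of the log of $M'$ is at most that of $M$ plus $C \lg (n+2)$ bits. -/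

import Mathlib

/-!
The Energy Word RAM: a word RAM with `w`-bit words, with time counted in word operations, space in
words, and (Landauer) energy in bits, and AVL trees of doubly linked nodes stored in its memory.
-/

namespace EnergyRAM

/-- The locations of the machine: its variables, and its memory words, addressed by words. -/
inductive Loc (w : ℕ) where
  | var (i : ℕ) : Loc w
  | mem (a : BitVec w) : Loc w

/-- A state of the machine: the word stored at each location. -/
abbrev State (w : ℕ) := Loc w → BitVec w

/-- An operand of an instruction: the variable `i`, or the memory word whose address is the
current value of the variable `i`. -/
inductive Operand where
  | var (i : ℕ)
  | ind (i : ℕ)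

/-- The location that an operand denotes in the state `s`. -/
def State.loc {w : ℕ} (s : State w) : Operand → Loc w
  | .var i => .var i
  | .ind i => .mem (s (.var i))

/-! ### Word operations and their energy -/

/-- The word operations on `k` words. `Copy(a, b)`, for an empty `b`, is `add b a`,
`DestroyCopy(a, b)` is `sub b a`, and `Inc`, `Dec` are `addc 1`, `subc 1`. The last three
operations are irreversible. -/
inductive WordOp : ℕ → Type where
  | add : WordOp 2
  | sub : WordOp 2
  | addc (c : ℕ) : WordOp 1
  | subc (c : ℕ) : WordOp 1
  | not : WordOp 1
  | swap : WordOp 2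
  | le : WordOp 3
  | invLe : WordOp 3
  | eq : WordOp 3
  | invEq : WordOp 3
  | and : WordOp 2
  | or : WordOp 2
  | set : WordOp 2

/-- The inputs on which an operation is defined: `not` works on a bit (a word that is `0` or `1`),
every other operation works on all words. -/
def WordOp.dom (w : ℕ) : {k : ℕ} → WordOp k → Set (Fin k → BitVec w)
  | _, .not => {v | v 0 = 0 ∨ v 0 = 1}
  | _, _ => Set.univ

/-- The words that replace the operands `v`; arithmetic is modulo `2 ^ w`, and words are compared
as unsigned integers. -/
def WordOp.eval {w : ℕ} : {k : ℕ} → WordOp k → (Fin k → BitVec w) → Fin k → BitVec w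
  | _, .add, v => ![v 0 + v 1, v 1]
  | _, .sub, v => ![v 0 - v 1, v 1]
  | _, .addc c, v => ![v 0 + BitVec.ofNat w c]
  | _, .subc c, v => ![v 0 - BitVec.ofNat w c]
  | _, .not, v => ![1 - v 0]
  | _, .swap, v => ![v 1, v 0]
  | _, .le, v => ![v 0, v 1, if v 0 ≤ v 1 then v 2 + 1 else v 2]
  | _, .invLe, v => ![v 0, v 1, if v 0 ≤ v 1 then v 2 - 1 else v 2]
  | _, .eq, v => ![v 0, v 1, if v 0 = v 1 then v 2 + 1 else v 2]
  | _, .invEq, v => ![v 0, v 1, if v 0 = v 1 then v 2 - 1 else v 2]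
  | _, .and, v => ![v 0 &&& v 1, v 1]
  | _, .or, v => ![v 0 ||| v 1, v 1]
  | _, .set, v => ![v 1, v 1]

/-- The energy of an operation, in bits: the binary logarithm of the ratio of the size of its input
space to the size of its output space. It is `0` exactly for the injective operations. -/
noncomputable def WordOp.energy (w : ℕ) {k : ℕ} (o : WordOp k) : ℝ :=
  Real.logb 2 ((o.dom w).ncard / (o.eval '' o.dom w).ncard)

/-- The operands `args` are legal in the state `s` of a machine with `S` words of memory: they
denote distinct locations, the addresses used are below `S`, and no variable is used both as an
operand and as an address (so that the locations can be recovered after the operation). -/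
def Legal (S : ℕ) {w : ℕ} (s : State w) {k : ℕ} (args : Fin k → Operand) : Prop :=
  Function.Injective (fun j => s.loc (args j)) ∧
    ∀ j i, args j = .ind i → (s (.var i)).toNat < S ∧ ∀ j', args j' ≠ .var i

/-! ### Tests -/

/-- Tests, built from comparisons of two operands, or of an operand with a constant. -/
inductive Test where
  | eq (x y : Operand)
  | le (x y : Operand)
  | eqc (x : Operand) (c : ℕ)
  | not (b : Test)
  | and (b b' : Test)
  | or (b b' : Test)

/-- The operands that occur in a test. -/
def Test.operands : Test → List Operand
  | .eq x y => [x, y]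
  | .le x y => [x, y]
  | .eqc x _ => [x]
  | .not b => b.operands
  | .and b b' => b.operands ++ b'.operands
  | .or b b' => b.operands ++ b'.operands

/-- The time that a test takes: the number of its comparisons and connectives. -/
def Test.size : Test → ℕ
  | .eq _ _ => 1
  | .le _ _ => 1
  | .eqc _ _ => 1
  | .not b => b.size + 1
  | .and b b' => b.size + b'.size + 1
  | .or b b' => b.size + b'.size + 1

/-- The test is true in the state `s`. -/
def Test.Holds {w : ℕ} (s : State w) : Test → Prop
  | .eq x y => s (s.loc x) = s (s.loc y)
  | .le x y => s (s.loc x) ≤ s (s.loc y)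
  | .eqc x c => s (s.loc x) = BitVec.ofNat w c
  | .not b => ¬ b.Holds s
  | .and b b' => b.Holds s ∧ b'.Holds s
  | .or b b' => b.Holds s ∨ b'.Holds s

/-- The test reads memory only at addresses below `S`. -/
def Test.InBounds (S : ℕ) {w : ℕ} (s : State w) (b : Test) : Prop :=
  ∀ i, Operand.ind i ∈ b.operands → (s (.var i)).toNat < S

/-! ### Programs -/

/-- Programs. Reversible control logic pairs every branch with a test at the place where the two
paths meet again (`comefrom`), which tells them apart:
* `ifRev b c c' b'` is `if b then c else c'`, where `b'` must be true after `c` and false after `c'`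
  (the protected if is the case `b' = b`);
* `loopRev a b c` is `until b do c`, where `a` must be true when the loop is entered and false
  after each execution of `c`.
`ifIrr` and `whileIrr` are the conventional branch and loop, which forget the path taken. -/
inductive Prog where
  | skip
  | op {k : ℕ} (o : WordOp k) (args : Fin k → Operand)
  | seq (c c' : Prog)
  | ifRev (b : Test) (c c' : Prog) (b' : Test)
  | loopRev (a b : Test) (c : Prog)
  | ifIrr (b : Test) (c c' : Prog)
  | whileIrr (b : Test) (c : Prog)

/-- `Exec S p s t e s'`: on a machine with `S` words of memory (those with addresses below `S`), the
program `p`, started in the state `s`, halts in the state `s'` after `t` word operations, using `e`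
units of energy. A program whose requirements (legal operands, tests at the meeting points of
reversible control logic, addresses below `S`) are violated gets stuck: it has no execution. Each
irreversible meeting of two paths forgets one bit. -/
inductive Exec (S : ℕ) {w : ℕ} : Prog → State w → ℕ → ℝ → State w → Prop where
  | skip (s : State w) : Exec S .skip s 0 0 s
  | op {k : ℕ} (o : WordOp k) (args : Fin k → Operand) (s : State w) (hl : Legal S s args)
      (hd : (fun j => s (s.loc (args j))) ∈ o.dom w) :
      Exec S (.op o args) s 1 (o.energy w)
        (Function.extend (fun j => s.loc (args j)) (o.eval fun j => s (s.loc (args j))) s)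
  | seq {c c' : Prog} {s₀ s₁ s₂ : State w} {t t' : ℕ} {e e' : ℝ}
      (h : Exec S c s₀ t e s₁) (h' : Exec S c' s₁ t' e' s₂) :
      Exec S (.seq c c') s₀ (t + t') (e + e') s₂
  | ifRev_true {b b' : Test} {c c' : Prog} {s s' : State w} {t : ℕ} {e : ℝ}
      (hi : b.InBounds S s) (hb : b.Holds s) (h : Exec S c s t e s')
      (hi' : b'.InBounds S s') (hb' : b'.Holds s') :
      Exec S (.ifRev b c c' b') s (b.size + t + b'.size) e s'
  | ifRev_false {b b' : Test} {c c' : Prog} {s s' : State w} {t : ℕ} {e : ℝ}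
      (hi : b.InBounds S s) (hb : ¬ b.Holds s) (h : Exec S c' s t e s')
      (hi' : b'.InBounds S s') (hb' : ¬ b'.Holds s') :
      Exec S (.ifRev b c c' b') s (b.size + t + b'.size) e s'
  | loopRev {a b : Test} {c : Prog} {s s' : State w} (k : ℕ) (σ : ℕ → State w) (τ : ℕ → ℕ)
      (ε : ℕ → ℝ) (h₀ : σ 0 = s) (hk : σ k = s')
      (hi : ∀ i ≤ k, a.InBounds S (σ i) ∧ b.InBounds S (σ i))
      (ha₀ : a.Holds (σ 0)) (ha : ∀ i < k, ¬ a.Holds (σ (i + 1)))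
      (hb : ∀ i < k, ¬ b.Holds (σ i)) (hbk : b.Holds (σ k))
      (h : ∀ i < k, Exec S c (σ i) (τ i) (ε i) (σ (i + 1))) :
      Exec S (.loopRev a b c) s
        ((k + 1) * (a.size + b.size) + ∑ i ∈ Finset.range k, τ i) (∑ i ∈ Finset.range k, ε i) s'
  | ifIrr_true {b : Test} {c c' : Prog} {s s' : State w} {t : ℕ} {e : ℝ}
      (hi : b.InBounds S s) (hb : b.Holds s) (h : Exec S c s t e s') :
      Exec S (.ifIrr b c c') s (b.size + t) (e + 1) s'
  | ifIrr_false {b : Test} {c c' : Prog} {s s' : State w} {t : ℕ} {e : ℝ}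
      (hi : b.InBounds S s) (hb : ¬ b.Holds s) (h : Exec S c' s t e s') :
      Exec S (.ifIrr b c c') s (b.size + t) (e + 1) s'
  | whileIrr {b : Test} {c : Prog} {s s' : State w} (k : ℕ) (σ : ℕ → State w) (τ : ℕ → ℕ)
      (ε : ℕ → ℝ) (h₀ : σ 0 = s) (hk : σ k = s') (hi : ∀ i ≤ k, b.InBounds S (σ i))
      (hb : ∀ i < k, b.Holds (σ i)) (hbk : ¬ b.Holds (σ k))
      (h : ∀ i < k, Exec S c (σ i) (τ i) (ε i) (σ (i + 1))) :
      Exec S (.whileIrr b c) s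
        ((k + 1) * b.size + ∑ i ∈ Finset.range k, τ i)
        ((k + 1) + ∑ i ∈ Finset.range k, ε i) s'

/-! ### Data structures in memory -/

/-- The contents of the memory. Between operations, a data structure lives in memory only. -/
abbrev Memory (w : ℕ) := BitVec w → BitVec w

/-- The state with memory `m`, the argument `x` in variable `0`, and all other variables zero. -/
def withArg {w : ℕ} (m : Memory w) (x : BitVec w) : State w
  | .var i => if i = 0 then x else 0
  | .mem a => m a

/-- `Built p xs m`: the memory contents `m` are obtained from the blank memory by inserting the
distinct keys of the list `xs` (last one first) with the program `p`. Each run keeps the argument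
and leaves all other variables zero. -/
inductive Built (p : Prog) {w : ℕ} : List (BitVec w) → Memory w → Prop where
  | blank : Built p [] (fun _ => 0)
  | insert {xs : List (BitVec w)} {m m' : Memory w} {x : BitVec w} {S t : ℕ} {e : ℝ}
      (hm : Built p xs m) (hx : x ∉ xs) (h : Exec S p (withArg m x) t e (withArg m' x)) :
      Built p (x :: xs) m'

/-- The space used in memory: the least `S` such that all words at addresses `≥ S` are blank. -/
noncomputable def spaceUsed {w : ℕ} (m : Memory w) : ℕ :=
  sInf {S : ℕ | ∀ a : BitVec w, S ≤ a.toNat → m a = 0}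

/-! ### AVL trees -/

/-- The keys of a tree, in symmetric order. -/
def keys {w : ℕ} : BinaryTree (BitVec w) → List (BitVec w)
  | .nil => []
  | .node k l r => keys l ++ k :: keys r

/-- Binary search trees (with distinct keys). -/
def IsSearchTree {w : ℕ} : BinaryTree (BitVec w) → Prop
  | .nil => True
  | .node k l r => (∀ y ∈ keys l, y < k) ∧ (∀ y ∈ keys r, k < y) ∧ IsSearchTree l ∧ IsSearchTree r

/-- The heights of the two subtrees of each node differ by at most one. -/
def IsBalanced {w : ℕ} : BinaryTree (BitVec w) → Prop
  | .nil => True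
  | .node _ l r =>
    l.height ≤ r.height + 1 ∧ r.height ≤ l.height + 1 ∧ IsBalanced l ∧ IsBalanced r

/-- AVL trees. -/
def IsAVL {w : ℕ} (T : BinaryTree (BitVec w)) : Prop := IsSearchTree T ∧ IsBalanced T

/-- The memory `m` holds the tree `T` as linked two-way nodes, where `p` is the pointer to the root
and `q` the pointer to its parent (`0` is the null pointer). A node at address `p` has its key at
`p`, the pointers to its left and right child at `p + 1` and `p + 2`, and the pointer to its parent
at `p + 3`. -/
def HoldsAt {w : ℕ} (m : Memory w) : BinaryTree (BitVec w) → BitVec w → BitVec w → Prop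
  | .nil, p, _ => p = 0
  | .node k l r, p, q =>
    p ≠ 0 ∧ m p = k ∧ m (p + 3) = q ∧ HoldsAt m l (m (p + 1)) p ∧ HoldsAt m r (m (p + 2)) p

/-- The addresses of the words of the nodes of a tree with root pointer `p`. -/
def nodeCells {w : ℕ} (m : Memory w) : BinaryTree (BitVec w) → BitVec w → List (BitVec w)
  | .nil, _ => []
  | .node _ l r, p =>
    [p, p + 1, p + 2, p + 3] ++ nodeCells m l (m (p + 1)) ++ nodeCells m r (m (p + 2))

/-- The addresses of the words of the tree: that of the root pointer, which is `0`, and those of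
the words of its nodes. -/
def treeCells {w : ℕ} (m : Memory w) (T : BinaryTree (BitVec w)) : List (BitVec w) :=
  0 :: nodeCells m T (m 0)

/-- The memory `m` holds the tree `T`: the root pointer is stored at address `0`, the nodes are
linked as in `T`, and all these words are at distinct addresses. -/
def HoldsTree {w : ℕ} (m : Memory w) (T : BinaryTree (BitVec w)) : Prop :=
  HoldsAt m T (m 0) 0 ∧ (treeCells m T).Nodup

/-- The size of the log, in bits: the total number of binary digits of all that is stored in memory
besides the keys and pointers of the tree. -/
def logBits {w : ℕ} (m : Memory w) (T : BinaryTree (BitVec w)) : ℕ :=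
  ∑ i : Fin (2 ^ w),
    if BitVec.ofFin i ∈ treeCells m T then 0 else Nat.size (m (BitVec.ofFin i)).toNat

end EnergyRAM

/-! A program without irreversible operations, branches and loops can be run backwards: invert the
operations, reverse their order, and exchange the two tests of every branch and loop. It uses no
energy, and takes the same time in both directions (`Exec.inv`). So it suffices to write one
reversible AVL insertion, `insertProg`; the reverse operation is `insertProg.inv`. The task is to
arrange that every variable can be cleared again and that a test tells apart any two paths that
meet.

Memory is cut into records of 16 words. Record 0 is a header: field 0 is the root pointer, field 4
the address of the last record allocated. In the record of a node, fields 0 to 3 are key, children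
and parent, and field 4 is the balance: 0, or the field number (1 or 2) of the higher child. The
record of a new key also keeps the log of its own insertion: field 5 is the node where the way up
ended, field 6 says whether there was a rotation, field 7 whether it was single, field 8 is the old
balance of the inner grandchild in a double rotation; field 9 is a nonzero mark. The null pointer is
the address of the header, which thus serves as the parent of the root.

The walks need no log of their steps. On the way down, the position left behind is the parent of the
new one, so the parent pointer erases it; the side taken is recomputed by comparing keys. The way up
passes balanced nodes only, whose balance changes from 0 to the side of the argument, and ends at
the first node with nonzero field 4, possibly the header. There the growth is absorbed, by a change
of balance or by a rotation, and the old height is restored, unless the root itself has grown. Only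
here could information get lost, and the log fields of the new record keep it.

The proof describes a position by a path (a zipper) and a subtree; `Linked` and `Bal` split along it
(`linked_plug`, `bal_plug`). The programs are followed by `iterates_walkDown`, `iterates_walkUp` and
`exists_settle`, which `exists_insert` assembles. If the search path has length `k`, then `k ≤
height ≤ 2 * k`, while `n + 1 ≤ 2 ^ height ≤ (n + 1) ^ 2`; so `k` is logarithmic. The log gains two
addresses, a bounded number of small codes, and at most `k + 10` changed balances of two bits each.
Determinism (`Exec.det`) transfers all this to the arbitrary runs in `Built`. -/

namespace EnergyRAM

/-! ### Determinism -/

/-- Identifies the runs postulated by `Built` with the constructed ones. The memory bounds may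
differ: they decide whether a step is legal, not what it does. -/
theorem Exec.det {S S' w : ℕ} {p : Prog} {s s₁ s₂ : State w} {t t' : ℕ} {e e' : ℝ}
    (h : Exec S p s t e s₁) (h' : Exec S' p s t' e' s₂) : s₁ = s₂ := by
  induction h generalizing t' e' s₂ with
  | skip s => cases h'; rfl
  | op o args s hl hd => cases h'; rfl
  | seq _ _ ih ih' =>
    cases h' with
    | seq g g' => cases ih g; exact ih' g'
  | ifRev_true _ hb _ _ _ ih =>
    cases h' with
    | ifRev_true _ _ g => exact ih g
    | ifRev_false _ hb' => exact absurd hb hb'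
  | ifRev_false _ hb _ _ _ ih =>
    cases h' with
    | ifRev_true _ hb' => exact absurd hb' hb
    | ifRev_false _ _ g => exact ih g
  | ifIrr_true _ hb _ ih =>
    cases h' with
    | ifIrr_true _ _ g => exact ih g
    | ifIrr_false _ hb' => exact absurd hb hb'
  | ifIrr_false _ hb _ ih =>
    cases h' with
    | ifIrr_true _ hb' => exact absurd hb' hb
    | ifIrr_false _ _ g => exact ih g
  | loopRev k σ τ ε h₀ hk hi ha₀ ha hb hbk h ih =>
    cases h' with
    | loopRev k' σ' τ' ε' h₀' hk' hi' ha₀' ha' hb' hbk' g =>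
      -- Two runs of a loop agree as long as both last, and neither can be strictly shorter: its
      -- last state would satisfy and fail the exit test.
      have key : ∀ i, i ≤ k → i ≤ k' → σ i = σ' i := by
        intro i
        induction i with
        | zero => intro _ _; rw [h₀, h₀']
        | succ i IH =>
          intro h1 h2
          have hg := g i h2
          rw [← IH (by omega) (by omega)] at hg
          exact ih i h1 hg
      rcases lt_trichotomy k k' with hlt | heq | hlt
      · exact absurd (key k le_rfl hlt.le ▸ hbk) (hb' k hlt)
      · subst heq; rw [← hk, ← hk', key k le_rfl le_rfl]
      · exact absurd ((key k' hlt.le le_rfl).symm ▸ hbk') (hb k' hlt)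
  | whileIrr k σ τ ε h₀ hk hi hb hbk h ih =>
    cases h' with
    | whileIrr k' σ' τ' ε' h₀' hk' hi' hb' hbk' g =>
      have key : ∀ i, i ≤ k → i ≤ k' → σ i = σ' i := by
        intro i
        induction i with
        | zero => intro _ _; rw [h₀, h₀']
        | succ i IH =>
          intro h1 h2
          have hg := g i h2
          rw [← IH (by omega) (by omega)] at hg
          exact ih i h1 hg
      rcases lt_trichotomy k k' with hlt | heq | hlt
      · exact absurd (hb' k hlt) (key k le_rfl hlt.le ▸ hbk)
      · subst heq; rw [← hk, ← hk', key k le_rfl le_rfl]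
      · exact absurd (hb k' hlt) ((key k' hlt.le le_rfl).symm ▸ hbk')

/-! ### Reversal of programs -/

/-- The inverse of a reversible operation (irreversible ones are left alone). -/
def WordOp.inv : {k : ℕ} → WordOp k → WordOp k
  | _, .add => .sub
  | _, .sub => .add
  | _, .addc c => .subc c
  | _, .subc c => .addc c
  | _, .not => .not
  | _, .swap => .swap
  | _, .le => .invLe
  | _, .invLe => .le
  | _, .eq => .invEq
  | _, .invEq => .eq
  | _, .and => .and
  | _, .or => .or
  | _, .set => .set

/-- The reversible operations. -/
def WordOp.IsRev : {k : ℕ} → WordOp k → Prop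
  | _, .and => False
  | _, .or => False
  | _, .set => False
  | _, _ => True

theorem WordOp.inv_eval {w k : ℕ} (o : WordOp k) (ho : o.IsRev) (v : Fin k → BitVec w) :
    o.inv.eval (o.eval v) = v := by
  cases o <;> simp only [WordOp.IsRev] at ho <;>
    (funext i; fin_cases i <;> simp [WordOp.inv, WordOp.eval]) <;> split_ifs <;> simp

theorem WordOp.eval_mem_dom {w k : ℕ} (o : WordOp k) (ho : o.IsRev) (v : Fin k → BitVec w)
    (hv : v ∈ o.dom w) : o.eval v ∈ o.inv.dom w := by
  cases o <;> simp_all [WordOp.inv, WordOp.eval, WordOp.dom, WordOp.IsRev]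
  rcases hv with h | h <;> simp [h]

/-- A left inverse makes the operation injective, so that input and output spaces have the same
size. -/
theorem WordOp.energy_eq_zero {w k : ℕ} (o : WordOp k) (ho : o.IsRev) : o.energy w = 0 := by
  have h : ((o.eval (w := w)) '' o.dom w).ncard = (o.dom w).ncard :=
    Set.InjOn.ncard_image fun a _ b _ hab => by
      rw [← o.inv_eval ho a, ← o.inv_eval ho b, hab]
  rw [WordOp.energy, h]
  by_cases h0 : ((o.dom w).ncard : ℝ) = 0
  · simp [h0]
  · simp [div_self h0]

theorem extend_extend {α β γ : Type*} {f : α → β} (hf : f.Injective) (g g' : α → γ) (s : β → γ) :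
    Function.extend f g (Function.extend f g' s) = Function.extend f g s := by
  funext x
  by_cases h : ∃ a, f a = x
  · obtain ⟨a, rfl⟩ := h; simp [hf.extend_apply]
  · simp [Function.extend_apply' _ _ _ h]

theorem extend_self {α β γ : Type*} {f : α → β} (hf : f.Injective) (s : β → γ) :
    Function.extend f (fun a => s (f a)) s = s := by
  funext x
  by_cases h : ∃ a, f a = x
  · obtain ⟨a, rfl⟩ := h; simp [hf.extend_apply]
  · simp [Function.extend_apply' _ _ _ h]

/-- The reversible programs. -/
def Prog.IsRev : Prog → Prop
  | .skip => True
  | .op o _ => o.IsRev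
  | .seq c c' => c.IsRev ∧ c'.IsRev
  | .ifRev _ c c' _ => c.IsRev ∧ c'.IsRev
  | .loopRev _ _ c => c.IsRev
  | .ifIrr _ _ _ => False
  | .whileIrr _ _ => False

/-- The inverse of a reversible program. -/
def Prog.inv : Prog → Prog
  | .skip => .skip
  | .op o args => .op o.inv args
  | .seq c c' => .seq c'.inv c.inv
  | .ifRev b c c' b' => .ifRev b' c.inv c'.inv b
  | .loopRev a b c => .loopRev b a c.inv
  | .ifIrr b c c' => .ifIrr b c c'
  | .whileIrr b c => .whileIrr b c

/-- No variable is both operand and address, so the operation leaves every address in place: its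
operands denote the same locations afterwards, and the inverse operation acts on the same words. -/
theorem op_inv {S w k : ℕ} (o : WordOp k) (ho : o.IsRev) (args : Fin k → Operand) (s : State w)
    (hl : Legal S s args) (hd : (fun j => s (s.loc (args j))) ∈ o.dom w) :
    Exec S (.op o.inv args)
      (Function.extend (fun j => s.loc (args j)) (o.eval fun j => s (s.loc (args j))) s) 1 0 s := by
  obtain ⟨hinj, hadr⟩ := hl
  set s' : State w := Function.extend (fun j => s.loc (args j)) (o.eval fun j => s (s.loc (args j))) s
    with hs'
  have hvar : ∀ j i, args j = .ind i → s' (.var i) = s (.var i) := by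
    intro j i hj
    refine Function.extend_apply' _ _ _ ?_
    rintro ⟨a, ha⟩
    have := (hadr j i hj).2 a
    cases haa : args a <;> simp_all [State.loc]
  have hloc : ∀ j, State.loc s' (args j) = s.loc (args j) := by
    intro j
    cases hj : args j with
    | var i => rfl
    | ind i => simp only [State.loc]; rw [hvar j i hj]
  have hval : (fun j => s' (State.loc s' (args j))) = o.eval fun j => s (s.loc (args j)) := by
    funext j
    rw [hloc, hs', hinj.extend_apply]
  have hl' : Legal S s' args := by
    refine ⟨by simpa only [hloc] using hinj, fun j i hj => ⟨?_, (hadr j i hj).2⟩⟩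
    rw [hvar j i hj]; exact (hadr j i hj).1
  have hoi : o.inv.IsRev := by cases o <;> simp_all [WordOp.inv, WordOp.IsRev]
  have := Exec.op (S := S) o.inv args s' hl' (by rw [hval]; exact o.eval_mem_dom ho _ hd)
  rw [o.inv.energy_eq_zero hoi, hval, o.inv_eval ho] at this
  simp only [hloc] at this
  rwa [hs', extend_extend hinj, extend_self hinj] at this

/-- A branch run backwards is decided by its `comefrom` test. A loop run backwards visits the states
`σ k, …, σ 0`; since its entry test fails after every execution of the body, that test can serve as
exit test of the reversed loop. -/
theorem Exec.inv {S w : ℕ} {p : Prog} {s s' : State w} {t : ℕ} {e : ℝ}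
    (h : Exec S p s t e s') (hp : p.IsRev) : e = 0 ∧ Exec S p.inv s' t 0 s := by
  induction h with
  | skip s => exact ⟨rfl, .skip s⟩
  | op o args s hl hd => exact ⟨o.energy_eq_zero hp, op_inv o hp args s hl hd⟩
  | @seq c c' s₀ s₁ s₂ t t' e e' _ _ ih ih' =>
    obtain ⟨h1, h2⟩ := ih hp.1
    obtain ⟨h1', h2'⟩ := ih' hp.2
    refine ⟨by simp [h1, h1'], ?_⟩
    have := Exec.seq h2' h2
    rwa [add_zero, add_comm] at this
  | @ifRev_true b b' c c' s s' t e hi hb _ hi' hb' ih =>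
    obtain ⟨h1, h2⟩ := ih hp.1
    refine ⟨h1, ?_⟩
    rw [show b.size + t + b'.size = b'.size + t + b.size by omega]
    exact .ifRev_true hi' hb' h2 hi hb
  | @ifRev_false b b' c c' s s' t e hi hb _ hi' hb' ih =>
    obtain ⟨h1, h2⟩ := ih hp.2
    refine ⟨h1, ?_⟩
    rw [show b.size + t + b'.size = b'.size + t + b.size by omega]
    exact .ifRev_false hi' hb' h2 hi hb
  | ifIrr_true => exact hp.elim
  | ifIrr_false => exact hp.elim
  | whileIrr => exact hp.elim
  | @loopRev a b c s s' k σ τ ε h₀ hk hi ha₀ ha hb hbk h ih =>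
    have hc : c.IsRev := hp
    refine ⟨Finset.sum_eq_zero fun i hi => (ih i (Finset.mem_range.1 hi) hc).1, ?_⟩
    have := Exec.loopRev (S := S) (a := b) (b := a) (c := c.inv) (s := s') (s' := s) k
      (fun i => σ (k - i)) (fun i => τ (k - 1 - i)) (fun _ => 0) (by simpa using hk)
      (by simpa using h₀) (fun i _ => (hi (k - i) (by omega)).symm) (by simpa using hbk)
      (fun i hik => hb _ (by omega))
      (fun i hik => by
        have := ha (k - i - 1) (by omega)
        rwa [show k - i - 1 + 1 = k - i by omega] at this)
      (by simpa using ha₀)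
      (fun i hik => by
        have := (ih (k - 1 - i) (by omega) hc).2
        rw [show k - 1 - i + 1 = k - i by omega] at this
        simpa only [show k - (i + 1) = k - 1 - i by omega] using this)
    rw [Finset.sum_range_reflect τ k, Finset.sum_const_zero, add_comm b.size] at this
    exact this

/-! ### Runs with a time bound -/

/-- The program `p` runs from `s` to `s'` in time at most `T`. -/
def Runs (S : ℕ) {w : ℕ} (p : Prog) (T : ℕ) (s s' : State w) : Prop :=
  ∃ t e, t ≤ T ∧ Exec S p s t e s'

theorem Runs.mono {S w : ℕ} {p : Prog} {T T' : ℕ} {s s' : State w} (h : Runs S p T s s')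
    (hT : T ≤ T') : Runs S p T' s s' := by
  obtain ⟨t, e, ht, h⟩ := h
  exact ⟨t, e, ht.trans hT, h⟩

theorem Runs.skip {S w : ℕ} (s : State w) : Runs S .skip 0 s s := ⟨0, 0, le_rfl, .skip s⟩

theorem Runs.seq {S w : ℕ} {p q : Prog} {T T' : ℕ} {s s' s'' : State w} (h : Runs S p T s s')
    (h' : Runs S q T' s' s'') : Runs S (.seq p q) (T + T') s s'' := by
  obtain ⟨t, e, ht, h⟩ := h
  obtain ⟨t', e', ht', h'⟩ := h'
  exact ⟨t + t', e + e', by omega, h.seq h'⟩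

theorem Runs.ifRev_true {S w : ℕ} {b b' : Test} {p q : Prog} {T : ℕ} {s s' : State w}
    (hi : b.InBounds S s) (hi' : b'.InBounds S s') (hb : b.Holds s) (h : Runs S p T s s')
    (hb' : b'.Holds s') : Runs S (.ifRev b p q b') (b.size + T + b'.size) s s' := by
  obtain ⟨t, e, ht, h⟩ := h
  exact ⟨_, e, by omega, .ifRev_true hi hb h hi' hb'⟩

theorem Runs.ifRev_false {S w : ℕ} {b b' : Test} {p q : Prog} {T : ℕ} {s s' : State w}
    (hi : b.InBounds S s) (hi' : b'.InBounds S s') (hb : ¬ b.Holds s) (h : Runs S q T s s')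
    (hb' : ¬ b'.Holds s') : Runs S (.ifRev b p q b') (b.size + T + b'.size) s s' := by
  obtain ⟨t, e, ht, h⟩ := h
  exact ⟨_, e, by omega, .ifRev_false hi hb h hi' hb'⟩

/-- `k` iterations of the body `c` of a reversible loop, from `s` to `s'`, each in time at most
`T`. -/
inductive Iterates (S : ℕ) {w : ℕ} (a b : Test) (c : Prog) (T : ℕ) : ℕ → State w → State w → Prop
  | done {s : State w} (ha : a.InBounds S s) (hb : b.InBounds S s) (h : b.Holds s) :
      Iterates S a b c T 0 s s
  | step {k : ℕ} {s s₁ s' : State w} (ha : a.InBounds S s) (hb : b.InBounds S s)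
      (h : ¬ b.Holds s) (hc : Runs S c T s s₁) (h₁ : ¬ a.Holds s₁)
      (hk : Iterates S a b c T k s₁ s') : Iterates S a b c T (k + 1) s s'

/-- Passes from the recursive form of a loop, suited to inductions along a path, to the sequences in
`Exec.loopRev`. -/
theorem Iterates.exists_seq {S w : ℕ} {a b : Test} {c : Prog} {T k : ℕ} {s s' : State w}
    (h : Iterates S a b c T k s s') :
    ∃ (σ : ℕ → State w) (τ : ℕ → ℕ) (ε : ℕ → ℝ), σ 0 = s ∧ σ k = s' ∧
      (∀ i ≤ k, a.InBounds S (σ i) ∧ b.InBounds S (σ i)) ∧ (∀ i < k, ¬ a.Holds (σ (i + 1))) ∧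
      (∀ i < k, ¬ b.Holds (σ i)) ∧ b.Holds (σ k) ∧ (∀ i, τ i ≤ T) ∧
      ∀ i < k, Exec S c (σ i) (τ i) (ε i) (σ (i + 1)) := by
  induction h with
  | @done s ha hb h =>
    exact ⟨fun _ => s, fun _ => 0, fun _ => 0, rfl, rfl, fun _ _ => ⟨ha, hb⟩, by simp, by simp, h,
      by simp, by simp⟩
  | @step k s s₁ s' ha hb h hc h₁ hk ih =>
    obtain ⟨σ, τ, ε, h0, hk, h2, h3, h4, h5, h6, h7⟩ := ih
    obtain ⟨t, e, ht, hc⟩ := hc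
    refine ⟨fun i => Nat.casesOn i s σ, fun i => Nat.casesOn i t τ, fun i => Nat.casesOn i e ε,
      rfl, hk, ?_, ?_, ?_, h5, ?_, ?_⟩
    · rintro (_ | i) hi
      · exact ⟨ha, hb⟩
      · exact h2 i (by omega)
    · rintro (_ | i) hi
      · simpa [h0] using h₁
      · exact h3 i (by omega)
    · rintro (_ | i) hi
      · exact h
      · exact h4 i (by omega)
    · rintro (_ | i)
      · exact ht
      · exact h6 i
    · rintro (_ | i) hi
      · simpa [h0] using hc
      · exact h7 i (by omega)

/-- The bound `k < t` stems from the `k + 1` evaluations of the tests alone; it is the source of the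
lower bound on the running time. -/
theorem Iterates.exec {S w : ℕ} {a b : Test} {c : Prog} {T k : ℕ} {s s' : State w}
    (h : Iterates S a b c T k s s') (ha : a.Holds s) :
    ∃ t e, k < t ∧ t ≤ (k + 1) * (a.size + b.size) + k * T ∧
      Exec S (.loopRev a b c) s t e s' := by
  obtain ⟨σ, τ, ε, h0, hk, h2, h3, h4, h5, h6, h7⟩ := h.exists_seq
  refine ⟨_, _, ?_, ?_, Exec.loopRev k σ τ ε h0 hk h2 (h0 ▸ ha) h3 h4 h5 h7⟩
  · have : 1 ≤ a.size := by cases a <;> simp [Test.size]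
    nlinarith [Nat.zero_le (∑ i ∈ Finset.range k, τ i)]
  · have := Finset.sum_le_card_nsmul (Finset.range k) τ T fun i _ => h6 i
    simp only [Finset.card_range, smul_eq_mul] at this
    exact Nat.add_le_add_left this _

/-! ### Heaps of records -/

/-- The memory seen as a sequence of records of `16` words. -/
abbrev Heap (w : ℕ) := ℕ → ℕ → BitVec w

/-- The address of field `k` of record `i`. -/
def ad (w i k : ℕ) : BitVec w := BitVec.ofNat w (16 * i + k)

/-- The memory that holds the records of a heap. -/
def Heap.mem {w : ℕ} (H : Heap w) : Memory w := fun a => H (a.toNat / 16) (a.toNat % 16)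

/-- Overwrite field `k` of record `i`. -/
def Heap.upd {w : ℕ} (H : Heap w) (i k : ℕ) (v : BitVec w) : Heap w :=
  fun i' k' => if i' = i ∧ k' = k then v else H i' k'

/-- The state with values `l` of the variables `0, 1, …` and with memory `H`. -/
def st {w : ℕ} (l : List (BitVec w)) (H : Heap w) : State w
  | .var i => l.getD i 0
  | .mem a => H.mem a

noncomputable instance (w : ℕ) : DecidableEq (Loc w) := Classical.decEq _

/-- The hypothesis `hM`, carried through most of the file, says that the records `0, …, M` fit into
the address space, so that address arithmetic does not wrap around. -/
theorem ad_toNat {w M i k : ℕ} (hM : 16 * (M + 1) ≤ 2 ^ w) (hi : i ≤ M) (hk : k < 16) :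
    (ad w i k).toNat = 16 * i + k := by
  rw [ad, BitVec.toNat_ofNat, Nat.mod_eq_of_lt (by omega)]

theorem Heap.mem_ad {w M i k : ℕ} (hM : 16 * (M + 1) ≤ 2 ^ w) (H : Heap w) (hi : i ≤ M)
    (hk : k < 16) : H.mem (ad w i k) = H i k := by
  rw [Heap.mem, ad_toNat hM hi hk]
  congr 1 <;> omega

theorem ad_inj {w M i k i' k' : ℕ} (hM : 16 * (M + 1) ≤ 2 ^ w) (hi : i ≤ M) (hk : k < 16)
    (hi' : i' ≤ M) (hk' : k' < 16) : ad w i k = ad w i' k' ↔ i = i' ∧ k = k' := by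
  refine ⟨fun h => ?_, fun ⟨h, h'⟩ => by rw [h, h']⟩
  have := congrArg BitVec.toNat h
  rw [ad_toNat hM hi hk, ad_toNat hM hi' hk'] at this
  omega

theorem ad_eq_zero {w M i : ℕ} (hM : 16 * (M + 1) ≤ 2 ^ w) (hi : i ≤ M) :
    ad w i 0 = 0#w ↔ i = 0 := by
  have : 0#w = ad w 0 0 := rfl
  rw [this, ad_inj hM hi (by omega) (by omega) (by omega)]
  simp

theorem ad_zero (w : ℕ) : ad w 0 0 = 0#w := rfl

theorem ad_add_ofNat (w i k : ℕ) : ad w i 0 + BitVec.ofNat w k = ad w i k := by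
  rw [ad, ad, ← BitVec.ofNat_add]; rfl

theorem ad_sub_ofNat (w i k : ℕ) : ad w i k - BitVec.ofNat w k = ad w i 0 := by
  rw [← ad_add_ofNat, BitVec.add_sub_cancel]

/-- `hM` also forces `16 ≤ 2 ^ w`, so that the small codes of sides, balances and flags are distinct
words. -/
theorem ofNat_inj {w M k k' : ℕ} (hM : 16 * (M + 1) ≤ 2 ^ w) (hk : k < 16) (hk' : k' < 16) :
    BitVec.ofNat w k = BitVec.ofNat w k' ↔ k = k' := by
  have := ad_inj hM (Nat.zero_le M) hk (Nat.zero_le M) hk'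
  simpa [ad] using this

theorem update_st_var {w : ℕ} (l : List (BitVec w)) (H : Heap w) (i : ℕ) (v : BitVec w)
    (hi : i < l.length) : Function.update (st l H) (.var i) v = st (l.set i v) H := by
  funext x
  cases x with
  | var j =>
    by_cases h : j = i
    · subst h; simp [st, hi]
    · simp [st, h, List.getD, List.getElem?_set_ne (Ne.symm h)]
  | mem a => simp [st]

theorem update_st_mem {w M : ℕ} (hM : 16 * (M + 1) ≤ 2 ^ w) (l : List (BitVec w)) (H : Heap w)
    {i k : ℕ} (hi : i ≤ M) (hk : k < 16) (v : BitVec w) :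
    Function.update (st l H) (.mem (ad w i k)) v = st l (H.upd i k v) := by
  funext x
  cases x with
  | var j => simp [st]
  | mem a =>
    by_cases h : a = ad w i k
    · subst h
      simp only [Function.update_self, st]
      rw [Heap.mem_ad hM _ hi hk]; simp [Heap.upd]
    · have h' : ¬ (a.toNat / 16 = i ∧ a.toNat % 16 = k) := fun ⟨h1, h2⟩ => h (by
        apply BitVec.eq_of_toNat_eq
        rw [ad_toNat hM hi hk]; omega)
      simp [st, h, Heap.mem, Heap.upd, h']

/-! ### Single operations -/

/-- Here and in the next two lemmas, the simultaneous overwrite of all operands by `Function.extend`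
is rewritten with single updates. -/
theorem exec_op_one {S w : ℕ} (o : WordOp 1) (x : Operand) (s : State w)
    (hl : ∀ i, x = .ind i → (s (.var i)).toNat < S) (hd : ![s (s.loc x)] ∈ o.dom w) :
    Runs S (.op o ![x]) 1 s (Function.update s (s.loc x) (o.eval ![s (s.loc x)] 0)) := by
  have hinj : Function.Injective fun j : Fin 1 => State.loc s (![x] j) :=
    Function.injective_of_subsingleton _
  have hv : (fun j : Fin 1 => s (State.loc s (![x] j))) = ![s (s.loc x)] := by
    funext j; fin_cases j; rfl
  have := Exec.op (S := S) o ![x] s ⟨hinj, fun j i hj => by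
    fin_cases j
    refine ⟨hl i hj, fun j' => ?_⟩
    fin_cases j'
    simp at hj
    simp [hj]⟩ (by rw [hv]; exact hd)
  refine ⟨1, o.energy w, le_rfl, ?_⟩
  convert this using 1
  funext y
  by_cases h : y = s.loc x
  · subst h
    rw [Function.update_self, hv]
    exact (hinj.extend_apply (o.eval _) s 0).symm
  · rw [Function.update_of_ne h, Function.extend_apply']
    rintro ⟨j, hj⟩
    fin_cases j
    exact h hj.symm

theorem exec_op_two {S w : ℕ} (o : WordOp 2) (x y : Operand) (s : State w)
    (hl : s.loc x ≠ s.loc y) (hx : ∀ i, x = .ind i → (s (.var i)).toNat < S ∧ y ≠ .var i)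
    (hy : ∀ i, y = .ind i → (s (.var i)).toNat < S ∧ x ≠ .var i)
    (hd : ![s (s.loc x), s (s.loc y)] ∈ o.dom w) :
    Runs S (.op o ![x, y]) 1 s
      (Function.update (Function.update s (s.loc x) (o.eval ![s (s.loc x), s (s.loc y)] 0))
        (s.loc y) (o.eval ![s (s.loc x), s (s.loc y)] 1)) := by
  have hinj : Function.Injective fun j : Fin 2 => State.loc s (![x, y] j) := by
    intro j j' h
    fin_cases j <;> fin_cases j' <;> simp_all
  have hv : (fun j : Fin 2 => s (State.loc s (![x, y] j))) = ![s (s.loc x), s (s.loc y)] := by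
    funext j; fin_cases j <;> rfl
  have := Exec.op (S := S) o ![x, y] s ⟨hinj, fun j i hj => by
    fin_cases j
    · refine ⟨(hx i hj).1, fun j' => ?_⟩
      fin_cases j'
      · intro h; simp at h hj; simp [h] at hj
      · exact (hx i hj).2
    · refine ⟨(hy i hj).1, fun j' => ?_⟩
      fin_cases j'
      · exact (hy i hj).2
      · intro h; simp at h hj; simp [h] at hj⟩ (by rw [hv]; exact hd)
  refine ⟨1, o.energy w, le_rfl, ?_⟩
  convert this using 1
  funext z
  by_cases h : z = s.loc y
  · subst h
    rw [Function.update_self, hv]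
    exact (hinj.extend_apply (o.eval _) s 1).symm
  · rw [Function.update_of_ne h]
    by_cases h' : z = s.loc x
    · subst h'
      rw [Function.update_self, hv]
      exact (hinj.extend_apply (o.eval _) s 0).symm
    · rw [Function.update_of_ne h', Function.extend_apply']
      rintro ⟨j, hj⟩
      fin_cases j
      · exact h' hj.symm
      · exact h hj.symm

theorem exec_op_var_three {S w : ℕ} (o : WordOp 3) (i j k : ℕ) (s : State w)
    (hij : i ≠ j) (hik : i ≠ k) (hjk : j ≠ k)
    (hd : ![s (.var i), s (.var j), s (.var k)] ∈ o.dom w)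
    (h0 : o.eval ![s (.var i), s (.var j), s (.var k)] 0 = s (.var i))
    (h1 : o.eval ![s (.var i), s (.var j), s (.var k)] 1 = s (.var j)) :
    Runs S (.op o ![.var i, .var j, .var k]) 1 s
      (Function.update s (.var k) (o.eval ![s (.var i), s (.var j), s (.var k)] 2)) := by
  have hinj : Function.Injective
      fun a : Fin 3 => State.loc s (![Operand.var i, .var j, .var k] a) := by
    intro a a' h
    fin_cases a <;> fin_cases a' <;> simp_all [State.loc]
  have hv : (fun a : Fin 3 => s (State.loc s (![Operand.var i, .var j, .var k] a))) =
      ![s (.var i), s (.var j), s (.var k)] := by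
    funext a; fin_cases a <;> rfl
  have := Exec.op (S := S) o ![Operand.var i, .var j, .var k] s ⟨hinj, fun a b hab => by
    fin_cases a <;> simp at hab⟩ (by rw [hv]; exact hd)
  refine ⟨1, o.energy w, le_rfl, ?_⟩
  convert this using 1
  funext z
  by_cases h : z = .var k
  · subst h
    rw [Function.update_self, hv]
    exact (hinj.extend_apply (o.eval _) s 2).symm
  · rw [Function.update_of_ne h]
    by_cases hi : z = .var i
    · subst hi
      rw [hv]; exact ((hinj.extend_apply (o.eval _) s 0).trans h0).symm
    · by_cases hj : z = .var j
      · subst hj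
        rw [hv]; exact ((hinj.extend_apply (o.eval _) s 1).trans h1).symm
      · rw [Function.extend_apply']
        rintro ⟨a, ha⟩
        fin_cases a
        · exact hi ha.symm
        · exact hj ha.symm
        · exact h ha.symm

/-! ### Instructions -/

/-- Add the constant `c` to a variable. -/
def addC (i c : ℕ) : Prog := .op (.addc c) ![.var i]

/-- Subtract the constant `c` from a variable. -/
def subC (i c : ℕ) : Prog := .op (.subc c) ![.var i]

/-- Add the variable `j` to the variable `i`. -/
def addV (i j : ℕ) : Prog := .op .add ![.var i, .var j]

/-- Subtract the variable `j` from the variable `i`. -/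
def subV (i j : ℕ) : Prog := .op .sub ![.var i, .var j]

/-- Swap two variables. -/
def swapV (i j : ℕ) : Prog := .op .swap ![.var i, .var j]

/-- Offsets of fields: a constant, or the value of a variable. -/
inductive Off where
  | c (k : ℕ)
  | v (d : ℕ)

/-- The value of an offset. -/
def Off.val {w : ℕ} (l : List (BitVec w)) : Off → BitVec w
  | .c k => BitVec.ofNat w k
  | .v d => l.getD d 0

/-- The variable `j` is not used in the offset. -/
def Off.Avoids (j : ℕ) : Off → Prop
  | .c _ => True
  | .v d => d ≠ j

/-- Run an operation on a field of the record to which the variable `j` points. -/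
def atField (j : ℕ) (f : Off) (p : Prog) : Prog :=
  match f with
  | .c k => .seq (addC j k) (.seq p (subC j k))
  | .v d => .seq (addV j d) (.seq p (subV j d))

/-- Add a field of the record at `j` to the variable `i`. -/
def load (i j : ℕ) (f : Off) : Prog := atField j f (.op .add ![.var i, .ind j])

/-- Subtract a field of the record at `j` from the variable `i`. -/
def unload (i j : ℕ) (f : Off) : Prog := atField j f (.op .sub ![.var i, .ind j])

/-- Add the variable `i` to a field of the record at `j`. -/
def store (i j : ℕ) (f : Off) : Prog := atField j f (.op .add ![.ind j, .var i])

/-- Subtract the variable `i` from a field of the record at `j`. -/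
def unstore (i j : ℕ) (f : Off) : Prog := atField j f (.op .sub ![.ind j, .var i])

section instructions

variable {S w M : ℕ} {l : List (BitVec w)} {H : Heap w}

theorem runs_addC (i c : ℕ) (hi : i < l.length) :
    Runs S (addC i c) 1 (st l H) (st (l.set i (l.getD i 0 + BitVec.ofNat w c)) H) := by
  have := exec_op_one (S := S) (.addc c) (.var i) (st l H) (by simp) (by simp [WordOp.dom])
  rwa [State.loc, update_st_var _ _ _ _ hi] at this

theorem runs_subC (i c : ℕ) (hi : i < l.length) :
    Runs S (subC i c) 1 (st l H) (st (l.set i (l.getD i 0 - BitVec.ofNat w c)) H) := by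
  have := exec_op_one (S := S) (.subc c) (.var i) (st l H) (by simp) (by simp [WordOp.dom])
  rwa [State.loc, update_st_var _ _ _ _ hi] at this

theorem runs_addV (i j : ℕ) (hij : i ≠ j) (hi : i < l.length) :
    Runs S (addV i j) 1 (st l H) (st (l.set i (l.getD i 0 + l.getD j 0)) H) := by
  have := exec_op_two (S := S) .add (.var i) (.var j) (st l H) (by simpa [State.loc] using hij)
    (by simp) (by simp) (by simp [WordOp.dom])
  simp only [State.loc, WordOp.eval] at this
  rwa [update_st_var _ _ _ _ hi, Function.update_eq_self_iff.2 ] at this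
  simp [st, List.getD, List.getElem?_set_ne hij]

theorem runs_subV (i j : ℕ) (hij : i ≠ j) (hi : i < l.length) :
    Runs S (subV i j) 1 (st l H) (st (l.set i (l.getD i 0 - l.getD j 0)) H) := by
  have := exec_op_two (S := S) .sub (.var i) (.var j) (st l H) (by simpa [State.loc] using hij)
    (by simp) (by simp) (by simp [WordOp.dom])
  simp only [State.loc, WordOp.eval] at this
  rwa [update_st_var _ _ _ _ hi, Function.update_eq_self_iff.2 ] at this
  simp [st, List.getD, List.getElem?_set_ne hij]

theorem runs_swapV (i j : ℕ) (hij : i ≠ j) (hi : i < l.length) (hj : j < l.length) :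
    Runs S (swapV i j) 1 (st l H) (st ((l.set i (l.getD j 0)).set j (l.getD i 0)) H) := by
  have := exec_op_two (S := S) .swap (.var i) (.var j) (st l H) (by simpa [State.loc] using hij)
    (by simp) (by simp) (by simp [WordOp.dom])
  simp only [State.loc, WordOp.eval] at this
  rwa [update_st_var _ _ _ _ hi, update_st_var _ _ _ _ (by simpa using hj)] at this

theorem runs_invLe (i j k : ℕ) (hij : i ≠ j) (hik : i ≠ k) (hjk : j ≠ k) (hk : k < l.length) :
    Runs S (.op .invLe ![.var i, .var j, .var k]) 1 (st l H)
      (st (l.set k (if l.getD i 0 ≤ l.getD j 0 then l.getD k 0 - 1 else l.getD k 0)) H) := by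
  have := exec_op_var_three (S := S) .invLe i j k (st l H) hij hik hjk (by simp [WordOp.dom])
    rfl rfl
  rwa [update_st_var _ _ _ _ hk] at this

theorem runs_eq (i j k : ℕ) (hij : i ≠ j) (hik : i ≠ k) (hjk : j ≠ k) (hk : k < l.length) :
    Runs S (.op .eq ![.var i, .var j, .var k]) 1 (st l H)
      (st (l.set k (if l.getD i 0 = l.getD j 0 then l.getD k 0 + 1 else l.getD k 0)) H) := by
  have := exec_op_var_three (S := S) .eq i j k (st l H) hij hik hjk (by simp [WordOp.dom])
    rfl rfl
  rwa [update_st_var _ _ _ _ hk] at this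

theorem getD_set_of_ne {i j : ℕ} (hij : i ≠ j) (v : BitVec w) :
    (l.set i v).getD j 0 = l.getD j 0 := by
  simp [List.getD, List.getElem?_set_ne hij]

theorem getD_set_self {i : ℕ} (hi : i < l.length) (v : BitVec w) :
    (l.set i v).getD i 0 = v := by
  simp [hi]

/-- The pointer is shifted to the field and back. The list `l'` describes the variables after `p`,
while the pointer is still shifted; the offset must have kept its value for the shift back to be
right. -/
theorem runs_atField {p : Prog} {j a k : ℕ} {f : Off} {T : ℕ} {l' : List (BitVec w)} {H' : Heap w}
    (hjl : j < l.length) (hjl' : j < l'.length)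
    (hj : l.getD j 0 = ad w a 0) (hf : f.val l = BitVec.ofNat w k) (hfj : f.Avoids j)
    (hj' : l'.getD j 0 = ad w a k) (hf' : f.val l' = BitVec.ofNat w k)
    (h : Runs S p T (st (l.set j (ad w a k)) H) (st l' H')) :
    Runs S (atField j f p) (T + 2) (st l H) (st (l'.set j (ad w a 0)) H') := by
  cases f with
  | c o =>
    have h1 := runs_addC (S := S) (H := H) j o hjl
    have h2 := runs_subC (S := S) (H := H') j o hjl'
    rw [hj, show BitVec.ofNat w o = _ from hf, ad_add_ofNat] at h1
    rw [hj', show BitVec.ofNat w o = _ from hf, ad_sub_ofNat] at h2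
    exact (h1.seq (h.seq h2)).mono (by omega)
  | v d =>
    have hd : j ≠ d := Ne.symm hfj
    have h1 := runs_addV (S := S) (H := H) j d hd hjl
    have h2 := runs_subV (S := S) (H := H') j d hd hjl'
    rw [hj, show l.getD d 0 = _ from hf, ad_add_ofNat] at h1
    rw [hj', show l'.getD d 0 = _ from hf', ad_sub_ofNat] at h2
    exact (h1.seq (h.seq h2)).mono (by omega)

theorem Off.val_set {f : Off} {j : ℕ} (hf : f.Avoids j) (v : BitVec w) :
    f.val (l.set j v) = f.val l := by
  cases f with
  | c k => rfl
  | v d => exact getD_set_of_ne (Ne.symm hf) v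

theorem set_set_set {i j : ℕ} {u v v' : BitVec w} (hij : i ≠ j) (hl : l.getD j 0 = u)
    (hj : j < l.length) : (((l.set j v).set i v').set j u) = l.set i v' := by
  rw [List.set_comm _ _ hij, List.set_set]
  congr 1
  subst hl
  apply List.ext_getElem (by simp)
  intro n h1 h2
  by_cases h : n = j
  · subst h; simp [hj]
  · rw [List.getElem_set_ne (Ne.symm h)]

theorem set_getD {j : ℕ} {u v : BitVec w} (hl : l.getD j 0 = u)
    (hj : j < l.length) : ((l.set j v).set j u) = l := by
  rw [List.set_set]
  subst hl
  apply List.ext_getElem (by simp)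
  intro n h1 h2
  by_cases h : n = j
  · subst h; simp [hj]
  · rw [List.getElem_set_ne (Ne.symm h)]

variable (hM : 16 * (M + 1) ≤ 2 ^ w) (hS : 16 * (M + 1) ≤ S)
include hM hS

theorem runs_load {i j a k : ℕ} {f : Off} (hi : i < l.length) (hjl : j < l.length) (hij : i ≠ j)
    (hfi : f.Avoids i) (hfj : f.Avoids j) (hj : l.getD j 0 = ad w a 0)
    (hf : f.val l = BitVec.ofNat w k) (ha : a ≤ M) (hk : k < 16) :
    Runs S (load i j f) 3 (st l H) (st (l.set i (l.getD i 0 + H a k)) H) := by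
  have h1 := exec_op_two (S := S) .add (.var i) (.ind j) (st (l.set j (ad w a k)) H)
    (by simp [State.loc]) (by simp)
    (by
      rintro _ ⟨⟩
      refine ⟨?_, by simpa using hij⟩
      simp only [st]; rw [getD_set_self hjl, ad_toNat hM ha hk]; omega) (by simp [WordOp.dom])
  have h2 : State.loc (st (l.set j (ad w a k)) H) (.ind j) = .mem (ad w a k) := by
    simp [State.loc, st, hjl]
  rw [Function.update_eq_self_iff.2 (by simp [State.loc, WordOp.eval]), h2] at h1
  simp only [State.loc, WordOp.eval] at h1
  rw [update_st_var _ _ _ _ (by simpa using hi)] at h1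
  have h3 := runs_atField hjl (by simpa using hjl) hj hf hfj
    (by rw [getD_set_of_ne hij, getD_set_self hjl])
    (by rw [Off.val_set hfi, Off.val_set hfj, hf]) h1
  rw [set_set_set hij hj hjl] at h3
  simpa [load, st, Heap.mem_ad hM H ha hk, List.getD, List.getElem?_set_ne hij.symm] using h3

theorem runs_unload {i j a k : ℕ} {f : Off} (hi : i < l.length) (hjl : j < l.length) (hij : i ≠ j)
    (hfi : f.Avoids i) (hfj : f.Avoids j) (hj : l.getD j 0 = ad w a 0)
    (hf : f.val l = BitVec.ofNat w k) (ha : a ≤ M) (hk : k < 16) :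
    Runs S (unload i j f) 3 (st l H) (st (l.set i (l.getD i 0 - H a k)) H) := by
  have h1 := exec_op_two (S := S) .sub (.var i) (.ind j) (st (l.set j (ad w a k)) H)
    (by simp [State.loc]) (by simp)
    (by
      rintro _ ⟨⟩
      refine ⟨?_, by simpa using hij⟩
      simp only [st]; rw [getD_set_self hjl, ad_toNat hM ha hk]; omega) (by simp [WordOp.dom])
  have h2 : State.loc (st (l.set j (ad w a k)) H) (.ind j) = .mem (ad w a k) := by
    simp [State.loc, st, hjl]
  rw [Function.update_eq_self_iff.2 (by simp [State.loc, WordOp.eval]), h2] at h1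
  simp only [State.loc, WordOp.eval] at h1
  rw [update_st_var _ _ _ _ (by simpa using hi)] at h1
  have h3 := runs_atField hjl (by simpa using hjl) hj hf hfj
    (by rw [getD_set_of_ne hij, getD_set_self hjl])
    (by rw [Off.val_set hfi, Off.val_set hfj, hf]) h1
  rw [set_set_set hij hj hjl] at h3
  simpa [unload, st, Heap.mem_ad hM H ha hk, List.getD, List.getElem?_set_ne hij.symm] using h3

theorem runs_store {i j a k : ℕ} {f : Off} (hjl : j < l.length) (hij : i ≠ j)
    (hfj : f.Avoids j) (hj : l.getD j 0 = ad w a 0)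
    (hf : f.val l = BitVec.ofNat w k) (ha : a ≤ M) (hk : k < 16) :
    Runs S (store i j f) 3 (st l H) (st l (H.upd a k (H a k + l.getD i 0))) := by
  have h1 := exec_op_two (S := S) .add (.ind j) (.var i) (st (l.set j (ad w a k)) H)
    (by simp [State.loc])
    (by
      rintro _ ⟨⟩
      refine ⟨?_, by simpa using hij⟩
      simp only [st]; rw [getD_set_self hjl, ad_toNat hM ha hk]; omega)
    (by simp) (by simp [WordOp.dom])
  have h2 : State.loc (st (l.set j (ad w a k)) H) (.ind j) = .mem (ad w a k) := by
    simp [State.loc, st, hjl]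
  rw [Function.update_eq_self_iff.2 (by simp [State.loc, WordOp.eval]), h2] at h1
  simp only [State.loc, WordOp.eval] at h1
  rw [update_st_mem hM _ _ ha hk] at h1
  have h3 := runs_atField hjl (by simpa using hjl) hj hf hfj (getD_set_self hjl _)
    (by rw [Off.val_set hfj, hf]) h1
  rw [set_getD hj hjl] at h3
  simpa [store, st, Heap.mem_ad hM H ha hk, List.getD, List.getElem?_set_ne hij.symm] using h3

theorem runs_unstore {i j a k : ℕ} {f : Off} (hjl : j < l.length) (hij : i ≠ j)
    (hfj : f.Avoids j) (hj : l.getD j 0 = ad w a 0)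
    (hf : f.val l = BitVec.ofNat w k) (ha : a ≤ M) (hk : k < 16) :
    Runs S (unstore i j f) 3 (st l H) (st l (H.upd a k (H a k - l.getD i 0))) := by
  have h1 := exec_op_two (S := S) .sub (.ind j) (.var i) (st (l.set j (ad w a k)) H)
    (by simp [State.loc])
    (by
      rintro _ ⟨⟩
      refine ⟨?_, by simpa using hij⟩
      simp only [st]; rw [getD_set_self hjl, ad_toNat hM ha hk]; omega)
    (by simp) (by simp [WordOp.dom])
  have h2 : State.loc (st (l.set j (ad w a k)) H) (.ind j) = .mem (ad w a k) := by
    simp [State.loc, st, hjl]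
  rw [Function.update_eq_self_iff.2 (by simp [State.loc, WordOp.eval]), h2] at h1
  simp only [State.loc, WordOp.eval] at h1
  rw [update_st_mem hM _ _ ha hk] at h1
  have h3 := runs_atField hjl (by simpa using hjl) hj hf hfj (getD_set_self hjl _)
    (by rw [Off.val_set hfj, hf]) h1
  rw [set_getD hj hjl] at h3
  simpa [unstore, st, Heap.mem_ad hM H ha hk, List.getD, List.getElem?_set_ne hij.symm] using h3

end instructions

/-! ### Trees of record numbers, and paths in them -/

/-- The field with the pointer to the child on the side `d` (`true` is left). -/
def fld (d : Bool) : ℕ := bif d then 1 else 2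

/-- The tree with root `i`, subtree `a` on the side `d`, and subtree `b` on the other side. -/
def nd (d : Bool) (i : ℕ) (a b : BinaryTree ℕ) : BinaryTree ℕ :=
  match d with
  | true => .node i a b
  | false => .node i b a

/-- A path to a subtree, from the bottom up: the nodes above it, on which side each is left, and
the subtree on the other side. -/
abbrev Path := List (ℕ × Bool × BinaryTree ℕ)

/-- The tree in which the path `c` leads to the subtree `t`. -/
def plug : Path → BinaryTree ℕ → BinaryTree ℕ
  | [], t => t
  | (i, d, b) :: c, t => plug c (nd d i t b)

/-- The label of the root, `0` for the empty tree. -/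
def rt : BinaryTree ℕ → ℕ
  | .nil => 0
  | .node i _ _ => i

/-- The last node on a path, `0` for the empty path. -/
def Path.top : Path → ℕ
  | [] => 0
  | (i, _, _) :: _ => i

/-- The field of the last node on a path that points to the subtree. -/
def Path.side : Path → ℕ
  | [] => 0
  | (_, d, _) :: _ => fld d

/-- The labels in symmetric order. -/
def lab : BinaryTree ℕ → List ℕ
  | .nil => []
  | .node i l r => lab l ++ i :: lab r

/-- The labels off the subtree to which a path leads. -/
def Path.labs : Path → List ℕ
  | [] => []
  | (i, _, b) :: c => i :: (lab b ++ labs c)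

/-- The labels on a path. -/
def Path.nodes (c : Path) : List ℕ := c.map Prod.fst

/-- The labels before those of the subtree to which a path leads. -/
def Path.before : Path → List ℕ
  | [] => []
  | (i, d, b) :: c => before c ++ bif d then [] else lab b ++ [i]

/-- The labels after those of the subtree to which a path leads. -/
def Path.after : Path → List ℕ
  | [] => []
  | (i, d, b) :: c => (bif d then i :: lab b else []) ++ after c

theorem fld_lt (d : Bool) : fld d < 3 := by cases d <;> decide
theorem fld_pos (d : Bool) : 0 < fld d := by cases d <;> decide
theorem fld_ne_not (d : Bool) : fld d ≠ fld (!d) := by cases d <;> decide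
theorem fld_add (d : Bool) : fld d + fld (!d) = 3 := by cases d <;> rfl

theorem rt_nd (d : Bool) (i : ℕ) (a b : BinaryTree ℕ) : rt (nd d i a b) = i := by cases d <;> rfl

theorem height_nd (d : Bool) (i : ℕ) (a b : BinaryTree ℕ) :
    (nd d i a b).height = max a.height b.height + 1 := by
  cases d <;> simp [nd, max_comm]

theorem nd_not (d : Bool) (i : ℕ) (a b : BinaryTree ℕ) : nd (!d) i a b = nd d i b a := by
  cases d <;> rfl

theorem exists_eq_nd (d : Bool) {t : BinaryTree ℕ} (h : 0 < t.height) :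
    ∃ i a b, t = nd d i a b := by
  cases t with
  | nil => simp at h
  | node i l r => cases d <;> exact ⟨i, _, _, rfl⟩

theorem lab_nd_perm (d : Bool) (i : ℕ) (a b : BinaryTree ℕ) :
    (lab (nd d i a b)).Perm (i :: (lab a ++ lab b)) := by
  cases d
  · exact List.perm_middle.trans (.cons _ List.perm_append_comm)
  · exact List.perm_middle

theorem mem_lab_nd {d : Bool} {i j : ℕ} {a b : BinaryTree ℕ} :
    j ∈ lab (nd d i a b) ↔ j = i ∨ j ∈ lab a ∨ j ∈ lab b := by
  simp [(lab_nd_perm d i a b).mem_iff]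

theorem lab_plug (c : Path) (t : BinaryTree ℕ) : lab (plug c t) = c.before ++ lab t ++ c.after := by
  induction c generalizing t with
  | nil => simp [plug, Path.before, Path.after]
  | cons f c ih =>
    obtain ⟨i, d, b⟩ := f
    cases d <;> simp [plug, ih, Path.before, Path.after, nd, lab]

theorem lab_plug_perm (c : Path) (t : BinaryTree ℕ) : (lab (plug c t)).Perm (c.labs ++ lab t) := by
  induction c generalizing t with
  | nil => simp [plug, Path.labs]
  | cons f c ih =>
    obtain ⟨i, d, b⟩ := f
    refine (ih _).trans (((lab_nd_perm d i t b).append_left _).trans ?_)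
    simp only [Path.labs]
    refine List.perm_middle.trans (.cons _ ?_)
    rw [List.perm_iff_count]
    intro j
    simp only [List.count_append, List.append_eq]
    omega

theorem Path.nodes_subset_labs (c : Path) : c.nodes ⊆ c.labs := by
  induction c with
  | nil => simp [nodes]
  | cons f c ih =>
    obtain ⟨i, d, b⟩ := f
    intro j hj
    simp only [nodes, List.map_cons, List.mem_cons, labs, List.mem_append] at hj ⊢
    rcases hj with h | h
    · exact .inl h
    · exact .inr (.inr (ih h))

/-! ### Representation in a heap -/

/-- The code `z` of the balance of a node with subtrees of heights `a`, on the side `d`, and `b`. -/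
def BalCode {w : ℕ} (z : BitVec w) (d : Bool) (a b : ℕ) : Prop :=
  (z = BitVec.ofNat w 0 ∧ a = b) ∨ (z = BitVec.ofNat w (fld d) ∧ a = b + 1) ∨
    (z = BitVec.ofNat w (fld (!d)) ∧ b = a + 1)

theorem balCode_not {w : ℕ} {z : BitVec w} {d : Bool} {a b : ℕ} :
    BalCode z (!d) a b ↔ BalCode z d b a := by
  simp only [BalCode, Bool.not_not, eq_comm (a := a) (b := b)]
  tauto

/-- The pointers in the heap `H` link the nodes of the tree `t`, with parent `q`. -/
def Links {w : ℕ} (H : Heap w) : BinaryTree ℕ → ℕ → Prop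
  | .nil, _ => True
  | .node i l r, q => H i 1 = ad w (rt l) 0 ∧ H i 2 = ad w (rt r) 0 ∧ H i 3 = ad w q 0 ∧
      Links H l i ∧ Links H r i

/-- The pointers in the heap `H` link the part of a tree off the subtree, with root `r`, to which a
path leads. -/
def LinksC {w : ℕ} (H : Heap w) : Path → ℕ → Prop
  | [], r => H 0 0 = ad w r 0
  | (i, d, b) :: c, r => H i (fld d) = ad w r 0 ∧ H i (fld (!d)) = ad w (rt b) 0 ∧
      H i 3 = ad w (Path.top c) 0 ∧ Links H b i ∧ LinksC H c i

/-- The heap `H` holds the root pointer and the links of the tree `t`. -/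
def Linked {w : ℕ} (H : Heap w) (t : BinaryTree ℕ) : Prop := H 0 0 = ad w (rt t) 0 ∧ Links H t 0

/-- The heap `H` holds the balances of the nodes of the tree `t`. -/
def Bal {w : ℕ} (H : Heap w) : BinaryTree ℕ → Prop
  | .nil => True
  | .node i l r => BalCode (H i 4) true l.height r.height ∧ Bal H l ∧ Bal H r

/-- The heap `H` holds the balances in the part of a tree off the subtree, of height `h`, to which a
path leads. -/
def BalC {w : ℕ} (H : Heap w) : Path → ℕ → Prop
  | [], _ => True
  | (i, d, b) :: c, h => BalCode (H i 4) d h b.height ∧ Bal H b ∧ BalC H c (max h b.height + 1)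

/-! ### Splitting the invariants along a path, and their stability under changes elsewhere. -/

section rep

variable {w : ℕ} {H H' : Heap w}

theorem links_nd {d : Bool} {i q : ℕ} {a b : BinaryTree ℕ} :
    Links H (nd d i a b) q ↔ H i (fld d) = ad w (rt a) 0 ∧ H i (fld (!d)) = ad w (rt b) 0 ∧
      H i 3 = ad w q 0 ∧ Links H a i ∧ Links H b i := by
  cases d
  · simp only [nd, Links, fld, cond_false, Bool.not_false, cond_true]
    tauto
  · rfl

theorem bal_nd {d : Bool} {i : ℕ} {a b : BinaryTree ℕ} :
    Bal H (nd d i a b) ↔ BalCode (H i 4) d a.height b.height ∧ Bal H a ∧ Bal H b := by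
  cases d
  · have := balCode_not (z := H i 4) (d := true) (a := a.height) (b := b.height)
    simp only [Bool.not_true] at this
    simp only [nd, Bal, this]
    tauto
  · rfl

/-- The part of the tree off a subtree sees only the root of the subtree, and the subtree sees only
the last node of the path. Likewise, in `bal_plug`, only the height of the subtree matters outside
it. -/
theorem linked_plug {c : Path} {t : BinaryTree ℕ} :
    Linked H (plug c t) ↔ LinksC H c (rt t) ∧ Links H t c.top := by
  induction c generalizing t with
  | nil => rfl
  | cons f c ih =>
    obtain ⟨i, d, b⟩ := f
    rw [plug, ih, links_nd, LinksC, rt_nd, Path.top]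
    tauto

theorem bal_plug {c : Path} {t : BinaryTree ℕ} :
    Bal H (plug c t) ↔ BalC H c t.height ∧ Bal H t := by
  induction c generalizing t with
  | nil => simp [plug, BalC]
  | cons f c ih =>
    obtain ⟨i, d, b⟩ := f
    rw [plug, ih, bal_nd, BalC, height_nd]
    tauto

theorem Links.congr {t : BinaryTree ℕ} {q : ℕ} (h : Links H t q)
    (hH : ∀ i ∈ lab t, ∀ k, 1 ≤ k → k < 4 → H' i k = H i k) : Links H' t q := by
  induction t generalizing q with
  | nil => trivial
  | node i l r ihl ihr =>
    simp only [lab, List.mem_append, List.mem_cons] at hH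
    simp only [Links] at h ⊢
    have hi := hH i (by simp)
    rw [hi 1 (by omega) (by omega), hi 2 (by omega) (by omega), hi 3 (by omega) (by omega)]
    exact ⟨h.1, h.2.1, h.2.2.1, ihl h.2.2.2.1 fun j hj => hH j (by simp [hj]),
      ihr h.2.2.2.2 fun j hj => hH j (by simp [hj])⟩

theorem LinksC.congr {c : Path} {r : ℕ} (hc : LinksC H c r) (h0 : H' 0 0 = H 0 0)
    (hH : ∀ i ∈ c.labs, ∀ k, 1 ≤ k → k < 4 → H' i k = H i k) : LinksC H' c r := by
  induction c generalizing r with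
  | nil => simpa [LinksC, h0] using hc
  | cons f c ih =>
    obtain ⟨i, d, b⟩ := f
    simp only [Path.labs, List.mem_append, List.mem_cons] at hH
    simp only [LinksC] at hc ⊢
    have hi := hH i (by simp)
    have := fld_lt d
    have := fld_lt !d
    rw [hi _ (fld_pos _) (by omega), hi _ (fld_pos _) (by omega), hi 3 (by omega) (by omega)]
    exact ⟨hc.1, hc.2.1, hc.2.2.1, hc.2.2.2.1.congr fun j hj => hH j (by simp [hj]),
      ih hc.2.2.2.2 fun j hj => hH j (by simp [hj])⟩

theorem Linked.congr {t : BinaryTree ℕ} (h : Linked H t) (h0 : H' 0 0 = H 0 0)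
    (hH : ∀ i ∈ lab t, ∀ k, 1 ≤ k → k < 4 → H' i k = H i k) : Linked H' t :=
  ⟨h0 ▸ h.1, h.2.congr hH⟩

theorem Bal.congr {t : BinaryTree ℕ} (h : Bal H t) (hH : ∀ i ∈ lab t, H' i 4 = H i 4) :
    Bal H' t := by
  induction t with
  | nil => trivial
  | node i l r ihl ihr =>
    simp only [lab, List.mem_append, List.mem_cons] at hH
    simp only [Bal] at h ⊢
    rw [hH i (by simp)]
    exact ⟨h.1, ihl h.2.1 fun j hj => hH j (by simp [hj]),
      ihr h.2.2 fun j hj => hH j (by simp [hj])⟩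

theorem BalC.congr {c : Path} {h : ℕ} (hc : BalC H c h) (hH : ∀ i ∈ c.labs, H' i 4 = H i 4) :
    BalC H' c h := by
  induction c generalizing h with
  | nil => trivial
  | cons f c ih =>
    obtain ⟨i, d, b⟩ := f
    simp only [Path.labs, List.mem_append, List.mem_cons] at hH
    simp only [BalC] at hc ⊢
    rw [hH i (by simp)]
    exact ⟨hc.1, hc.2.1.congr fun j hj => hH j (by simp [hj]),
      ih hc.2.2 fun j hj => hH j (by simp [hj])⟩

/-- Redirect the pointer at the end of a path. -/
theorem LinksC.redirect {c : Path} {r : ℕ} (hc : LinksC H c r) (r' : ℕ) (h0 : c.labs.Nodup)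
    (h0' : 0 ∉ c.labs) (hr : H' c.top c.side = ad w r' 0)
    (hH : ∀ i, i = 0 ∨ i ∈ c.labs → ∀ k < 4, 1 ≤ k ∨ i = 0 →
      (i = c.top ∧ k = c.side) ∨ H' i k = H i k) :
    LinksC H' c r' := by
  cases c with
  | nil => exact hr
  | cons f c =>
    obtain ⟨i, d, b⟩ := f
    simp only [Path.labs, List.nodup_cons, List.mem_append, not_or, List.mem_cons] at h0 h0' hH
    simp only [Path.top, Path.side] at hr hH
    simp only [LinksC] at hc ⊢
    have hk : ∀ k < 4, 1 ≤ k → k ≠ fld d → H' i k = H i k := fun k hk h1 hne =>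
      (hH i (by simp) k hk (.inl h1)).resolve_left fun h => hne h.2
    have hj : ∀ j, j ≠ i → j ∈ lab b ∨ j ∈ Path.labs c → ∀ k, 1 ≤ k → k < 4 → H' j k = H j k :=
      fun j hji hj k h1 hk => (hH j (by tauto) k hk (.inl h1)).resolve_left fun h => hji h.1
    have := fld_lt d
    have := fld_lt !d
    rw [hk _ (by omega) (fld_pos _) (fld_ne_not d).symm, hk 3 (by omega) (by omega) (by omega)]
    refine ⟨hr, hc.2.1, hc.2.2.1, hc.2.2.2.1.congr fun j hj' => hj j ?_ (.inl hj'),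
      hc.2.2.2.2.congr ?_ fun j hj' => hj j ?_ (.inr hj')⟩
    · rintro rfl; exact h0.1.1 hj'
    · exact (hH 0 (.inl rfl) 0 (by omega) (.inr rfl)).resolve_left fun h => h0'.1 h.1
    · rintro rfl; exact h0.1.2 hj'

/-- The empty path needs no exception later: its `top` is the header and its `side` is field 0,
which is the root pointer. -/
theorem LinksC.hole {c : Path} {r : ℕ} (hc : LinksC H c r) : H c.top c.side = ad w r 0 := by
  cases c with
  | nil => exact hc
  | cons f c => exact hc.1

theorem Links.parent {t : BinaryTree ℕ} {q : ℕ} (h : Links H t q) (ht : rt t ≠ 0) :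
    H (rt t) 3 = ad w q 0 := by
  cases t with
  | nil => exact absurd rfl ht
  | node i l r => exact h.2.2.1

theorem BalCode.exists_lt {z : BitVec w} {d : Bool} {a b : ℕ} (h : BalCode z d a b) :
    ∃ k < 3, z = BitVec.ofNat w k := by
  rcases h with h | h | h
  · exact ⟨_, by omega, h.1⟩
  · exact ⟨_, fld_lt _, h.1⟩
  · exact ⟨_, fld_lt _, h.1⟩

theorem Bal.code_lt {t : BinaryTree ℕ} (h : Bal H t) :
    ∀ i ∈ lab t, ∃ k < 3, H i 4 = BitVec.ofNat w k := by
  induction t with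
  | nil => simp [lab]
  | node i l r ihl ihr =>
    obtain ⟨hb, hl, hr⟩ := h
    intro j hj
    simp only [lab, List.mem_append, List.mem_cons] at hj
    rcases hj with hj | rfl | hj
    · exact ihl hl j hj
    · exact hb.exists_lt
    · exact ihr hr j hj

/-! ### Heights -/

theorem BalCode.le {z : BitVec w} {d : Bool} {a b : ℕ} (h : BalCode z d a b) :
    a ≤ b + 1 ∧ b ≤ a + 1 := by
  rcases h with h | h | h <;> omega

theorem length_lab (t : BinaryTree ℕ) : (lab t).length = t.numNodes := by
  induction t with
  | nil => rfl
  | node i l r ihl ihr => simp [lab, ihl, ihr]; omega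

theorem numNodes_lt_two_pow_height (t : BinaryTree ℕ) : t.numNodes + 1 ≤ 2 ^ t.height := by
  induction t with
  | nil => simp
  | node i l r ihl ihr =>
    have h1 : 2 ^ l.height ≤ 2 ^ max l.height r.height :=
      Nat.pow_le_pow_right (by omega) (le_max_left _ _)
    have h2 : 2 ^ r.height ≤ 2 ^ max l.height r.height :=
      Nat.pow_le_pow_right (by omega) (le_max_right _ _)
    simp only [BinaryTree.numNodes, BinaryTree.height, pow_succ]
    omega

/-- The product of the hypotheses gives `a * b ≥ 2 ^ h`, so `a ^ 2 + 2 * a * b + b ^ 2` is at least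
`(2 + 2 + 1) * 2 ^ h`. -/
theorem sq_le_add_sq {a b h : ℕ} (ha : 2 ^ (h + 1) ≤ a ^ 2) (hb : 2 ^ h ≤ b ^ 2) :
    2 ^ (h + 2) ≤ (a + b) ^ 2 := by
  have hab : 2 ^ h ≤ a * b := by
    by_contra hlt
    have h1 : (a * b) ^ 2 < (2 ^ h) ^ 2 := Nat.pow_lt_pow_left (by omega) (by omega)
    have h2 : 2 ^ (h + 1) * 2 ^ h ≤ a ^ 2 * b ^ 2 := Nat.mul_le_mul ha hb
    have h3 : (2 ^ h) ^ 2 ≤ 2 ^ (h + 1) * 2 ^ h := by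
      rw [sq]; exact Nat.mul_le_mul_right _ (Nat.pow_le_pow_right (by omega) (by omega))
    rw [mul_pow] at h1
    omega
  rw [pow_succ] at ha
  rw [pow_succ, pow_succ]
  nlinarith

/-- A weak form of the Fibonacci bound: the number of nodes plus one grows at least by a factor `√2`
per level, which suffices for logarithmic height. -/
theorem Bal.two_pow_height_le {t : BinaryTree ℕ} (h : Bal H t) :
    2 ^ t.height ≤ (t.numNodes + 1) ^ 2 := by
  induction t with
  | nil => simp
  | node i l r ihl ihr =>
    obtain ⟨hb, hl, hr⟩ := h
    have hl' := ihl hl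
    have hr' := ihr hr
    simp only [BinaryTree.numNodes, BinaryTree.height]
    obtain ⟨h1, h2⟩ := hb.le
    rw [show l.numNodes + r.numNodes + 1 + 1 = (l.numNodes + 1) + (r.numNodes + 1) by omega]
    rcases Nat.lt_trichotomy l.height r.height with hlt | heq | hlt
    · have e : r.height = l.height + 1 := by omega
      rw [e] at hr'
      rw [max_eq_right hlt.le, e, add_comm (l.numNodes + 1)]
      exact sq_le_add_sq hr' hl'
    · rw [heq, max_self, pow_succ]
      rw [heq] at hl'
      nlinarith [Nat.zero_le ((l.numNodes + 1) * (r.numNodes + 1))]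
    · have e : l.height = r.height + 1 := by omega
      rw [e] at hl'
      rw [max_eq_left hlt.le, e]
      exact sq_le_add_sq hl' hr'

theorem length_add_height_le (c : Path) (t : BinaryTree ℕ) :
    c.length + t.height ≤ (plug c t).height := by
  induction c generalizing t with
  | nil => simp [plug]
  | cons f c ih =>
    obtain ⟨i, d, b⟩ := f
    have := ih (nd d i t b)
    rw [height_nd] at this
    simp only [plug, List.length_cons]
    have := le_max_left t.height b.height
    omega

/-- A sibling is at most one level higher, so one step up adds at most two to the height. For an
empty subtree this says that every search path has at least half the height of the tree, so that no
insertion is fast. -/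
theorem BalC.height_plug_le {c : Path} {t : BinaryTree ℕ} (h : BalC H c t.height) :
    (plug c t).height ≤ t.height + 2 * c.length := by
  induction c generalizing t with
  | nil => simp [plug]
  | cons f c ih =>
    obtain ⟨i, d, b⟩ := f
    obtain ⟨hb, _, hc⟩ := h
    rw [← height_nd d i] at hc
    have := ih hc
    have := hb.le
    rw [height_nd] at *
    simp only [plug, List.length_cons]
    omega

/-! ### From heaps to memory -/

theorem keys_map (f : ℕ → BitVec w) (t : BinaryTree ℕ) : keys (t.map f) = (lab t).map f := by
  induction t with
  | nil => rfl
  | node i l r ihl ihr => simp [BinaryTree.map, keys, lab, ihl, ihr]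

theorem isSearchTree_iff (t : BinaryTree (BitVec w)) : IsSearchTree t ↔ (keys t).Pairwise (· < ·) := by
  induction t with
  | nil => simp [IsSearchTree, keys]
  | node k l r ihl ihr =>
    simp only [IsSearchTree, keys, ihl, ihr, List.pairwise_append, List.pairwise_cons,
      List.mem_cons]
    constructor
    · rintro ⟨h1, h2, h3, h4⟩
      refine ⟨h3, ⟨h2, h4⟩, fun a ha b hb => ?_⟩
      rcases hb with rfl | hb
      · exact h1 a ha
      · exact BitVec.lt_trans (h1 a ha) (h2 b hb)
    · rintro ⟨h3, ⟨h2, h4⟩, h5⟩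
      exact ⟨fun a ha => h5 a ha k (.inl rfl), h2, h3, h4⟩

theorem height_map {α β : Type*} (f : α → β) (t : BinaryTree α) : (t.map f).height = t.height := by
  induction t with
  | nil => rfl
  | node i l r ihl ihr => simp [BinaryTree.map, ihl, ihr]

theorem Bal.isBalanced {t : BinaryTree ℕ} (h : Bal H t) (f : ℕ → BitVec w) :
    IsBalanced (t.map f) := by
  induction t with
  | nil => trivial
  | node i l r ihl ihr =>
    obtain ⟨hb, hl, hr⟩ := h
    simp only [BinaryTree.map, IsBalanced, height_map]
    exact ⟨hb.le.1, hb.le.2, ihl hl, ihr hr⟩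

/-- The labels in preorder. -/
def preorder : BinaryTree ℕ → List ℕ
  | .nil => []
  | .node i l r => i :: (preorder l ++ preorder r)

theorem preorder_perm (t : BinaryTree ℕ) : (preorder t).Perm (lab t) := by
  induction t with
  | nil => rfl
  | node i l r ihl ihr => exact ((ihl.append ihr).cons i).trans List.perm_middle.symm

/-- The addresses of the first four fields of a record. -/
def cells (w i : ℕ) : List (BitVec w) := [ad w i 0, ad w i 1, ad w i 2, ad w i 3]

variable {M : ℕ} (hM : 16 * (M + 1) ≤ 2 ^ w)
include hM

/-- The fields 0 to 3 of a record are exactly the words that `HoldsAt` prescribes. Preorder appears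
because `nodeCells` lists a node before its subtrees. -/
theorem Links.holdsAt {t : BinaryTree ℕ} {q : ℕ} (h : Links H t q)
    (ht : ∀ i ∈ lab t, 1 ≤ i ∧ i ≤ M) :
    HoldsAt H.mem (t.map (H · 0)) (ad w (rt t) 0) (ad w q 0) ∧
      nodeCells H.mem (t.map (H · 0)) (ad w (rt t) 0) = (preorder t).flatMap (cells w) := by
  induction t generalizing q with
  | nil => exact ⟨rfl, rfl⟩
  | node i l r ihl ihr =>
    obtain ⟨h1, h2, h3, hl, hr⟩ := h
    simp only [lab, List.mem_append, List.mem_cons] at ht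
    obtain ⟨l1, l2⟩ := ihl hl fun j hj => ht j (by simp [hj])
    obtain ⟨r1, r2⟩ := ihr hr fun j hj => ht j (by simp [hj])
    obtain ⟨hi, hi'⟩ := ht i (by simp)
    have e1 : ad w i 0 + 1 = ad w i 1 := ad_add_ofNat w i 1
    have e2 : ad w i 0 + 2 = ad w i 2 := ad_add_ofNat w i 2
    have e3 : ad w i 0 + 3 = ad w i 3 := ad_add_ofNat w i 3
    simp only [BinaryTree.map, HoldsAt, nodeCells, show rt (.node i l r) = i from rfl, e1, e2, e3, Heap.mem_ad hM H hi'
      (show 0 < 16 by omega), Heap.mem_ad hM H hi' (show 1 < 16 by omega), Heap.mem_ad hM H hi'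
      (show 2 < 16 by omega), Heap.mem_ad hM H hi' (show 3 < 16 by omega), h1, h2, h3]
    refine ⟨⟨?_, trivial, trivial, l1, r1⟩, ?_⟩
    · intro h0; exact absurd ((ad_eq_zero hM hi').1 h0) (by omega)
    · simp [l2, r2, preorder, cells]

theorem mem_cells {i j k : ℕ} (hi : i ≤ M) (hj : j ≤ M) (hk : k < 16) :
    ad w j k ∈ cells w i ↔ j = i ∧ k < 4 := by
  simp only [cells, List.mem_cons, List.not_mem_nil, or_false]
  rw [ad_inj hM hj hk hi (by omega), ad_inj hM hj hk hi (by omega), ad_inj hM hj hk hi (by omega),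
    ad_inj hM hj hk hi (by omega)]
  omega

theorem mem_flatMap_cells {L : List ℕ} (hL : ∀ i ∈ L, i ≤ M) {j k : ℕ} (hj : j ≤ M)
    (hk : k < 16) : ad w j k ∈ L.flatMap (cells w) ↔ j ∈ L ∧ k < 4 := by
  rw [List.mem_flatMap]
  constructor
  · rintro ⟨i, hi, h⟩
    rw [mem_cells hM (hL i hi) hj hk] at h
    exact ⟨h.1 ▸ hi, h.2⟩
  · rintro ⟨h, h'⟩
    exact ⟨j, h, (mem_cells hM hj hj hk).2 ⟨rfl, h'⟩⟩

theorem nodup_cells {L : List ℕ} (hL : ∀ i ∈ L, 1 ≤ i ∧ i ≤ M) (hn : L.Nodup) :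
    (0#w :: L.flatMap (cells w)).Nodup := by
  rw [List.nodup_cons, List.nodup_flatMap]
  refine ⟨?_, fun i hi => ?_, ?_⟩
  · rw [← ad_zero, mem_flatMap_cells hM (fun i hi => (hL i hi).2) (by omega) (by omega)]
    exact fun h => absurd (hL 0 h.1).1 (by omega)
  · have := (hL i hi).2
    simp only [cells, List.nodup_cons, List.mem_cons, List.not_mem_nil, or_false, not_or]
    simp [ad_inj hM this _ this]
  · refine hn.imp_of_mem fun {i j} hi hj hij => ?_
    intro a ha ha'
    have : ∃ k < 16, a = ad w i k := by
      simp only [cells, List.mem_cons, List.not_mem_nil, or_false] at ha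
      rcases ha with h | h | h | h
      exacts [⟨_, by omega, h⟩, ⟨_, by omega, h⟩, ⟨_, by omega, h⟩, ⟨_, by omega, h⟩]
    obtain ⟨k, hk, rfl⟩ := this
    exact hij ((mem_cells hM (hL j hj).2 (hL i hi).2 hk).1 ha').1

theorem Linked.holdsTree {t : BinaryTree ℕ} (h : Linked H t)
    (ht : ∀ i ∈ lab t, 1 ≤ i ∧ i ≤ M) (hn : (lab t).Nodup) :
    HoldsTree H.mem (t.map (H · 0)) ∧
      treeCells H.mem (t.map (H · 0)) = 0#w :: (preorder t).flatMap (cells w) := by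
  obtain ⟨h0, h⟩ := h
  obtain ⟨h1, h2⟩ := h.holdsAt hM ht
  have hm : H.mem 0#w = ad w (rt t) 0 := by
    rw [← ad_zero, Heap.mem_ad hM H (by omega) (by omega), h0]
  have h3 : treeCells H.mem (t.map (H · 0)) = 0#w :: (preorder t).flatMap (cells w) := by
    rw [treeCells, ← h2]
    simp only [BitVec.ofNat_eq_ofNat, hm]
  refine ⟨⟨?_, ?_⟩, h3⟩
  · simp only [BitVec.ofNat_eq_ofNat, hm]; exact h1
  · rw [h3]
    exact nodup_cells hM (fun i hi => ht i ((preorder_perm t).mem_iff.1 hi))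
      ((preorder_perm t).nodup_iff.2 hn)

end rep

/-! ### Blocks of instructions -/

/-- Run programs one after the other. -/
def block : List Prog → Prog
  | [] => .skip
  | p :: ps => .seq p (block ps)

/-- Time is a budget: each instruction is charged to it and the rest of the block runs on what is
left, so that only numerical inequalities remain. -/
theorem Runs.cons {S w : ℕ} {p : Prog} {ps : List Prog} {T T' : ℕ} {s s' s'' : State w}
    (h : Runs S p T s s') (h' : Runs S (block ps) (T' - T) s' s'')
    (hT : T ≤ T' := by norm_num) : Runs S (block (p :: ps)) T' s s'' :=
  (h.seq h').mono (by omega)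

theorem Runs.nil {S w T : ℕ} (s : State w) : Runs S (block []) T s s :=
  (Runs.skip s).mono (by omega)

theorem Runs.inv {S w : ℕ} {p : Prog} {T : ℕ} {s s' : State w} (h : Runs S p T s s')
    (hp : p.IsRev) : Runs S p.inv T s' s := by
  obtain ⟨t, e, ht, h⟩ := h
  exact ⟨t, 0, ht, (h.inv hp).2⟩

theorem Heap.upd_apply {w : ℕ} (H : Heap w) (i k : ℕ) (v : BitVec w) (i' k' : ℕ) :
    H.upd i k v i' k' = if i' = i ∧ k' = k then v else H i' k' := rfl

theorem Heap.upd_upd {w : ℕ} (H : Heap w) (i k : ℕ) (v v' : BitVec w) :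
    (H.upd i k v).upd i k v' = H.upd i k v' := by
  funext i' k'
  simp only [Heap.upd_apply]
  split_ifs <;> rfl

section instructions

variable {S w M : ℕ} {l : List (BitVec w)} {H : Heap w}

theorem runs_addC_to (i c : ℕ) {u v : BitVec w} (hu : l.getD i 0 = u)
    (hv : u + BitVec.ofNat w c = v) (hi : i < l.length := by simp) :
    Runs S (addC i c) 1 (st l H) (st (l.set i v) H) := by
  subst hu hv; exact runs_addC i c hi

theorem runs_subC_to (i c : ℕ) {u v : BitVec w} (hu : l.getD i 0 = u)
    (hv : u - BitVec.ofNat w c = v) (hi : i < l.length := by simp) :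
    Runs S (subC i c) 1 (st l H) (st (l.set i v) H) := by
  subst hu hv; exact runs_subC i c hi

theorem runs_addV_to (i j : ℕ) {u u' v : BitVec w} (hu : l.getD i 0 = u) (hu' : l.getD j 0 = u')
    (hv : u + u' = v) (hi : i < l.length := by simp) (hij : i ≠ j := by decide) :
    Runs S (addV i j) 1 (st l H) (st (l.set i v) H) := by
  subst hu hu' hv; exact runs_addV i j hij hi

theorem runs_subV_to (i j : ℕ) {u u' v : BitVec w} (hu : l.getD i 0 = u) (hu' : l.getD j 0 = u')
    (hv : u - u' = v) (hi : i < l.length := by simp) (hij : i ≠ j := by decide) :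
    Runs S (subV i j) 1 (st l H) (st (l.set i v) H) := by
  subst hu hu' hv; exact runs_subV i j hij hi

theorem runs_swapV_to (i j : ℕ) {u u' : BitVec w} (hu : l.getD i 0 = u) (hu' : l.getD j 0 = u')
    (hi : i < l.length := by simp) (hj : j < l.length := by simp) (hij : i ≠ j := by decide) :
    Runs S (swapV i j) 1 (st l H) (st ((l.set i u').set j u) H) := by
  subst hu hu'; exact runs_swapV i j hij hi hj

theorem runs_eq_to (i j k : ℕ) {u u' v : BitVec w} (hi : l.getD i 0 = u) (hj : l.getD j 0 = u')
    (h0 : l.getD k 0 = 0#w) (hv : (if u = u' then 0#w + 1 else 0#w) = v)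
    (hk : k < l.length := by simp) (hij : i ≠ j := by decide) (hik : i ≠ k := by decide)
    (hjk : j ≠ k := by decide) :
    Runs S (.op .eq ![.var i, .var j, .var k]) 1 (st l H) (st (l.set k v) H) := by
  have := runs_eq (S := S) (H := H) i j k hij hik hjk hk
  rwa [h0, hi, hj, hv] at this

/-- The conditions on the operands of an access to the field at the offset `f` of the record at
`j`, with the variable `i` as other operand: this is field `k` of record `a`. -/
structure Access (M : ℕ) {w : ℕ} (l : List (BitVec w)) (i j : ℕ) (f : Off) (a k : ℕ) : Prop where
  hj : l.getD j 0 = ad w a 0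
  hf : f.val l = BitVec.ofNat w k
  ha : a ≤ M
  hk : k < 16
  hi : i < l.length := by simp
  hjl : j < l.length := by simp
  hij : i ≠ j := by decide
  hfi : f.Avoids i := by simp [Off.Avoids]
  hfj : f.Avoids j := by simp [Off.Avoids]

variable (hM : 16 * (M + 1) ≤ 2 ^ w) (hS : 16 * (M + 1) ≤ S) {i j a k : ℕ} {f : Off} {v : BitVec w}
include hM hS

/-- Adding to a zero word is copying, and subtracting a known equal word is erasing. Nearly all
memory accesses have one of these four forms. -/
theorem runs_load_zero (h : Access M l i j f a k) (h0 : l.getD i 0 = 0#w) (hv : H a k = v) :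
    Runs S (load i j f) 3 (st l H) (st (l.set i v) H) := by
  have := runs_load (H := H) hM hS h.hi h.hjl h.hij h.hfi h.hfj h.hj h.hf h.ha h.hk
  rwa [h0, BitVec.zero_add, hv] at this

theorem runs_unload_zero (h : Access M l i j f a k) (h0 : l.getD i 0 = v) (hv : H a k = v) :
    Runs S (unload i j f) 3 (st l H) (st (l.set i 0#w) H) := by
  have := runs_unload (H := H) hM hS h.hi h.hjl h.hij h.hfi h.hfj h.hj h.hf h.ha h.hk
  rwa [h0, hv, BitVec.sub_self] at this

theorem runs_store_zero (h : Access M l i j f a k) (h0 : l.getD i 0 = v) (hv : H a k = 0#w) :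
    Runs S (store i j f) 3 (st l H) (st l (H.upd a k v)) := by
  have := runs_store (H := H) hM hS h.hjl h.hij h.hfj h.hj h.hf h.ha h.hk
  rwa [h0, hv, BitVec.zero_add] at this

theorem runs_unstore_zero (h : Access M l i j f a k) (h0 : l.getD i 0 = v) (hv : H a k = v) :
    Runs S (unstore i j f) 3 (st l H) (st l (H.upd a k 0#w)) := by
  have := runs_unstore (H := H) hM hS h.hjl h.hij h.hfj h.hj h.hf h.ha h.hk
  rwa [h0, hv, BitVec.sub_self] at this

/-- The reversible substitute for overwriting: the old word has to be at hand in a variable, to be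
subtracted before the new one is added. -/
theorem Runs.replace {i' T : ℕ} {ps : List Prog} {s' : State w} {v' : BitVec w}
    (h : Access M l i j f a k) (h' : Access M l i' j f a k) (h0 : l.getD i 0 = v)
    (h0' : l.getD i' 0 = v') (hv : H a k = v)
    (hs : Runs S (block ps) (T - 6) (st l (H.upd a k v')) s') (hT : 6 ≤ T := by norm_num) :
    Runs S (block (unstore i j f :: store i' j f :: ps)) T (st l H) s' := by
  refine .cons (runs_unstore_zero hM hS h h0 hv) (.cons (runs_store_zero hM hS h' h0' ?_) ?_ ?_) ?_
  · simp [Heap.upd_apply]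
  · rw [Heap.upd_upd]
    exact hs.mono (by omega)
  · omega
  · omega

end instructions

/-! ### The programs -/

/-- Put the side on which the argument belongs at the node `q` into the variable `d`. -/
def dirNode (q d : ℕ) : Prog :=
  block [load 5 q (.c 0), addC d 2, .op .invLe ![.var 0, .var 5, .var d], unload 5 q (.c 0)]

/-- Put the field of `q` that is followed in a search for the argument into the variable `d`; for
the null pointer `q` this is the root pointer. -/
def dir (q d : ℕ) : Prog := .ifRev (.eqc (.var q) 0) .skip (dirNode q d) (.eqc (.var q) 0)

/-- Allocate a record, and load its address and the root pointer. -/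
def alloc : Prog :=
  block [addC 3 16, store 3 2 (.c 4), subC 3 16, load 1 2 (.c 4), load 4 2 (.v 3)]

/-- Go one step down. -/
def walkDownBody : Prog :=
  block [(dir 2 3).inv, unload 2 4 (.c 3), swapV 2 4, dir 2 3, load 4 2 (.v 3)]

/-- Go down to the null pointer where the argument belongs. -/
def walkDown : Prog := .loopRev (.eqc (.var 2) 0) (.eqc (.var 4) 0) walkDownBody

/-- Link the new record as a leaf. -/
def link : Prog :=
  block [store 1 2 (.v 3), store 2 1 (.c 3), store 0 1 (.c 0), addC 5 1, store 5 1 (.c 9),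
    subC 5 1, (dir 2 3).inv, unload 2 1 (.c 3)]

/-- Prepare to go up from the new leaf. -/
def startUp : Prog := block [addV 4 1, load 2 4 (.c 3), load 5 2 (.c 4)]

/-- Adjust the balance of a balanced node one of whose subtrees has grown, and go one step up. -/
def walkUpBody : Prog :=
  block [dirNode 2 3, store 3 2 (.c 4), unload 4 2 (.v 3), (dirNode 2 3).inv, swapV 4 2,
    load 2 4 (.c 3), load 5 2 (.c 4)]

/-- Go up until the parent is not balanced, or null. -/
def walkUp : Prog := .loopRev (.eq (.var 4) (.var 1)) (.not (.eqc (.var 5) 0)) walkUpBody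

/-- Store the address of the node reached in the log. -/
def stopUp : Prog := block [unload 5 2 (.c 4), dir 2 3, unload 4 2 (.v 3), store 2 1 (.c 5)]

/-- Rotate the child on the side `3` of the node `2` above it; field `8` of `7` points to this
node. -/
def rotate : Prog :=
  block [load 5 4 (.v 6), unstore 4 2 (.v 3), store 5 2 (.v 3), unstore 5 4 (.v 6),
    store 2 4 (.v 6), unstore 2 7 (.v 8), store 4 7 (.v 8), unstore 7 2 (.c 3), store 4 2 (.c 3),
    unstore 2 4 (.c 3), store 7 4 (.c 3),
    .ifRev (.eqc (.var 5) 0) .skip (block [unstore 4 5 (.c 3), store 2 5 (.c 3)])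
      (.eqc (.var 5) 0),
    unload 5 2 (.v 3), unload 4 2 (.c 3)]

/-- The first rotation of a double rotation, with the adjustment of the balances. -/
def double : Prog :=
  block [unstore 6 4 (.c 4), swapV 7 2, swapV 2 4, swapV 3 6, addV 8 6, load 4 2 (.v 3),
    load 5 4 (.c 4), unstore 5 4 (.c 4), store 5 1 (.c 8),
    .ifRev (.eq (.var 5) (.var 8)) (store 3 7 (.c 4)) .skip (.eq (.var 5) (.var 8)),
    .ifRev (.eq (.var 5) (.var 3)) (store 6 2 (.c 4)) .skip (.eq (.var 5) (.var 3)),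
    unload 5 1 (.c 8), rotate, subV 8 6, swapV 3 6, swapV 7 2, load 4 2 (.v 3), unload 7 4 (.v 3)]

/-- Rebalance a node whose higher subtree has grown. -/
def rebalance : Prog :=
  block [unstore 3 2 (.c 4), load 4 2 (.v 3), load 5 4 (.c 4),
    .op .eq ![.var 5, .var 3, .var 10], store 10 1 (.c 7), unload 5 4 (.c 4),
    .ifRev (.eqc (.var 10) 1) (unstore 3 4 (.c 4)) double (.eqc (.var 10) 1),
    unload 10 1 (.c 7), load 7 2 (.c 3), dir 7 8, rotate, (dir 7 8).inv, load 4 2 (.c 3),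
    unload 7 4 (.c 3), unload 4 2 (.c 3)]

/-- Deal with an unbalanced node one of whose subtrees has grown. -/
def settle : Prog :=
  block [addC 6 3, subV 6 3, load 5 2 (.c 4), .op .eq ![.var 5, .var 3, .var 9],
    store 9 1 (.c 6), unload 5 2 (.c 4),
    .ifRev (.eqc (.var 9) 1) rebalance (unstore 6 2 (.c 4)) (.eqc (.var 9) 1),
    unload 9 1 (.c 6), addV 6 3, subC 6 3]

/-- Deal with the node where the way up has ended, and clear the variables. -/
def finish : Prog :=
  block [.ifRev (.eqc (.var 2) 0) .skip settle (.eqc (.var 2) 0), (dir 2 3).inv,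
    unload 2 1 (.c 5), unload 1 2 (.c 4)]

/-- Insertion. -/
def insertProg : Prog :=
  block [alloc, .seq walkDown (block [link, startUp, walkUp, stopUp, finish])]

/-- The side on which `x` belongs at the node `i`. -/
def sideOf {w : ℕ} (H : Heap w) (x : BitVec w) (i : ℕ) : Bool := decide (x ≤ H i 0)

/-- The path is followed in a search for `x`. -/
def Path.Follows {w : ℕ} (H : Heap w) (x : BitVec w) (c : Path) : Prop :=
  ∀ f ∈ c, f.2.1 = sideOf H x f.1

theorem isRev_insertProg : insertProg.IsRev := by
  simp [insertProg, alloc, walkDownBody, walkDown, link, startUp, walkUpBody, walkUp, stopUp, rotate,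
    double, rebalance, settle, finish, dir, dirNode, block, Prog.IsRev, load, unload, store,
    unstore, atField, addC, subC, addV, subV, swapV, WordOp.IsRev, Prog.inv, WordOp.inv]

theorem isRev_dir (q d : ℕ) : (dir q d).IsRev := by
  simp [dir, dirNode, block, Prog.IsRev, load, unload, atField, addC, subC, WordOp.IsRev]

theorem isRev_dirNode (q d : ℕ) : (dirNode q d).IsRev := by
  simp [dirNode, block, Prog.IsRev, load, unload, atField, addC, subC, WordOp.IsRev]

/-- The comparison in `dirNode` takes 1 off an initial 2, which gives the number of the child field
to follow. -/
theorem ofNat_fld_sideOf {w : ℕ} {H : Heap w} (x : BitVec w) (i : ℕ) :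
    (if x ≤ H i 0 then BitVec.ofNat w 2 - 1 else BitVec.ofNat w 2) =
      BitVec.ofNat w (fld (sideOf H x i)) := by
  by_cases h : x ≤ H i 0
  · simp only [h, if_true, sideOf, decide_true, fld, cond_true]
    rw [← BitVec.add_sub_cancel (BitVec.ofNat w 1) 1]
    rw [show (1 : BitVec w) = BitVec.ofNat w 1 from rfl, ← BitVec.ofNat_add]
  · simp [h, sideOf, fld]

theorem inBounds_var {S w : ℕ} (s : State w) (i c : ℕ) : (Test.eqc (.var i) c).InBounds S s := by
  intro j hj; simp [Test.operands] at hj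

theorem inBounds_var_var {S w : ℕ} (s : State w) (i j : ℕ) :
    (Test.eq (.var i) (.var j)).InBounds S s := by
  intro j hj; simp [Test.operands] at hj

section tests

variable {S w T i j c : ℕ} {p q : Prog} {l l' : List (BitVec w)} {H H' : Heap w}

theorem runs_ifEqc_true (hb : l.getD i 0 = BitVec.ofNat w c)
    (h : Runs S p T (st l H) (st l' H')) (hb' : l'.getD i 0 = BitVec.ofNat w c) :
    Runs S (.ifRev (.eqc (.var i) c) p q (.eqc (.var i) c)) (T + 2) (st l H) (st l' H') :=
  (Runs.ifRev_true (inBounds_var _ _ _) (inBounds_var _ _ _) (by exact hb) h (by exact hb')).mono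
    (by simp [Test.size]; omega)

theorem runs_ifEqc_false (hb : ¬ l.getD i 0 = BitVec.ofNat w c)
    (h : Runs S q T (st l H) (st l' H')) (hb' : ¬ l'.getD i 0 = BitVec.ofNat w c) :
    Runs S (.ifRev (.eqc (.var i) c) p q (.eqc (.var i) c)) (T + 2) (st l H) (st l' H') :=
  (Runs.ifRev_false (inBounds_var _ _ _) (inBounds_var _ _ _) (by exact hb) h (by exact hb')).mono
    (by simp [Test.size]; omega)

theorem runs_ifEq_true (hb : l.getD i 0 = l.getD j 0)
    (h : Runs S p T (st l H) (st l' H')) (hb' : l'.getD i 0 = l'.getD j 0) :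
    Runs S (.ifRev (.eq (.var i) (.var j)) p q (.eq (.var i) (.var j))) (T + 2) (st l H)
      (st l' H') :=
  (Runs.ifRev_true (inBounds_var_var _ _ _) (inBounds_var_var _ _ _) (by exact hb) h (by exact hb')).mono
    (by simp [Test.size]; omega)

theorem runs_ifEq_false (hb : ¬ l.getD i 0 = l.getD j 0)
    (h : Runs S q T (st l H) (st l' H')) (hb' : ¬ l'.getD i 0 = l'.getD j 0) :
    Runs S (.ifRev (.eq (.var i) (.var j)) p q (.eq (.var i) (.var j))) (T + 2) (st l H)
      (st l' H') :=
  (Runs.ifRev_false (inBounds_var_var _ _ _) (inBounds_var_var _ _ _) (by exact hb) h (by exact hb')).mono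
    (by simp [Test.size]; omega)

end tests

/-! ### Computing the side of the argument from the keys. -/

section blocks

variable {S w M : ℕ} (hM : 16 * (M + 1) ≤ 2 ^ w) (hS : 16 * (M + 1) ≤ S) {H : Heap w}
include hM hS

theorem runs_dirNode_2 {x N v E p F g h : BitVec w} {i : ℕ} (hi : i ≤ M) :
    Runs S (dirNode 2 3) 8 (st [x, N, ad w i 0, 0#w, v, 0#w, E, p, F, g, h] H)
      (st [x, N, ad w i 0, BitVec.ofNat w (fld (sideOf H x i)), v, 0#w, E, p, F, g, h] H) := by
  refine .cons (runs_load_zero hM hS (a := i) (k := 0) (.mk rfl rfl hi (by omega)) rfl rfl) ?_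
  refine .cons (runs_addC_to 3 2 rfl (BitVec.zero_add _)) ?_
  refine .cons (runs_invLe 0 5 3 (by decide) (by decide) (by decide) (by simp)) ?_
  refine .cons (runs_unload_zero hM hS (a := i) (k := 0) (.mk rfl rfl hi (by omega)) rfl rfl) ?_
  rw [← ofNat_fld_sideOf]
  exact .nil _

/-- The side depends only on the argument and on a key, so it need not be logged: the inverse
program clears it whenever the keys are unchanged. At the header the field to follow is 0, so
nothing is done; the pointer tested stays the same, so one test serves at both ends of the branch.
-/
theorem runs_dir_2 {x N v E p F g h : BitVec w} {c : Path} (hc : c.Follows H x)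
    (hn : ∀ i ∈ c.nodes, 1 ≤ i ∧ i ≤ M) :
    Runs S (dir 2 3) 10 (st [x, N, ad w c.top 0, 0#w, v, 0#w, E, p, F, g, h] H)
      (st [x, N, ad w c.top 0, BitVec.ofNat w c.side, v, 0#w, E, p, F, g, h] H) := by
  cases c with
  | nil =>
    exact (runs_ifEqc_true (by exact ad_zero w) (.skip _) (by exact ad_zero w)).mono (by decide)
  | cons f c =>
    obtain ⟨i, s, b⟩ := f
    obtain ⟨h1, h2⟩ := hn i (by simp [Path.nodes])
    have h0 : ¬ ad w i 0 = 0#w := fun h => absurd ((ad_eq_zero hM h2).1 h) (by omega)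
    have hs : s = sideOf H x i := hc _ List.mem_cons_self
    have := runs_dirNode_2 hM hS (H := H) (x := x) (N := N) (v := v) (E := E)
      (p := p) (F := F) (g := g) (h := h) h2
    rw [← hs] at this
    exact runs_ifEqc_false (by exact h0) this (by exact h0)

theorem runs_dirNode_7 {x N q d v E g h : BitVec w} {i : ℕ} (hi : i ≤ M) :
    Runs S (dirNode 7 8) 8 (st [x, N, q, d, v, 0#w, E, ad w i 0, 0#w, g, h] H)
      (st [x, N, q, d, v, 0#w, E, ad w i 0, BitVec.ofNat w (fld (sideOf H x i)), g, h] H) := by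
  refine .cons (runs_load_zero hM hS (a := i) (k := 0) (.mk rfl rfl hi (by omega)) rfl rfl) ?_
  refine .cons (runs_addC_to 8 2 rfl (BitVec.zero_add _)) ?_
  refine .cons (runs_invLe 0 5 8 (by decide) (by decide) (by decide) (by simp)) ?_
  refine .cons (runs_unload_zero hM hS (a := i) (k := 0) (.mk rfl rfl hi (by omega)) rfl rfl) ?_
  rw [← ofNat_fld_sideOf]
  exact .nil _

theorem runs_dir_7 {x N q d v E g h : BitVec w} {c : Path} (hc : c.Follows H x)
    (hn : ∀ i ∈ c.nodes, 1 ≤ i ∧ i ≤ M) :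
    Runs S (dir 7 8) 10 (st [x, N, q, d, v, 0#w, E, ad w c.top 0, 0#w, g, h] H)
      (st [x, N, q, d, v, 0#w, E, ad w c.top 0, BitVec.ofNat w c.side, g, h] H) := by
  cases c with
  | nil =>
    exact (runs_ifEqc_true (by exact ad_zero w) (.skip _) (by exact ad_zero w)).mono (by decide)
  | cons f c =>
    obtain ⟨i, s, b⟩ := f
    obtain ⟨h1, h2⟩ := hn i (by simp [Path.nodes])
    have h0 : ¬ ad w i 0 = 0#w := fun h => absurd ((ad_eq_zero hM h2).1 h) (by omega)
    have hs : s = sideOf H x i := hc _ List.mem_cons_self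
    have := runs_dirNode_7 hM hS (H := H) (x := x) (N := N) (q := q) (d := d) (v := v) (E := E)
      (g := g) (h := h) h2
    rw [← hs] at this
    exact runs_ifEqc_false (by exact h0) this (by exact h0)

end blocks

/-- The heap after the rotation of the child `v` of the node `c` on the side `d` above it, where
`b` is the inner grandchild, and field `f` of the record `p` points to `c`. -/
def rotated {w : ℕ} (H : Heap w) (c v p b f : ℕ) (d : Bool) : Heap w :=
  let H' := ((((H.upd c (fld d) (ad w b 0)).upd v (fld (!d)) (ad w c 0)).upd p f (ad w v 0)).upd
    c 3 (ad w v 0)).upd v 3 (ad w p 0)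
  if b = 0 then H' else H'.upd b 3 (ad w c 0)

/-! ### The rotation program on pointers. -/

section rotation

variable {S w M : ℕ} (hM : 16 * (M + 1) ≤ 2 ^ w) (hS : 16 * (M + 1) ≤ S) {H : Heap w}
include hM hS

/-- Old and new values of the pointers to be changed are all held in variables, so each change is a
reversible replacement. Afterwards the rotated tree itself provides copies of `b` (child of `c`) and
of `v` (parent of `c`), against which the variables 5 and 4 are cleared. -/
theorem runs_rotate {x N g h : BitVec w} {c v p b f : ℕ} {d : Bool}
    (hc : c ≤ M) (hv : v ≤ M) (hp : p ≤ M) (hb : b ≤ M) (hf : f < 3)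
    (hcv : c ≠ v) (hpc : p ≠ c) (hpv : p ≠ v) (hbc : b ≠ c) (hbv : b ≠ v)
    (h1 : H c (fld d) = ad w v 0) (h2 : H v (fld (!d)) = ad w b 0) (h3 : H p f = ad w c 0)
    (h4 : H c 3 = ad w p 0) (h5 : H v 3 = ad w c 0) (h6 : b ≠ 0 → H b 3 = ad w v 0) :
    Runs S rotate 60
      (st [x, N, ad w c 0, .ofNat w (fld d), ad w v 0, 0#w, .ofNat w (fld (!d)), ad w p 0,
        .ofNat w f, g, h] H)
      (st [x, N, ad w c 0, .ofNat w (fld d), 0#w, 0#w, .ofNat w (fld (!d)), ad w p 0,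
        .ofNat w f, g, h] (rotated H c v p b f d)) := by
  have hd := fld_lt d
  have hd' := fld_lt !d
  have hdd := fld_ne_not d
  have e1 : fld d ≠ 3 := by omega
  have e2 : fld (!d) ≠ 3 := by omega
  have e3 : f ≠ 3 := by omega
  refine .cons (runs_load_zero hM hS (a := v) (k := fld (!d)) (.mk rfl rfl hv (by omega)) rfl h2) ?_
  refine .replace hM hS (a := c) (k := fld d) (.mk rfl rfl hc (by omega))
    (.mk rfl rfl hc (by omega)) rfl rfl h1 ?_
  refine .replace hM hS (a := v) (k := fld (!d)) (.mk rfl rfl hv (by omega))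
    (.mk rfl rfl hv (by omega)) rfl rfl (by simp [Heap.upd_apply, hcv.symm, h2]) ?_
  refine .replace hM hS (a := p) (k := f) (.mk rfl rfl hp (by omega))
    (.mk rfl rfl hp (by omega)) rfl rfl (by simp [Heap.upd_apply, hpc, hpv, h3]) ?_
  refine .replace hM hS (a := c) (k := 3) (.mk rfl rfl hc (by omega))
    (.mk rfl rfl hc (by omega)) rfl rfl (by simp [Heap.upd_apply, hcv, hpc.symm, h4, e1.symm]) ?_
  refine .replace hM hS (a := v) (k := 3) (.mk rfl rfl hv (by omega))
    (.mk rfl rfl hv (by omega)) rfl rfl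
    (by simp [Heap.upd_apply, hcv.symm, hpv.symm, h5, e2.symm]) ?_
  refine .cons (T := 8) (s' := st [x, N, ad w c 0, .ofNat w (fld d), ad w v 0, ad w b 0,
    .ofNat w (fld (!d)), ad w p 0, .ofNat w f, g, h] (rotated H c v p b f d)) ?_ ?_
  -- A null grandchild has no parent pointer to mend; the access would hit the header.
  · by_cases hb0 : b = 0
    · subst hb0
      simp only [rotated, if_true]
      exact (runs_ifEqc_true rfl (.skip _) rfl).mono (by omega)
    · have hb0' : ¬ ad w b 0 = 0#w := fun h => hb0 ((ad_eq_zero hM hb).1 h)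
      simp only [rotated, if_neg hb0]
      refine runs_ifEqc_false hb0' ?_ hb0'
      refine .replace hM hS (a := b) (k := 3) (.mk rfl rfl hb (by omega))
        (.mk rfl rfl hb (by omega)) rfl rfl
        (by simp [Heap.upd_apply, hbc, hbv, h6 hb0, e3.symm]) (.nil _)
  · refine .cons (runs_unload_zero hM hS (a := c) (k := fld d) (.mk rfl rfl hc (by omega)) rfl ?_) ?_
    · by_cases hb0 : b = 0 <;>
        simp [rotated, Heap.upd_apply, hb0, hcv, hpc.symm, e1]
    · refine .cons (runs_unload_zero hM hS (a := c) (k := 3) (.mk rfl rfl hc (by omega)) rfl ?_)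
        (.nil _)
      by_cases hb0 : b = 0 <;>
        simp [rotated, Heap.upd_apply, hb0, hcv, hbc.symm]

end rotation

/-! ### Rotations of trees -/

theorem Path.top_mem (c : Path) : c.top = 0 ∨ c.top ∈ c.nodes := by
  cases c with
  | nil => exact .inl rfl
  | cons f c => exact .inr (by simp [top, nodes])

theorem Path.top_mem_labs (c : Path) : c.top = 0 ∨ c.top ∈ c.labs :=
  c.top_mem.imp_right fun h => c.nodes_subset_labs h

theorem Path.eq_nil_or_top_mem (c : Path) : c = [] ∨ c.top ∈ c.nodes := by
  cases c with
  | nil => exact .inl rfl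
  | cons f c => exact .inr (by simp [top, nodes])

theorem Path.side_lt (c : Path) : c.side < 3 := by
  cases c with
  | nil => exact Nat.zero_lt_succ _
  | cons f c => exact fld_lt _

theorem Path.side_pos {c : Path} (h : c.top ≠ 0) : 0 < c.side := by
  cases c with
  | nil => exact absurd rfl h
  | cons f c => exact fld_pos _

theorem rt_mem (t : BinaryTree ℕ) : rt t = 0 ∨ rt t ∈ lab t := by
  cases t with
  | nil => exact .inl rfl
  | node i l r => exact .inr (by simp [rt, lab])

theorem Links.reparent {w : ℕ} {H H' : Heap w} {t : BinaryTree ℕ} {q q' : ℕ} (h : Links H t q)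
    (hn : (lab t).Nodup) (hq : rt t ≠ 0 → H' (rt t) 3 = ad w q' 0) (h0 : 0 ∉ lab t)
    (hH : ∀ i ∈ lab t, ∀ k, 1 ≤ k → k < 4 → (i = rt t ∧ k = 3) ∨ H' i k = H i k) :
    Links H' t q' := by
  cases t with
  | nil => trivial
  | node i l r =>
    simp only [lab, List.mem_append, List.mem_cons, rt, not_or] at *
    simp only [Links] at h ⊢
    have hn' := List.nodup_append.1 hn
    have hn2 := List.nodup_cons.1 hn'.2.1
    have hi := hH i (by simp)
    rw [(hi 1 (by omega) (by omega)).resolve_left (by omega),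
      (hi 2 (by omega) (by omega)).resolve_left (by omega)]
    refine ⟨h.1, h.2.1, hq (Ne.symm h0.2.1), h.2.2.2.1.congr fun j hj k h1 h2 => ?_,
      h.2.2.2.2.congr fun j hj k h1 h2 => ?_⟩
    · refine (hH j (.inl hj) k h1 h2).resolve_left fun h => ?_
      exact hn'.2.2 j hj i (by simp) h.1
    · refine (hH j (.inr (.inr hj)) k h1 h2).resolve_left fun h => ?_
      exact hn2.1 (h.1 ▸ hj)

section rotated

variable {w : ℕ} {H : Heap w} {c v p b f : ℕ} {d : Bool}

theorem rotated_apply (i k : ℕ) : rotated H c v p b f d i k =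
    if b ≠ 0 ∧ i = b ∧ k = 3 then ad w c 0 else if i = v ∧ k = 3 then ad w p 0 else
    if i = c ∧ k = 3 then ad w v 0 else if i = p ∧ k = f then ad w v 0 else
    if i = v ∧ k = fld (!d) then ad w c 0 else if i = c ∧ k = fld d then ad w b 0 else H i k := by
  by_cases hb : b = 0 <;> simp [rotated, hb, Heap.upd_apply]

theorem rotated_of_four_le (hf : f < 3) {i k : ℕ} (hk : 4 ≤ k) :
    rotated H c v p b f d i k = H i k := by
  have := fld_lt d
  have := fld_lt !d
  simp [rotated_apply, show k ≠ 3 by omega, show k ≠ f by omega, show k ≠ fld d by omega,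
    show k ≠ fld (!d) by omega]

/-- A rotation writes to a field 0 only if `p` is the header, where this is the root pointer and not
a key. -/
theorem rotated_key (hf : p ≠ 0 → 0 < f) {i : ℕ} (hi : i ≠ 0) :
    rotated H c v p b f d i 0 = H i 0 := by
  have := fld_pos d
  have := fld_pos !d
  have h : ¬ (i = p ∧ 0 = f) := fun h => by
    have := hf (h.1 ▸ hi); omega
  rw [rotated_apply, if_neg (by omega), if_neg (by omega), if_neg (by omega), if_neg h,
    if_neg (by omega), if_neg (by omega)]

theorem rotated_of_ne {i : ℕ} (hc : i ≠ c) (hv : i ≠ v) (hp : i ≠ p) (hb : i ≠ b) (k : ℕ) :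
    rotated H c v p b f d i k = H i k := by
  simp [rotated_apply, hc, hv, hp, hb]

end rotated

/-! ### Rotations turn linked trees into linked trees. -/

section trees

variable {w : ℕ} {H : Heap w} {C : Path} {c v : ℕ} {d : Bool} {a m b : BinaryTree ℕ}

theorem lab_rotate_perm : (lab (plug C (nd d c (nd d v a m) b))).Perm
    (C.labs ++ (c :: v :: (lab a ++ (lab m ++ lab b)))) := by
  refine (lab_plug_perm _ _).trans (List.Perm.append_left _ ?_)
  refine (lab_nd_perm _ _ _ _).trans (.cons _ ?_)
  refine ((lab_nd_perm _ _ _ _).append_right _).trans ?_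
  simp

theorem lab_rotate : lab (nd d v a (nd d c m b)) = lab (nd d c (nd d v a m) b) := by
  cases d <;> simp [nd, lab]

/-- The path, the nodes `c` and `v`, and the three subtrees have disjoint labels, so each pointer
can be checked separately. The path is redirected to `v`, the inner subtree `m` gets the new parent
`c`, and the pointers inside `a` and `b` stay as they are. -/
theorem linked_rotate (hT : Linked H (plug C (nd d c (nd d v a m) b)))
    (hn : (lab (plug C (nd d c (nd d v a m) b))).Nodup)
    (h0 : 0 ∉ lab (plug C (nd d c (nd d v a m) b))) :
    Linked (rotated H c v C.top (rt m) C.side d) (plug C (nd d v a (nd d c m b))) := by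
  rw [lab_rotate_perm.nodup_iff] at hn
  rw [lab_rotate_perm.mem_iff] at h0
  simp only [List.mem_append, List.mem_cons, not_or] at h0
  obtain ⟨n1, n2, n3⟩ := List.nodup_append.1 hn
  obtain ⟨n4, n5⟩ := List.nodup_cons.1 n2
  obtain ⟨n6, n7⟩ := List.nodup_cons.1 n5
  obtain ⟨n8, n9, n10⟩ := List.nodup_append.1 n7
  obtain ⟨n11, n12, n13⟩ := List.nodup_append.1 n9
  simp only [List.mem_cons, List.mem_append, not_or] at n3 n4 n6 n10
  obtain ⟨z1, z2, z3, z4, z5, z6⟩ := h0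
  obtain ⟨hcv, c2, c3, c4⟩ := n4
  obtain ⟨v1, v2, v3⟩ := n6
  have fC : ∀ i ∈ C.labs, i ≠ c ∧ i ≠ v ∧ i ∉ lab a ∧ i ∉ lab m ∧ i ∉ lab b := fun i hi =>
    ⟨n3 i hi c (.inl rfl), n3 i hi v (.inr (.inl rfl)),
      fun h => n3 i hi i (.inr (.inr (.inl h))) rfl,
      fun h => n3 i hi i (.inr (.inr (.inr (.inl h)))) rfl,
      fun h => n3 i hi i (.inr (.inr (.inr (.inr h)))) rfl⟩
  have htop := C.top_mem_labs
  have hrt := rt_mem m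
  have hpc : C.top ≠ c := by
    rcases htop with h | h
    · rwa [h]
    · exact (fC _ h).1
  have hpv : C.top ≠ v := by
    rcases htop with h | h
    · rwa [h]
    · exact (fC _ h).2.1
  have hmc : rt m ≠ c := by
    rcases hrt with h | h
    · rwa [h]
    · rintro e; rw [e] at h; exact c3 h
  have hmv : rt m ≠ v := by
    rcases hrt with h | h
    · rwa [h]
    · rintro e; rw [e] at h; exact v2 h
  -- Both can be the null pointer; this is their only possible coincidence.
  have hmp : rt m = C.top → rt m = 0 := by
    intro e
    rcases hrt with h | h
    · exact h
    · rcases htop with h' | h'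
      · rw [e, h']
      · rw [e] at h; exact absurd h (fC _ h').2.2.2.1
  have fa : ∀ i ∈ lab a, i ≠ 0 ∧ i ∉ C.labs ∧ i ≠ c ∧ i ≠ v ∧ i ∉ lab m := fun i hi =>
    ⟨fun e => z4 (e ▸ hi), fun h => (fC i h).2.2.1 hi, fun e => c2 (e ▸ hi), fun e => v1 (e ▸ hi),
      fun h => n10 i hi i (.inl h) rfl⟩
  have fb : ∀ i ∈ lab b, i ≠ 0 ∧ i ∉ C.labs ∧ i ≠ c ∧ i ≠ v ∧ i ∉ lab m := fun i hi =>
    ⟨fun e => z6 (e ▸ hi), fun h => (fC i h).2.2.2.2 hi, fun e => c4 (e ▸ hi),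
      fun e => v3 (e ▸ hi), fun h => n13 i h i hi rfl⟩
  have fm : ∀ i ∈ lab m, i ≠ 0 ∧ i ≠ C.top ∧ i ≠ c ∧ i ≠ v := fun i hi =>
    ⟨fun e => z5 (e ▸ hi), fun e => htop.elim (fun h => z5 (h ▸ e ▸ hi))
      fun h => (fC _ h).2.2.2.1 (e ▸ hi), fun e => c3 (e ▸ hi), fun e => v2 (e ▸ hi)⟩
  have hd := fld_lt d
  have hd' := fld_lt !d
  have hd2 := fld_pos d
  have hd3 := fld_pos !d
  have hdd := fld_ne_not d
  have hside := C.side_lt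
  rw [linked_plug, links_nd, links_nd, rt_nd, rt_nd] at hT ⊢
  obtain ⟨hC, l1, l2, l3, ⟨l4, l5, l6, l7, l8⟩, l9⟩ := hT
  have off : ∀ i, i ≠ 0 → i ∉ C.labs → i ≠ c → i ≠ v → i ∉ lab m → ∀ k,
      rotated H c v C.top (rt m) C.side d i k = H i k := by
    intro i hi h1 h2 h3 h4 k
    refine rotated_of_ne h2 h3 ?_ ?_ k
    · rintro rfl; exact htop.elim hi h1
    · rintro rfl; exact hrt.elim hi h4
  refine ⟨hC.redirect v n1 z1 ?_ ?_, ?_, ?_, ?_, ?_, ?_, ?_, ?_, ?_, ?_⟩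
  · rw [rotated_apply, if_neg (by omega), if_neg (by omega), if_neg (by omega), if_pos ⟨rfl, rfl⟩]
  · intro i hi k hk hk'
    by_cases h : i = C.top ∧ k = C.side
    · exact .inl h
    · right
      have hic : i ≠ c := by
        rcases hi with hi | hi
        · rwa [hi]
        · exact (fC i hi).1
      have hiv : i ≠ v := by
        rcases hi with hi | hi
        · rwa [hi]
        · exact (fC i hi).2.1
      have him : ¬ (rt m ≠ 0 ∧ i = rt m ∧ k = 3) := by
        rintro ⟨h1, rfl, _⟩
        rcases hi with hi | hi
        · exact h1 hi
        · exact (fC _ hi).2.2.2.1 (hrt.resolve_left h1)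
      rw [rotated_apply, if_neg him, if_neg (by omega), if_neg (by omega), if_neg h,
        if_neg (by omega), if_neg (by omega)]
  · rw [rotated_apply, if_neg (by omega), if_neg (by omega), if_neg (by omega), if_neg (by omega),
      if_neg (by omega), if_neg (by omega), l4]
  · rw [rotated_apply, if_neg (by omega), if_neg (by omega), if_neg (by omega), if_neg (by omega),
      if_pos ⟨rfl, rfl⟩]
  · rw [rotated_apply, if_neg (by omega), if_pos ⟨rfl, rfl⟩]
  · refine l7.congr fun i hi k _ _ => ?_
    obtain ⟨h1, h2, h3, h4, h5⟩ := fa i hi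
    exact off i h1 h2 h3 h4 h5 k
  · rw [rotated_apply, if_neg (by omega), if_neg (by omega), if_neg (by omega), if_neg (by omega),
      if_neg (by omega), if_pos ⟨rfl, rfl⟩]
  · rw [rotated_apply, if_neg (by omega), if_neg (by omega), if_neg (by omega), if_neg (by omega),
      if_neg (by omega), if_neg (by omega), l2]
  · rw [rotated_apply, if_neg (by omega), if_neg (by omega), if_pos ⟨rfl, rfl⟩]
  · refine l8.reparent n11 (fun h => ?_) z5 fun i hi k h1 h2 => ?_
    · rw [rotated_apply, if_pos ⟨h, rfl, rfl⟩]
    · by_cases h : i = rt m ∧ k = 3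
      · exact .inl h
      · right
        obtain ⟨_, h3, h4, h5⟩ := fm i hi
        rw [rotated_apply, if_neg (by omega), if_neg (by omega), if_neg (by omega),
          if_neg (by omega), if_neg (by omega), if_neg (by omega)]
  · refine l9.congr fun i hi k _ _ => ?_
    obtain ⟨h1, h2, h3, h4, h5⟩ := fb i hi
    exact off i h1 h2 h3 h4 h5 k

theorem runs_rotate_tree {S M : ℕ} (hM : 16 * (M + 1) ≤ 2 ^ w) (hS : 16 * (M + 1) ≤ S)
    {x N g h : BitVec w} (hT : Linked H (plug C (nd d c (nd d v a m) b)))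
    (hn : (lab (plug C (nd d c (nd d v a m) b))).Nodup)
    (hl : ∀ i ∈ lab (plug C (nd d c (nd d v a m) b)), 1 ≤ i ∧ i ≤ M) :
    Runs S rotate 60
      (st [x, N, ad w c 0, .ofNat w (fld d), ad w v 0, 0#w, .ofNat w (fld (!d)), ad w C.top 0,
        .ofNat w C.side, g, h] H)
      (st [x, N, ad w c 0, .ofNat w (fld d), 0#w, 0#w, .ofNat w (fld (!d)), ad w C.top 0,
        .ofNat w C.side, g, h] (rotated H c v C.top (rt m) C.side d)) := by
  have hl' := fun i h => hl i (lab_rotate_perm.mem_iff.2 h)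
  rw [lab_rotate_perm.nodup_iff] at hn
  obtain ⟨n1, n2, n3⟩ := List.nodup_append.1 hn
  obtain ⟨n4, n5⟩ := List.nodup_cons.1 n2
  obtain ⟨n6, n7⟩ := List.nodup_cons.1 n5
  simp only [List.mem_cons, List.mem_append, not_or] at n3 n4 n6 hl'
  have htop := C.top_mem_labs
  have hrt := rt_mem m
  obtain ⟨c1, c2⟩ := hl' c (.inr (.inl rfl))
  obtain ⟨v1, v2⟩ := hl' v (.inr (.inr (.inl rfl)))
  rw [linked_plug, links_nd, links_nd, rt_nd, rt_nd] at hT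
  obtain ⟨hC, l1, l2, l3, ⟨l4, l5, l6, l7, l8⟩, l9⟩ := hT
  refine runs_rotate hM hS c2 v2 ?_ ?_ C.side_lt n4.1 ?_ ?_ ?_ ?_ l1 l5 hC.hole l3 l6
    fun h => l8.parent h
  · rcases htop with h | h
    · omega
    · exact (hl' _ (.inl h)).2
  · rcases hrt with h | h
    · omega
    · exact (hl' _ (.inr (.inr (.inr (.inr (.inl h)))))).2
  · rcases htop with h | h
    · omega
    · exact n3 _ h c (.inl rfl)
  · rcases htop with h | h
    · omega
    · exact n3 _ h v (.inr (.inl rfl))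
  · rcases hrt with h | h
    · omega
    · rintro e; rw [e] at h; exact n4.2.2.1 h
  · rcases hrt with h | h
    · omega
    · rintro e; rw [e] at h; exact n6.2.1 h

end trees

/-! ### Rebalancing -/

theorem Path.Follows.congr {w : ℕ} {H H' : Heap w} {x : BitVec w} {c : Path}
    (h : c.Follows H x) (hH : ∀ i ∈ c.nodes, H' i 0 = H i 0) : c.Follows H' x := by
  intro f hf
  rw [h f hf, sideOf, sideOf, hH f.1 (List.mem_map_of_mem hf)]

theorem Heap.upd_same {w : ℕ} (H : Heap w) {i k : ℕ} {v : BitVec w} (h : H i k = v) :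
    H.upd i k v = H := by
  funext i' k'
  simp only [Heap.upd_apply]
  split_ifs with h'
  · rw [h'.1, h'.2, h]
  · rfl

/-- The changes to the heap when a tree with labels `L` is rebalanced after the insertion of `N`;
the balances of the nodes in `J` may change. -/
structure Frame {w : ℕ} (H H' : Heap w) (L : List ℕ) (N : ℕ) (J : List ℕ) : Prop where
  out : ∀ j, j ∉ L → ∀ k, j ≠ 0 ∨ k ≠ 0 → H' j k = H j k
  key : ∀ j, j ≠ 0 → H' j 0 = H j 0
  bal : ∀ j, j ∉ J → H' j 4 = H j 4
  log : ∀ j k, 5 ≤ k → j ≠ N ∨ k = 5 ∨ 9 ≤ k → H' j k = H j k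
  new : ∀ k, 5 ≤ k → H' N k = H N k ∨ ∃ e < 3, H' N k = BitVec.ofNat w e

section frame

variable {w : ℕ} {H H' H'' : Heap w} {L J J' : List ℕ} {N : ℕ}

theorem Frame.refl : Frame H H L N [] := by constructor <;> simp

theorem Frame.trans (h : Frame H H' L N J) (h' : Frame H' H'' L N J') :
    Frame H H'' L N (J ++ J') where
  out j hj k hk := by rw [h'.out j hj k hk, h.out j hj k hk]
  key j hj := by rw [h'.key j hj, h.key j hj]
  bal j hj := by
    simp only [List.mem_append, not_or] at hj
    rw [h'.bal j hj.2, h.bal j hj.1]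
  log j k hk hj := by rw [h'.log j k hk hj, h.log j k hk hj]
  new k hk := by
    rcases h'.new k hk with h1 | h1
    · rw [h1]; exact h.new k hk
    · exact .inr h1

theorem Frame.upd_bal {i : ℕ} (hi : i ∈ L) (v : BitVec w) : Frame H (H.upd i 4 v) L N [i] where
  out j hj k _ := by simp [Heap.upd_apply, ne_of_mem_of_not_mem hi hj |>.symm]
  key j _ := by simp [Heap.upd_apply]
  bal j hj := by simp_all [Heap.upd_apply]
  log j k hk _ := by simp [Heap.upd_apply, show k ≠ 4 by omega]
  new k hk := by simp [Heap.upd_apply, show k ≠ 4 by omega]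

theorem Frame.upd_log {k e : ℕ} (hN : N ∈ L) (hk : 6 ≤ k ∧ k < 9) (he : e < 3) :
    Frame H (H.upd N k (.ofNat w e)) L N [] where
  out j hj k _ := by simp [Heap.upd_apply, ne_of_mem_of_not_mem hN hj |>.symm]
  key j _ := by simp [Heap.upd_apply, show 0 ≠ k by omega]
  bal j hj := by simp [Heap.upd_apply, show 4 ≠ k by omega]
  log j k' hk' hj := by
    rw [Heap.upd_apply, if_neg]
    rintro ⟨rfl, rfl⟩
    omega
  new k' hk := by
    by_cases h : k' = k
    · exact .inr ⟨e, he, by simp [Heap.upd_apply, h]⟩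
    · exact .inl (by simp [Heap.upd_apply, h])

/-- For the empty path the redirected pointer is field 0 of the header, the one word off `L` that a
`Frame` lets change. -/
theorem Frame.rotated {c v b : ℕ} {C : Path} {d : Bool} (hc : c ∈ L) (hv : v ∈ L)
    (hp : C = [] ∨ C.top ∈ L) (hb : b = 0 ∨ b ∈ L) :
    Frame H (rotated H c v C.top b C.side d) L N [] where
  out j hj k hk := by
    have h1 : ¬ (b ≠ 0 ∧ j = b ∧ k = 3) := by
      rintro ⟨h, rfl, _⟩; exact hj (hb.resolve_left h)
    have h2 : j ≠ v := by rintro rfl; exact hj hv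
    have h3 : j ≠ c := by rintro rfl; exact hj hc
    have h4 : ¬ (j = C.top ∧ k = C.side) := by
      rintro ⟨rfl, rfl⟩
      rcases hp with rfl | h
      · simp [Path.top, Path.side] at hk
      · exact hj h
    rw [rotated_apply, if_neg h1, if_neg (by omega), if_neg (by omega), if_neg h4,
      if_neg (by omega), if_neg (by omega)]
  key j hj := rotated_key (fun h => Path.side_pos h) hj
  bal j hj := rotated_of_four_le C.side_lt le_rfl
  log j k hk _ := rotated_of_four_le C.side_lt (by omega)
  new k hk := .inl (rotated_of_four_le C.side_lt (by omega))

end frame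

theorem three_sub_fld (w : ℕ) (d : Bool) :
    BitVec.ofNat w 3 - BitVec.ofNat w (fld d) = BitVec.ofNat w (fld (!d)) := by
  rw [← fld_add d, add_comm, BitVec.ofNat_add, BitVec.add_sub_cancel]

theorem fld_add_not (w : ℕ) (d : Bool) :
    BitVec.ofNat w (fld (!d)) + BitVec.ofNat w (fld d) = BitVec.ofNat w 3 := by
  rw [← fld_add d, add_comm (fld d), BitVec.ofNat_add]

section settle

variable {S w M : ℕ} (hM : 16 * (M + 1) ≤ 2 ^ w) (hS : 16 * (M + 1) ≤ S) {H H' : Heap w}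
  {x : BitVec w} {N c : ℕ} {d : Bool}
include hM hS

/-- Both branches can leave `c` with balance 0, so the balance cannot tell them apart. The outcome
`e` of the comparison is therefore kept in field 6 of `N`, against which variable 9 is cleared after
the branch. The run `hr` of the branch is supplied by the cases below. -/
theorem runs_settle {e : ℕ} (hc : c ≤ M) (hN : N ≤ M) (h6 : H N 6 = 0#w)
    (he : (if H c 4 = BitVec.ofNat w (fld d) then 0#w + 1 else 0#w) = .ofNat w e)
    (hr : Runs S (.ifRev (.eqc (.var 9) 1) rebalance (unstore 6 2 (.c 4)) (.eqc (.var 9) 1)) 500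
      (st [x, ad w N 0, ad w c 0, .ofNat w (fld d), 0#w, 0#w, .ofNat w (fld (!d)), 0#w, 0#w,
        .ofNat w e, 0#w] (H.upd N 6 (.ofNat w e)))
      (st [x, ad w N 0, ad w c 0, .ofNat w (fld d), 0#w, 0#w, .ofNat w (fld (!d)), 0#w, 0#w,
        .ofNat w e, 0#w] H'))
    (h6' : H' N 6 = .ofNat w e) :
    Runs S settle 550
      (st [x, ad w N 0, ad w c 0, .ofNat w (fld d), 0#w, 0#w, 0#w, 0#w, 0#w, 0#w, 0#w] H)
      (st [x, ad w N 0, ad w c 0, .ofNat w (fld d), 0#w, 0#w, 0#w, 0#w, 0#w, 0#w, 0#w] H') := by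
  refine .cons (runs_addC_to 6 3 rfl (BitVec.zero_add _)) ?_
  refine .cons (runs_subV_to 6 3 rfl rfl (three_sub_fld w d)) ?_
  refine .cons (runs_load_zero hM hS (a := c) (k := 4) (.mk rfl rfl hc (by omega)) rfl rfl) ?_
  refine .cons (runs_eq_to 5 3 9 rfl rfl rfl he) ?_
  refine .cons (runs_store_zero hM hS (a := N) (k := 6) (.mk rfl rfl hN (by omega)) rfl h6) ?_
  refine .cons (runs_unload_zero hM hS (a := c) (k := 4) (v := H c 4)
    (.mk rfl rfl hc (by omega)) rfl (by simp [Heap.upd_apply])) ?_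
  refine .cons hr ?_
  refine .cons (runs_unload_zero hM hS (a := N) (k := 6) (.mk rfl rfl hN (by omega)) rfl h6') ?_
  refine .cons (runs_addV_to 6 3 rfl rfl (fld_add_not w d)) ?_
  exact .cons (runs_subC_to 6 3 rfl (BitVec.sub_self _)) (.nil _)

variable {C : Path} {v v' : ℕ} {a m b : BinaryTree ℕ}

/-- Both kinds of rebalancing end with the rotation of a child `v'` on the side `d` above `c`: in
the single case `v'` is `v`, and in the double case a first rotation has put the grandchild there.
Field 7 of `N` records which case occurred. -/
theorem runs_rebalance {e : ℕ} {g : BitVec w} (hv : v ≤ M) (hN : N ≤ M) (hN0 : H N 7 = 0#w)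
    (hcv : c ≠ v)
    (h1 : H c (fld d) = ad w v 0) (h2 : H c 4 = .ofNat w (fld d))
    (he : (if H v 4 = BitVec.ofNat w (fld d) then 0#w + 1 else 0#w) = .ofNat w e)
    (hr : Runs S (.ifRev (.eqc (.var 10) 1) (unstore 3 4 (.c 4)) double (.eqc (.var 10) 1)) 300
      (st [x, ad w N 0, ad w c 0, .ofNat w (fld d), ad w v 0, 0#w, .ofNat w (fld (!d)), 0#w, 0#w,
        g, .ofNat w e] ((H.upd c 4 0#w).upd N 7 (.ofNat w e)))
      (st [x, ad w N 0, ad w c 0, .ofNat w (fld d), ad w v' 0, 0#w, .ofNat w (fld (!d)), 0#w, 0#w,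
        g, .ofNat w e] H'))
    (h7 : H' N 7 = .ofNat w e) (hT : Linked H' (plug C (nd d c (nd d v' a m) b)))
    (hn : (lab (plug C (nd d c (nd d v' a m) b))).Nodup)
    (hl : ∀ i ∈ lab (plug C (nd d c (nd d v' a m) b)), 1 ≤ i ∧ i ≤ M) (hC : C.Follows H' x) :
    Runs S rebalance 490
      (st [x, ad w N 0, ad w c 0, .ofNat w (fld d), 0#w, 0#w, .ofNat w (fld (!d)), 0#w, 0#w,
        g, 0#w] H)
      (st [x, ad w N 0, ad w c 0, .ofNat w (fld d), 0#w, 0#w, .ofNat w (fld (!d)), 0#w, 0#w,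
        g, 0#w] (rotated H' c v' C.top (rt m) C.side d)) := by
  have hd := fld_lt d
  have hmem : ∀ i ∈ C.labs ++ (c :: v' :: (lab a ++ (lab m ++ lab b))), 1 ≤ i ∧ i ≤ M :=
    fun i h => hl i (lab_rotate_perm.mem_iff.2 h)
  have hc : c ≤ M := (hmem c (by simp)).2
  have hv' : v' ≤ M := (hmem v' (by simp)).2
  have hnodes : ∀ i ∈ C.nodes, 1 ≤ i ∧ i ≤ M := fun i hi =>
    hmem i (List.mem_append_left _ (C.nodes_subset_labs hi))
  have hT' := linked_rotate hT hn fun h => absurd (hl 0 h).1 (by omega)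
  rw [linked_plug, links_nd, links_nd, rt_nd, rt_nd] at hT'
  obtain ⟨-, -, -, k3, -, -, -, k6, -⟩ := hT'
  have k0 := hT
  rw [linked_plug, links_nd, links_nd, rt_nd, rt_nd] at k0
  obtain ⟨-, k1, -, k2, -⟩ := k0
  have hp : C.top ≤ M := by
    rcases C.top_mem with h | h
    · omega
    · exact (hnodes _ h).2
  refine .cons (runs_unstore_zero hM hS (a := c) (k := 4) (.mk rfl rfl hc (by omega)) rfl h2) ?_
  refine .cons (runs_load_zero hM hS (a := c) (k := fld d) (.mk rfl rfl hc (by omega)) rfl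
    (by simpa [Heap.upd_apply, show fld d ≠ 4 by omega] using h1)) ?_
  refine .cons (runs_load_zero hM hS (a := v) (k := 4) (v := H v 4) (.mk rfl rfl hv (by omega)) rfl
    (by simp [Heap.upd_apply, hcv.symm])) ?_
  refine .cons (runs_eq_to 5 3 10 rfl rfl rfl he) ?_
  refine .cons (runs_store_zero hM hS (a := N) (k := 7) (.mk rfl rfl hN (by omega)) rfl
    (by simpa [Heap.upd_apply] using hN0)) ?_
  refine .cons (runs_unload_zero hM hS (a := v) (k := 4) (v := H v 4) (.mk rfl rfl hv (by omega))
    rfl (by simp [Heap.upd_apply, hcv.symm])) ?_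
  refine .cons hr ?_
  refine .cons (runs_unload_zero hM hS (a := N) (k := 7) (.mk rfl rfl hN (by omega)) rfl h7) ?_
  refine .cons (runs_load_zero hM hS (a := c) (k := 3) (.mk rfl rfl hc (by omega)) rfl k2) ?_
  refine .cons (runs_dir_7 hM hS hC hnodes) ?_
  refine .cons (runs_rotate_tree hM hS hT hn hl) ?_
  refine .cons ((runs_dir_7 hM hS (hC.congr fun i hi => rotated_key (fun h => Path.side_pos h)
    (by have := hnodes i hi; omega)) hnodes).inv (isRev_dir _ _)) ?_
  -- Now `v'` is the parent of `c` and has the former parent of `c` as its own parent, so the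
  -- variables 7 and 4 can be cleared.
  refine .cons (runs_load_zero hM hS (a := c) (k := 3) (.mk rfl rfl hc (by omega)) rfl k6) ?_
  refine .cons (runs_unload_zero hM hS (a := v') (k := 3) (.mk rfl rfl hv' (by omega)) rfl k3) ?_
  exact .cons (runs_unload_zero hM hS (a := c) (k := 3) (.mk rfl rfl hc (by omega)) rfl k6) (.nil _)

end settle

/-- The heap after the adjustment of the balances for a double rotation. -/
def doubled {w : ℕ} (H : Heap w) (N c v g z : ℕ) (d : Bool) : Heap w :=
  ((((H.upd v 4 0#w).upd g 4 0#w).upd N 8 (.ofNat w z)).upd c 4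
    (if z = fld d then .ofNat w (fld (!d)) else 0#w)).upd v 4
    (if z = fld (!d) then .ofNat w (fld d) else 0#w)

theorem doubled_of_lt {w : ℕ} (H : Heap w) (N c v g z : ℕ) (d : Bool) {i k : ℕ} (hk : k < 4) :
    doubled H N c v g z d i k = H i k := by
  simp [doubled, Heap.upd_apply, show k ≠ 4 by omega, show k ≠ 8 by omega]

theorem doubled_four {w : ℕ} (H : Heap w) (N c v g z : ℕ) (d : Bool) (i : ℕ) :
    doubled H N c v g z d i 4 =
      if i = v then (if z = fld (!d) then .ofNat w (fld d) else 0#w) else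
      if i = c then (if z = fld d then .ofNat w (fld (!d)) else 0#w) else
      if i = g then 0#w else H i 4 := by
  by_cases hv : i = v
  · simp [doubled, Heap.upd_apply, hv]
  · by_cases hc : i = c <;> simp [doubled, Heap.upd_apply, hv, hc]

theorem doubled_of_lt_eight {w : ℕ} (H : Heap w) (N c v g z : ℕ) (d : Bool) {i k : ℕ}
    (hk : 4 < k) (hk' : k < 8) : doubled H N c v g z d i k = H i k := by
  simp [doubled, Heap.upd_apply, show k ≠ 4 by omega, show k ≠ 8 by omega]

/-! ### Single and double rotations with their balances. -/

section double

variable {S w M : ℕ} (hM : 16 * (M + 1) ≤ 2 ^ w) (hS : 16 * (M + 1) ≤ S) {H : Heap w}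
  {x : BitVec w} {N c v g : ℕ} {d : Bool} {C : Path} {α β γ δ b : BinaryTree ℕ}

theorem lab_double_perm : (lab (plug C (nd d c (nd (!d) v (nd (!d) g δ γ) α) b))).Perm
    (C.labs ++ (c :: v :: g :: (lab δ ++ (lab γ ++ (lab α ++ lab b))))) := by
  refine (lab_plug_perm _ _).trans (List.Perm.append_left _ ?_)
  refine (lab_nd_perm _ _ _ _).trans (.cons _ ?_)
  refine ((lab_nd_perm _ _ _ _).append_right _).trans (.cons _ ?_)
  refine (((lab_nd_perm _ _ _ _).append_right _).append_right _).trans (.cons _ ?_)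
  simp

include hM hS

/-- The first rotation reuses `rotate` with renamed variables: `g` is rotated above `v`, the sides
`d` and `!d` are exchanged, and the node above is `c`, that is, the path is `(c, d, b) :: C`. The
old balance `z` of `g` determines the new balances of `c` and `v`; it is moved to field 8 of `N`,
because the balance of `g` becomes 0 in every case. -/
theorem runs_double {z : ℕ} {u u' : BitVec w} (hN : N ≤ M) (hz : z < 3)
    (hT : Linked H (plug C (nd d c (nd (!d) v (nd (!d) g δ γ) α) b)))
    (hn : (lab (plug C (nd d c (nd (!d) v (nd (!d) g δ γ) α) b))).Nodup)
    (hl : ∀ i ∈ lab (plug C (nd d c (nd (!d) v (nd (!d) g δ γ) α) b)), 1 ≤ i ∧ i ≤ M)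
    (hc4 : H c 4 = 0#w) (hv4 : H v 4 = .ofNat w (fld (!d))) (hg4 : H g 4 = .ofNat w z)
    (hN8 : H N 8 = 0#w) :
    Runs S double 250
      (st [x, ad w N 0, ad w c 0, .ofNat w (fld d), ad w v 0, 0#w, .ofNat w (fld (!d)), 0#w, 0#w,
        u, u'] H)
      (st [x, ad w N 0, ad w c 0, .ofNat w (fld d), ad w g 0, 0#w, .ofNat w (fld (!d)), 0#w, 0#w,
        u, u'] (rotated (doubled H N c v g z d) v g c (rt γ) (fld d) (!d))) := by
  have hd := fld_lt d
  have hd' := fld_lt !d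
  have hmem : ∀ i ∈ C.labs ++ (c :: v :: g :: (lab δ ++ (lab γ ++ (lab α ++ lab b)))),
    1 ≤ i ∧ i ≤ M := fun i h => hl i (lab_double_perm.mem_iff.2 h)
  have hn' := lab_double_perm.nodup_iff.1 hn
  obtain ⟨-, n2, -⟩ := List.nodup_append.1 hn'
  obtain ⟨n3, n4⟩ := List.nodup_cons.1 n2
  obtain ⟨n5, -⟩ := List.nodup_cons.1 n4
  simp only [List.mem_cons, not_or] at n3 n5
  have hcv : c ≠ v := n3.1
  have hcg : c ≠ g := n3.2.1
  have hvg : v ≠ g := n5.1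
  have hc := (hmem c (by simp)).2
  have hv := (hmem v (by simp)).2
  have hg := (hmem g (by simp)).2
  have hTd : Linked (doubled H N c v g z d)
      (plug ((c, d, b) :: C) (nd (!d) v (nd (!d) g δ γ) α)) :=
    hT.congr (doubled_of_lt _ _ _ _ _ _ _ (by omega)) fun i _ k _ hk =>
      doubled_of_lt _ _ _ _ _ _ _ hk
  have hTr := linked_rotate hTd hn fun h => absurd (hl 0 h).1 (by omega)
  rw [linked_plug, LinksC, links_nd, rt_nd, rt_nd, Bool.not_not] at hTr
  obtain ⟨⟨r1, -⟩, -, r2, -⟩ := hTr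
  have hT0 := hT
  rw [linked_plug, links_nd, links_nd, rt_nd, rt_nd, Bool.not_not] at hT0
  obtain ⟨-, -, -, -, ⟨t1, -⟩, -⟩ := hT0
  rw [rt_nd] at t1
  have hrot := runs_rotate_tree hM hS (x := x) (N := ad w N 0) (g := u) (h := u') hTd hn hl
  rw [Bool.not_not] at hrot
  refine .cons (runs_unstore_zero hM hS (a := v) (k := 4) (.mk rfl rfl hv (by omega)) rfl hv4) ?_
  refine .cons (runs_swapV_to 7 2 rfl rfl) ?_
  refine .cons (runs_swapV_to 2 4 rfl rfl) ?_
  refine .cons (runs_swapV_to 3 6 rfl rfl) ?_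
  refine .cons (runs_addV_to 8 6 rfl rfl (BitVec.zero_add _)) ?_
  refine .cons (runs_load_zero hM hS (a := v) (k := fld (!d)) (v := ad w g 0)
    (.mk rfl rfl hv (by omega)) rfl (by simpa [Heap.upd_apply, hd'.ne, show fld (!d) ≠ 4 by omega]
      using t1)) ?_
  refine .cons (runs_load_zero hM hS (a := g) (k := 4) (v := .ofNat w z)
    (.mk rfl rfl hg (by omega)) rfl (by simpa [Heap.upd_apply, hvg.symm] using hg4)) ?_
  refine .cons (runs_unstore_zero hM hS (a := g) (k := 4) (v := .ofNat w z)
    (.mk rfl rfl hg (by omega)) rfl (by simpa [Heap.upd_apply, hvg.symm] using hg4)) ?_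
  refine .cons (runs_store_zero hM hS (a := N) (k := 8) (v := .ofNat w z)
    (.mk rfl rfl hN (by omega)) rfl (by simpa [Heap.upd_apply] using hN8)) ?_
  refine .cons (T := 5) (s' := st [x, ad w N 0, ad w v 0, .ofNat w (fld (!d)), ad w g 0,
    .ofNat w z, .ofNat w (fld d), ad w c 0, .ofNat w (fld d), u, u']
    ((((H.upd v 4 0#w).upd g 4 0#w).upd N 8 (.ofNat w z)).upd c 4
      (if z = fld d then .ofNat w (fld (!d)) else 0#w))) ?_ ?_
  · by_cases h : z = fld d
    · rw [if_pos h]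
      exact runs_ifEq_true (by rw [h]; rfl) (runs_store_zero hM hS (a := c) (k := 4)
        (.mk rfl rfl hc (by omega)) rfl (by simpa [Heap.upd_apply, hcv, hcg] using hc4))
        (by rw [h]; rfl)
    · have h' : ¬ BitVec.ofNat w z = BitVec.ofNat w (fld d) := fun e =>
        h ((ofNat_inj hM (by omega) (by omega)).1 e)
      -- The skipped store amounts to writing 0 over 0, so that `doubled` describes both outcomes.
      rw [if_neg h, Heap.upd_same (i := c) (k := 4) (v := 0#w) _
        (by simpa [Heap.upd_apply, hcv, hcg] using hc4)]
      refine Runs.mono (T := 2) ?_ (by omega)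
      exact runs_ifEq_false (by exact h') (.skip _) (by exact h')
  refine .cons (T := 5) (s' := st [x, ad w N 0, ad w v 0, .ofNat w (fld (!d)), ad w g 0,
    .ofNat w z, .ofNat w (fld d), ad w c 0, .ofNat w (fld d), u, u']
    (doubled H N c v g z d)) ?_ ?_
  · by_cases h : z = fld (!d)
    · rw [doubled, if_pos h]
      exact runs_ifEq_true (by rw [h]; rfl) (runs_store_zero hM hS (a := v) (k := 4)
        (.mk rfl rfl hv (by omega)) rfl (by simp [Heap.upd_apply, hcv.symm, hvg]))
        (by rw [h]; rfl)
    · have h' : ¬ BitVec.ofNat w z = BitVec.ofNat w (fld (!d)) := fun e =>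
        h ((ofNat_inj hM (by omega) (by omega)).1 e)
      rw [doubled, if_neg h, Heap.upd_same (i := v) (k := 4) (v := 0#w)
        ((((H.upd v 4 0#w).upd g 4 0#w).upd N 8 (.ofNat w z)).upd c 4
          (if z = fld d then .ofNat w (fld (!d)) else 0#w))
        (by simp [Heap.upd_apply, hcv.symm, hvg])]
      refine Runs.mono (T := 2) ?_ (by omega)
      exact runs_ifEq_false (by exact h') (.skip _) (by exact h')
  refine .cons (runs_unload_zero hM hS (a := N) (k := 8) (.mk rfl rfl hN (by omega)) rfl
    (by simp [doubled, Heap.upd_apply])) ?_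
  refine .cons hrot ?_
  refine .cons (runs_subV_to 8 6 rfl rfl (BitVec.sub_self _)) ?_
  refine .cons (runs_swapV_to 3 6 rfl rfl) ?_
  refine .cons (runs_swapV_to 7 2 rfl rfl) ?_
  refine .cons (runs_load_zero hM hS (a := c) (k := fld d) (.mk rfl rfl hc (by omega)) rfl r1) ?_
  exact .cons (runs_unload_zero hM hS (a := g) (k := fld d) (.mk rfl rfl hg (by omega)) rfl r2)
    (.nil _)

/-- Rebalancing by a single rotation. -/
theorem exists_settle_single {A B : BinaryTree ℕ} {h : ℕ}
    (hn : (lab (plug C (nd d c (nd d v A B) b))).Nodup)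
    (hl : ∀ i ∈ lab (plug C (nd d c (nd d v A B) b)), 1 ≤ i ∧ i ≤ M)
    (hN : N ∈ lab (plug C (nd d c (nd d v A B) b))) (h6 : H N 6 = 0#w) (h7 : H N 7 = 0#w)
    (hT : Linked H (plug C (nd d c (nd d v A B) b))) (hBC : BalC H C (max h b.height + 1))
    (hA : Bal H A) (hB : Bal H B) (hb : Bal H b) (hc4 : H c 4 = .ofNat w (fld d))
    (hv4 : H v 4 = .ofNat w (fld d)) (hF : C.Follows H x) (hh : h = b.height + 1)
    (hAB : A.height = B.height + 1) (hBb : B.height = b.height) :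
    ∃ t' H' J, Runs S settle 550
      (st [x, ad w N 0, ad w c 0, .ofNat w (fld d), 0#w, 0#w, 0#w, 0#w, 0#w, 0#w, 0#w] H)
      (st [x, ad w N 0, ad w c 0, .ofNat w (fld d), 0#w, 0#w, 0#w, 0#w, 0#w, 0#w, 0#w] H') ∧
      Linked H' (plug C t') ∧ Bal H' (plug C t') ∧
      lab (plug C t') = lab (plug C (nd d c (nd d v A B) b)) ∧
      Frame H H' (lab (plug C (nd d c (nd d v A B) b))) N J ∧ J.length ≤ 10 := by
  have hp := lab_rotate_perm (C := C) (c := c) (v := v) (d := d) (a := A) (m := B) (b := b)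
  have hn' := hp.nodup_iff.1 hn
  obtain ⟨-, n2, n3⟩ := List.nodup_append.1 hn'
  obtain ⟨n4, n5⟩ := List.nodup_cons.1 n2
  obtain ⟨n6, -⟩ := List.nodup_cons.1 n5
  simp only [List.mem_cons, List.mem_append, not_or] at n3 n4 n6
  have hcL : c ∈ lab (plug C (nd d c (nd d v A B) b)) := hp.mem_iff.2 (by simp)
  have hvL : v ∈ lab (plug C (nd d c (nd d v A B) b)) := hp.mem_iff.2 (by simp)
  have hCL : ∀ i ∈ C.nodes, i ∈ lab (plug C (nd d c (nd d v A B) b)) := fun i hi =>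
    hp.mem_iff.2 (List.mem_append_left _ (C.nodes_subset_labs hi))
  have hcM := (hl _ hcL).2
  have hvM := (hl _ hvL).2
  have hNM := (hl _ hN).2
  -- The heap just before the rotation. The two logged flags mean: a rotation, and a single one.
  set H₁ := (((H.upd N 6 (.ofNat w 1)).upd c 4 0#w).upd N 7 (.ofNat w 1)).upd v 4 0#w with hH₁
  have hT₁ : Linked H₁ (plug C (nd d c (nd d v A B) b)) := hT.congr (by simp [hH₁, Heap.upd_apply]) fun i _ k h1 h2 => by
    simp [hH₁, Heap.upd_apply, show k ≠ 4 by omega, show k ≠ 6 by omega, show k ≠ 7 by omega]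
  have hbal : ∀ i, rotated H₁ c v C.top (rt B) C.side d i 4 =
      if i = v then 0#w else if i = c then 0#w else H i 4 := by
    intro i
    rw [rotated_of_four_le C.side_lt le_rfl]
    simp [hH₁, Heap.upd_apply]
  have hT' := hT
  rw [linked_plug, links_nd, rt_nd, rt_nd] at hT'
  have l1 : H c (fld d) = ad w v 0 := hT'.2.1
  have hd := fld_lt d
  -- The list of changed balances is written in the shape that the chain of `Frame.trans` below
  -- produces.
  refine ⟨nd d v A (nd d c B b), rotated H₁ c v C.top (rt B) C.side d,
    ((([] ++ [c]) ++ []) ++ [v]) ++ [], ?_,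
    linked_rotate hT₁ hn fun h => absurd (hl 0 h).1 (by omega), ?_, ?_, ?_, by simp⟩
  · refine runs_settle hM hS (e := 1) hcM hNM h6 (by rw [if_pos hc4]; simp) ?_ ?_
    · refine Runs.mono (T := 492) ?_ (by omega)
      refine runs_ifEqc_true rfl (runs_rebalance hM hS (e := 1) hvM hNM
        (by simpa [Heap.upd_apply] using h7) n4.1
        (by simpa [Heap.upd_apply, show fld d ≠ 6 by omega] using l1)
        (by simpa [Heap.upd_apply] using hc4)
        (by rw [if_pos (by simpa [Heap.upd_apply] using hv4)]; simp) ?_ ?_ hT₁ hn hl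
        (hF.congr fun i _ => by simp [hH₁, Heap.upd_apply])) rfl
      · refine Runs.mono (T := 5) ?_ (by omega)
        exact runs_ifEqc_true rfl (runs_unstore_zero hM hS (a := v) (k := 4)
          (.mk rfl rfl hvM (by omega)) rfl (by simpa [Heap.upd_apply, Ne.symm n4.1] using hv4)) rfl
      · simp [hH₁, Heap.upd_apply]
    · rw [rotated_of_four_le C.side_lt (by omega)]
      simp [hH₁, Heap.upd_apply]
  · rw [bal_plug, bal_nd, bal_nd, height_nd, height_nd, hbal, hbal]
    refine ⟨?_, .inl ⟨by simp, by omega⟩, ?_, .inl ⟨by simp, by omega⟩, ?_, ?_⟩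
    -- The rotated subtree has the height of the subtree at `c` before the insertion, so the
    -- balances on the path remain right.
    · rw [show max A.height (max B.height b.height + 1) + 1 = max h b.height + 1 by omega]
      refine hBC.congr fun i hi => ?_
      rw [hbal, if_neg (n3 i hi v (by simp)), if_neg (n3 i hi c (by simp))]
    · refine hA.congr fun i hi => ?_
      rw [hbal, if_neg (by rintro rfl; exact n6.1 hi), if_neg (by rintro rfl; exact n4.2.1 hi)]
    · refine hB.congr fun i hi => ?_
      rw [hbal, if_neg (by rintro rfl; exact n6.2.1 hi), if_neg (by rintro rfl; exact n4.2.2.1 hi)]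
    · refine hb.congr fun i hi => ?_
      rw [hbal, if_neg (by rintro rfl; exact n6.2.2 hi), if_neg (by rintro rfl; exact n4.2.2.2 hi)]
  · rw [lab_plug, lab_plug, lab_rotate]
  · exact ((((Frame.upd_log hN (by omega) (by omega)).trans (Frame.upd_bal hcL _)).trans
      (Frame.upd_log hN (by omega) (by omega))).trans (Frame.upd_bal hvL _)).trans
      (Frame.rotated hcL hvL (C.eq_nil_or_top_mem.imp_right (hCL _))
        ((rt_mem B).imp_right fun h => hp.mem_iff.2 (by simp [h])))

/-- Rebalancing by a double rotation. -/
theorem exists_settle_double {h : ℕ}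
    (hn : (lab (plug C (nd d c (nd (!d) v (nd (!d) g δ γ) α) b))).Nodup)
    (hl : ∀ i ∈ lab (plug C (nd d c (nd (!d) v (nd (!d) g δ γ) α) b)), 1 ≤ i ∧ i ≤ M)
    (hN : N ∈ lab (plug C (nd d c (nd (!d) v (nd (!d) g δ γ) α) b))) (h6 : H N 6 = 0#w) (h7 : H N 7 = 0#w) (h8 : H N 8 = 0#w)
    (hT : Linked H (plug C (nd d c (nd (!d) v (nd (!d) g δ γ) α) b))) (hBC : BalC H C (max h b.height + 1))
    (hα : Bal H α) (hδ : Bal H δ) (hγ : Bal H γ) (hb : Bal H b) (hc4 : H c 4 = .ofNat w (fld d))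
    (hv4 : H v 4 = .ofNat w (fld (!d))) (hg4 : BalCode (H g 4) (!d) δ.height γ.height)
    (hF : C.Follows H x) (hh : h = b.height + 1)
    (hAB : max δ.height γ.height + 1 = α.height + 1) (hBb : α.height = b.height) :
    ∃ t' H' J, Runs S settle 550
      (st [x, ad w N 0, ad w c 0, .ofNat w (fld d), 0#w, 0#w, 0#w, 0#w, 0#w, 0#w, 0#w] H)
      (st [x, ad w N 0, ad w c 0, .ofNat w (fld d), 0#w, 0#w, 0#w, 0#w, 0#w, 0#w, 0#w] H') ∧
      Linked H' (plug C t') ∧ Bal H' (plug C t') ∧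
      lab (plug C t') = lab (plug C (nd d c (nd (!d) v (nd (!d) g δ γ) α) b)) ∧
      Frame H H' (lab (plug C (nd d c (nd (!d) v (nd (!d) g δ γ) α) b))) N J ∧ J.length ≤ 10 := by
  have hp := lab_double_perm (C := C) (c := c) (v := v) (g := g) (d := d) (α := α) (γ := γ)
    (δ := δ) (b := b)
  have hn' := hp.nodup_iff.1 hn
  obtain ⟨-, n2, n3⟩ := List.nodup_append.1 hn'
  obtain ⟨n4, n5⟩ := List.nodup_cons.1 n2
  obtain ⟨n6, n7⟩ := List.nodup_cons.1 n5
  obtain ⟨n8, -⟩ := List.nodup_cons.1 n7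
  simp only [List.mem_cons, List.mem_append, not_or] at n3 n4 n6 n8
  have hcL : c ∈ lab (plug C (nd d c (nd (!d) v (nd (!d) g δ γ) α) b)) := hp.mem_iff.2 (by simp)
  have hvL : v ∈ lab (plug C (nd d c (nd (!d) v (nd (!d) g δ γ) α) b)) := hp.mem_iff.2 (by simp)
  have hgL : g ∈ lab (plug C (nd d c (nd (!d) v (nd (!d) g δ γ) α) b)) := hp.mem_iff.2 (by simp)
  have hCL : ∀ i ∈ C.nodes, i ∈ lab (plug C (nd d c (nd (!d) v (nd (!d) g δ γ) α) b)) := fun i hi =>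
    hp.mem_iff.2 (List.mem_append_left _ (C.nodes_subset_labs hi))
  have hcM := (hl _ hcL).2
  have hvM := (hl _ hvL).2
  have hNM := (hl _ hN).2
  have hd := fld_lt d
  have hd' := fld_lt !d
  have hdn := fld_ne_not d
  have hdp := fld_pos d
  have hdp' := fld_pos !d
  obtain ⟨z, hz, hgz⟩ : ∃ z < 3, H g 4 = BitVec.ofNat w z := hg4.exists_lt
  set H₀ := ((H.upd N 6 (.ofNat w 1)).upd c 4 0#w).upd N 7 (.ofNat w 0) with hH₀
  set H₁ := doubled H₀ N c v g z d with hH₁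
  have hlt₀ : ∀ i k, k < 4 → H₀ i k = H i k := fun i k hk => by
    simp [hH₀, Heap.upd_apply, show k ≠ 4 by omega, show k ≠ 6 by omega, show k ≠ 7 by omega]
  have hlt : ∀ i k, k < 4 → H₁ i k = H i k := fun i k hk => by
    rw [hH₁, doubled_of_lt _ _ _ _ _ _ _ hk, hlt₀ i k hk]
  have hT₀ : Linked H₀ (plug C (nd d c (nd (!d) v (nd (!d) g δ γ) α) b)) := hT.congr (hlt₀ _ _ (by omega)) fun i _ k _ hk => hlt₀ i k hk
  have hT₁ : Linked H₁ (plug ((c, d, b) :: C) (nd (!d) v (nd (!d) g δ γ) α)) :=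
    hT.congr (hlt _ _ (by omega)) fun i _ k _ hk => hlt i k hk
  -- The heap between the two rotations: `g` is now the child of `c`, and `v` is below `g`.
  set H₂ := rotated H₁ v g c (rt γ) (fld d) (!d) with hH₂
  have hT₂ : Linked H₂ (plug C (nd d c (nd d g (nd d v α γ) δ) b)) := by
    have := linked_rotate hT₁ hn fun h => absurd (hl 0 h).1 (by omega)
    rwa [nd_not, nd_not] at this
  have hlab : lab (plug C (nd d c (nd d g (nd d v α γ) δ) b)) = lab (plug C (nd d c (nd (!d) v (nd (!d) g δ γ) α) b)) := by
    rw [lab_plug, lab_plug]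
    congr 2
    cases d <;> simp [nd, lab]
  have h4 : ∀ i, H₂ i 4 = if i = v then (if z = fld (!d) then .ofNat w (fld d) else 0#w) else
      if i = c then (if z = fld d then .ofNat w (fld (!d)) else 0#w) else
      if i = g then 0#w else H i 4 := by
    intro i
    rw [hH₂, rotated_of_four_le (by omega) le_rfl, hH₁, doubled_four]
    by_cases hc : i = c
    · rw [if_pos hc, if_pos hc]
    · rw [if_neg hc, if_neg hc, hH₀]
      simp [Heap.upd_apply, hc]
  have hbal : ∀ i, rotated H₂ c g C.top (rt δ) C.side d i 4 =
      if i = v then (if z = fld (!d) then .ofNat w (fld d) else 0#w) else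
      if i = c then (if z = fld d then .ofNat w (fld (!d)) else 0#w) else
      if i = g then 0#w else H i 4 := by
    intro i
    rw [rotated_of_four_le C.side_lt le_rfl, h4]
  have hT' := hT
  rw [linked_plug, links_nd, rt_nd, rt_nd] at hT'
  have l1 : H c (fld d) = ad w v 0 := hT'.2.1
  have h01 : ¬ BitVec.ofNat w 0 = BitVec.ofNat w 1 := by
    rw [ofNat_inj hM (by omega) (by omega)]; omega
  have hvd : ¬ H v 4 = BitVec.ofNat w (fld d) := by
    rw [hv4, ofNat_inj hM (by omega) (by omega)]; exact hdn.symm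
  have key₂ : ∀ i, i ≠ 0 → H₂ i 0 = H i 0 := fun i hi => by
    rw [hH₂, rotated_key (fun _ => hdp) hi, hlt i 0 (by omega)]
  have h78 : H₂ N 7 = .ofNat w 0 := by
    rw [hH₂, rotated_of_four_le (by omega) (by omega), hH₁,
      doubled_of_lt_eight _ _ _ _ _ _ _ (by omega) (by omega), hH₀]
    simp [Heap.upd_apply]
  have h66 : H₂ N 6 = .ofNat w 1 := by
    rw [hH₂, rotated_of_four_le (by omega) (by omega), hH₁,
      doubled_of_lt_eight _ _ _ _ _ _ _ (by omega) (by omega), hH₀]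
    simp [Heap.upd_apply]
  have hCn : ∀ i ∈ C.nodes, i ≠ 0 := fun i hi => by have := (hl i (hCL i hi)).1; omega
  refine ⟨nd d g (nd d v α γ) (nd d c δ b), rotated H₂ c g C.top (rt δ) C.side d,
    (((((((([] ++ [c]) ++ []) ++ [v]) ++ [g]) ++ []) ++ [c]) ++ [v]) ++ []) ++ [], ?_,
    linked_rotate hT₂ (hlab ▸ hn) fun h => absurd (hl 0 (hlab ▸ h)).1 (by omega), ?_, ?_, ?_,
    by simp⟩
  · refine runs_settle hM hS (e := 1) hcM hNM h6 (by rw [if_pos hc4]; simp) ?_ ?_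
    · refine Runs.mono (T := 492) ?_ (by omega)
      refine runs_ifEqc_true rfl (runs_rebalance hM hS (e := 0) (v' := g) hvM hNM
        (by simpa [Heap.upd_apply] using h7) n4.1
        (by simpa [Heap.upd_apply, show fld d ≠ 6 by omega] using l1)
        (by simpa [Heap.upd_apply] using hc4)
        (by rw [if_neg (by simpa [Heap.upd_apply] using hvd)]) ?_ h78 hT₂ (hlab ▸ hn)
        (fun i hi => hl i (hlab ▸ hi)) (hF.congr fun i hi => key₂ i (hCn i hi))) rfl
      refine Runs.mono (T := 252) ?_ (by omega)
      exact runs_ifEqc_false h01 (runs_double hM hS hNM hz hT₀ hn hl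
        (by simp [Heap.upd_apply]) (by simpa [hH₀, Heap.upd_apply, Ne.symm n4.1] using hv4)
        (by simpa [hH₀, Heap.upd_apply, Ne.symm n4.2.1] using hgz)
        (by simpa [hH₀, Heap.upd_apply] using h8)) h01
    · rw [rotated_of_four_le C.side_lt (by omega), h66]
  · have hcases : (z = 0 ∧ δ.height = γ.height) ∨ (z = fld (!d) ∧ δ.height = γ.height + 1) ∨
        (z = fld d ∧ γ.height = δ.height + 1) := by
      rw [BalCode, hgz, Bool.not_not] at hg4
      simpa only [ofNat_inj hM (show z < 16 by omega) (show fld (!d) < 16 by omega),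
        ofNat_inj hM (show z < 16 by omega) (show fld d < 16 by omega),
        ofNat_inj hM (show z < 16 by omega) (show 0 < 16 by omega)] using hg4
    rw [bal_plug, bal_nd, bal_nd, bal_nd, height_nd, height_nd, height_nd, hbal, hbal, hbal,
      if_neg (Ne.symm n6.1), if_neg (Ne.symm n4.2.1), if_pos rfl, if_pos rfl, if_neg n4.1,
      if_pos rfl]
    refine ⟨?_, .inl ⟨rfl, by omega⟩, ⟨?_, ?_, ?_⟩, ?_, ?_, ?_⟩
    · rw [show max (max α.height γ.height + 1) (max δ.height b.height + 1) + 1 =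
        max h b.height + 1 by omega]
      refine hBC.congr fun i hi => ?_
      rw [hbal, if_neg (n3 i hi v (by simp)), if_neg (n3 i hi c (by simp)),
        if_neg (n3 i hi g (by simp))]
    -- `v` keeps `α` and receives `γ`, which is the lower of the two exactly if `g` leaned to the
    -- side `!d`.
    · rcases hcases with ⟨h1, h2⟩ | ⟨h1, h2⟩ | ⟨h1, h2⟩
      · exact .inl ⟨if_neg (by omega), by omega⟩
      · exact .inr (.inl ⟨if_pos h1, by omega⟩)
      · exact .inl ⟨if_neg (by omega), by omega⟩
    · refine hα.congr fun i hi => ?_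
      rw [hbal, if_neg (by rintro rfl; simp_all), if_neg (by rintro rfl; simp_all),
        if_neg (by rintro rfl; simp_all)]
    · refine hγ.congr fun i hi => ?_
      rw [hbal, if_neg (by rintro rfl; simp_all), if_neg (by rintro rfl; simp_all),
        if_neg (by rintro rfl; simp_all)]
    -- `c` keeps `b` and receives `δ`, which is the lower of the two exactly if `g` leaned to the
    -- side `d`.
    · rcases hcases with ⟨h1, h2⟩ | ⟨h1, h2⟩ | ⟨h1, h2⟩
      · exact .inl ⟨if_neg (by omega), by omega⟩
      · exact .inl ⟨if_neg (by omega), by omega⟩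
      · exact .inr (.inr ⟨if_pos h1, by omega⟩)
    · refine hδ.congr fun i hi => ?_
      rw [hbal, if_neg (by rintro rfl; simp_all), if_neg (by rintro rfl; simp_all),
        if_neg (by rintro rfl; simp_all)]
    · refine hb.congr fun i hi => ?_
      rw [hbal, if_neg (by rintro rfl; simp_all), if_neg (by rintro rfl; simp_all),
        if_neg (by rintro rfl; simp_all)]
  · rw [← hlab, lab_plug, lab_plug, lab_rotate]
  · exact (((((((((Frame.upd_log hN (by omega) (by omega)).trans (Frame.upd_bal hcL _)).trans
      (Frame.upd_log hN (by omega) (by omega))).trans (Frame.upd_bal hvL _)).trans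
      (Frame.upd_bal hgL _)).trans (Frame.upd_log hN (by omega) hz)).trans
      (Frame.upd_bal hcL _)).trans (Frame.upd_bal hvL _)).trans
      (Frame.rotated (C := (c, d, b) :: C) hvL hgL (.inr hcL)
        ((rt_mem γ).imp_right fun h => hp.mem_iff.2 (by simp [h])))).trans
      (Frame.rotated hcL hgL (C.eq_nil_or_top_mem.imp_right (hCL _))
        ((rt_mem δ).imp_right fun h => hp.mem_iff.2 (by simp [h])))

/-- The program `settle` rebalances a tree in which the subtree `t` on the side `d` of the
unbalanced node `c` has grown. -/
theorem exists_settle {t : BinaryTree ℕ} {h : ℕ}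
    (hn : (lab (plug C (nd d c t b))).Nodup)
    (hl : ∀ i ∈ lab (plug C (nd d c t b)), 1 ≤ i ∧ i ≤ M)
    (hN : N ∈ lab (plug C (nd d c t b))) (h6 : H N 6 = 0#w) (h7 : H N 7 = 0#w) (h8 : H N 8 = 0#w)
    (hT : Linked H (plug C (nd d c t b))) (hB : BalC H ((c, d, b) :: C) h) (hBt : Bal H t)
    (ht : t.height = h + 1) (hc4 : H c 4 ≠ 0#w) (htall : 1 ≤ h → H (rt t) 4 ≠ 0#w)
    (hF : C.Follows H x) :
    ∃ t' H' J, Runs S settle 550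
      (st [x, ad w N 0, ad w c 0, .ofNat w (fld d), 0#w, 0#w, 0#w, 0#w, 0#w, 0#w, 0#w] H)
      (st [x, ad w N 0, ad w c 0, .ofNat w (fld d), 0#w, 0#w, 0#w, 0#w, 0#w, 0#w, 0#w] H') ∧
      Linked H' (plug C t') ∧ Bal H' (plug C t') ∧
      lab (plug C t') = lab (plug C (nd d c t b)) ∧
      Frame H H' (lab (plug C (nd d c t b))) N J ∧ J.length ≤ 10 := by
  have hNM := (hl N hN).2
  have hcL : c ∈ lab (plug C (nd d c t b)) := by
    rw [(lab_plug_perm _ _).mem_iff]; simp [mem_lab_nd]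
  have hcM := (hl c hcL).2
  have hdn := fld_ne_not d
  have hd := fld_lt d
  have hd' := fld_lt !d
  obtain ⟨hcode, hBb, hBC⟩ := hB
  rcases hcode with ⟨h1, -⟩ | ⟨h1, hbh⟩ | ⟨h1, hbh⟩
  · exact absurd h1 hc4
  · have hh : 1 ≤ h := by omega
    obtain ⟨v, A, B, rfl⟩ := exists_eq_nd d (t := t) (by omega)
    rw [rt_nd] at htall
    rw [height_nd] at ht
    rw [bal_nd] at hBt
    obtain ⟨hvc, hBA, hBB⟩ := hBt
    rcases hvc with ⟨h2, -⟩ | ⟨h2, hAB⟩ | ⟨h2, hAB⟩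
    -- A subtree that has grown and was not empty before has a root that leans, so one of the two
    -- rotations applies.
    · exact absurd h2 (htall hh)
    · exact exists_settle_single hM hS hn hl hN h6 h7 hT hBC hBA hBB hBb h1 h2 hF (by omega) hAB
        (by omega)
    · obtain ⟨g, D, E, rfl⟩ := exists_eq_nd (!d) (t := B) (by omega)
      rw [bal_nd] at hBB
      rw [height_nd] at hAB ht
      -- This brings the tree into the form of the double rotation, with the inner subtree of `v`
      -- named first.
      rw [← nd_not d v] at *
      exact exists_settle_double hM hS hn hl hN h6 h7 h8 hT hBC hBA hBB.2.1 hBB.2.2 hBb h1 h2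
        hBB.1 hF (by omega) hAB (by omega)
  -- The lower subtree of `c` has grown: `c` becomes balanced and its height stays the same.
  · have hzero : (if H c 4 = BitVec.ofNat w (fld d) then 0#w + 1 else 0#w) = .ofNat w 0 := by
      rw [if_neg]
      rw [h1, ofNat_inj hM (by omega) (by omega)]
      exact hdn.symm
    have h10 : ¬ BitVec.ofNat w 0 = BitVec.ofNat w 1 := by
      rw [ofNat_inj hM (by omega) (by omega)]; omega
    have hn' := (lab_plug_perm _ _).nodup_iff.1 hn
    obtain ⟨-, n2, n3⟩ := List.nodup_append.1 hn'
    rw [(lab_nd_perm _ _ _ _).nodup_iff, List.nodup_cons] at n2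
    simp only [List.mem_append, not_or] at n2
    refine ⟨nd d c t b, (H.upd N 6 (.ofNat w 0)).upd c 4 0#w, [] ++ [c], ?_, ?_, ?_, rfl, ?_, by simp⟩
    · refine runs_settle hM hS hcM hNM h6 hzero ((runs_ifEqc_false (by exact h10)
        (runs_unstore_zero hM hS (a := c) (k := 4) (.mk rfl rfl hcM (by omega)) rfl ?_)
        (by exact h10)).mono (by omega)) ?_
      · simpa [Heap.upd_apply] using h1
      · simp [Heap.upd_apply]
    · refine hT.congr (by simp [Heap.upd_apply]) fun i _ k h1 h2 => ?_
      simp [Heap.upd_apply, show k ≠ 4 by omega, show k ≠ 6 by omega]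
    · rw [bal_plug, bal_nd, height_nd]
      refine ⟨?_, .inl ⟨by simp [Heap.upd_apply], by omega⟩, ?_, ?_⟩
      · rw [ht, hbh, max_self]
        rw [hbh, max_eq_right (by omega)] at hBC
        refine hBC.congr fun i hi => ?_
        have := n3 i hi c (by simp [mem_lab_nd])
        simp [Heap.upd_apply, this]
      · refine hBt.congr fun i hi => ?_
        have : i ≠ c := by rintro rfl; exact n2.1.1 hi
        simp [Heap.upd_apply, this]
      · refine hBb.congr fun i hi => ?_
        have : i ≠ c := by rintro rfl; exact n2.1.2 hi
        simp [Heap.upd_apply, this]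
    · exact (Frame.upd_log hN (by omega) (by omega)).trans (Frame.upd_bal hcL _)

end double

/-! ### Walking in the tree -/

theorem exists_nd_of_ne_nil (d : Bool) {t : BinaryTree ℕ} (h : t ≠ .nil) : ∃ i a b, t = nd d i a b := by
  cases t with
  | nil => exact absurd rfl h
  | node i l r => cases d <;> exact ⟨i, _, _, rfl⟩

section walks

variable {S w M : ℕ} (hM : 16 * (M + 1) ≤ 2 ^ w) (hS : 16 * (M + 1) ≤ S) {H : Heap w}
  {x N : BitVec w}
include hM hS

theorem runs_alloc {n : ℕ} {t : BinaryTree ℕ} (h0 : H 0 4 = ad w n 0) (h1 : H 0 0 = ad w (rt t) 0) :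
    Runs S alloc 20
      (st [x, 0#w, 0#w, 0#w, 0#w, 0#w, 0#w, 0#w, 0#w, 0#w, 0#w] H)
      (st [x, ad w (n + 1) 0, 0#w, 0#w, ad w (rt t) 0, 0#w, 0#w, 0#w, 0#w, 0#w, 0#w]
        (H.upd 0 4 (ad w (n + 1) 0))) := by
  have hadd : H 0 4 + BitVec.ofNat w 16 = ad w (n + 1) 0 := by
    rw [h0, ad, ad, ← BitVec.ofNat_add]; congr 1
  have h2 : Runs S (store 3 2 (.c 4)) 3
      (st [x, 0#w, 0#w, BitVec.ofNat w 16, 0#w, 0#w, 0#w, 0#w, 0#w, 0#w, 0#w] H)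
      (st [x, 0#w, 0#w, BitVec.ofNat w 16, 0#w, 0#w, 0#w, 0#w, 0#w, 0#w, 0#w]
        (H.upd 0 4 (ad w (n + 1) 0))) := by
    have := runs_store (H := H) (l := [x, 0#w, 0#w, BitVec.ofNat w 16, 0#w, 0#w, 0#w, 0#w, 0#w, 0#w, 0#w])
      hM hS (i := 3) (j := 2) (f := .c 4) (a := 0) (k := 4) (by simp) (by decide) trivial rfl rfl
      (by omega) (by omega)
    rw [← hadd]
    exact this
  refine .cons (runs_addC_to 3 16 rfl (BitVec.zero_add _)) ?_
  refine .cons h2 ?_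
  refine .cons (runs_subC_to 3 16 rfl (BitVec.sub_self _)) ?_
  refine .cons (runs_load_zero hM hS (a := 0) (k := 4) (v := ad w (n + 1) 0)
    (.mk rfl rfl (by omega) (by omega)) rfl (by simp [Heap.upd_apply])) ?_
  -- Variable 3 is zero again, so the offset `.v 3` denotes field 0 of the header, the root pointer.
  exact .cons (runs_load_zero hM hS (a := 0) (k := 0) (v := ad w (rt t) 0)
    (.mk rfl rfl (by omega) (by omega)) rfl (by simpa [Heap.upd_apply] using h1)) (.nil _)

/-- The position left behind equals the parent pointer of the new position, and the side is cleared
by recomputing it, so a step down leaves no trace in memory. -/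
theorem runs_walkDownBody {c : Path} {i : ℕ} {a b : BinaryTree ℕ}
    (hT : Links H (nd (sideOf H x i) i a b) c.top) (hc : c.Follows H x)
    (hn : ∀ j ∈ c.nodes, 1 ≤ j ∧ j ≤ M) (hi : 1 ≤ i ∧ i ≤ M) :
    Runs S walkDownBody 27
      (st [x, N, ad w c.top 0, .ofNat w c.side, ad w i 0, 0#w, 0#w, 0#w, 0#w, 0#w, 0#w] H)
      (st [x, N, ad w i 0, .ofNat w (fld (sideOf H x i)), ad w (rt a) 0, 0#w, 0#w, 0#w, 0#w, 0#w,
        0#w] H) := by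
  rw [links_nd] at hT
  have hd := fld_lt (sideOf H x i)
  refine .cons ((runs_dir_2 hM hS hc hn).inv (isRev_dir _ _)) ?_
  refine .cons (runs_unload_zero hM hS (a := i) (k := 3) (v := ad w c.top 0)
    (.mk rfl rfl hi.2 (by omega)) rfl hT.2.2.1) ?_
  refine .cons (runs_swapV_to 2 4 rfl rfl) ?_
  refine .cons (runs_dir_2 hM hS (c := (i, sideOf H x i, b) :: c) ?_ ?_) ?_
  · intro f hf
    rcases List.mem_cons.1 hf with rfl | hf
    · rfl
    · exact hc f hf
  · intro j hj
    rcases List.mem_cons.1 hj with rfl | hj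
    · exact hi
    · exact hn j hj
  · exact .cons (runs_load_zero hM hS (a := i) (k := fld (sideOf H x i)) (v := ad w (rt a) 0)
      (.mk rfl rfl hi.2 (by omega)) rfl hT.1) (.nil _)

/-- The entry test, a null parent, holds only above the root, since all nodes have nonzero
addresses. The induction is on the number of nodes, as each tree is decomposed according to the side
of `x`. -/
theorem iterates_walkDown {t : BinaryTree ℕ} {c : Path} (hT : Links H t c.top)
    (hc : c.Follows H x) (hn : ∀ j ∈ c.nodes, 1 ≤ j ∧ j ≤ M) (ht : ∀ j ∈ lab t, 1 ≤ j ∧ j ≤ M) :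
    ∃ c' k, plug c' .nil = plug c t ∧ Path.Follows H x c' ∧ c'.length = c.length + k ∧
      Iterates S (.eqc (.var 2) 0) (.eqc (.var 4) 0) walkDownBody 27 k
        (st [x, N, ad w c.top 0, .ofNat w c.side, ad w (rt t) 0, 0#w, 0#w, 0#w, 0#w, 0#w, 0#w] H)
        (st [x, N, ad w (Path.top c') 0, .ofNat w (Path.side c'), 0#w, 0#w, 0#w, 0#w, 0#w, 0#w,
          0#w] H) := by
  induction hh : t.numNodes using Nat.strong_induction_on generalizing t c with
  | _ m ih =>
    by_cases ht0 : t = .nil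
    · subst ht0
      exact ⟨c, 0, rfl, hc, rfl, .done (inBounds_var _ _ _) (inBounds_var _ _ _) rfl⟩
    · obtain ⟨i, a, b, hti⟩ := exists_nd_of_ne_nil (sideOf H x (rt t)) ht0
      have hir : rt t = i := by
        have := congrArg rt hti
        rwa [rt_nd] at this
      rw [hir] at hti ⊢
      subst hti
      have hi := ht i (mem_lab_nd.2 (.inl rfl))
      have hT' := links_nd.1 hT
      obtain ⟨c', k, h1, h2, h3, h4⟩ := ih a.numNodes (by
          rw [← hh, ← length_lab, ← length_lab, (lab_nd_perm _ _ _ _).length_eq]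
          simp) (t := a) (c := (i, sideOf H x i, b) :: c) hT'.2.2.2.1
        (by
          intro f hf
          rcases List.mem_cons.1 hf with rfl | hf
          · rfl
          · exact hc f hf)
        (by
          intro j hj
          rcases List.mem_cons.1 hj with rfl | hj
          · exact hi
          · exact hn j hj)
        (fun j hj => ht j (mem_lab_nd.2 (.inr (.inl hj)))) rfl
      have hi0 : ¬ ad w i 0 = 0#w := fun h => absurd ((ad_eq_zero hM hi.2).1 h) (by omega)
      refine ⟨c', k + 1, h1, h2, by rw [h3]; simp; omega, ?_⟩
      exact .step (inBounds_var _ _ _) (inBounds_var _ _ _) (by exact hi0)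
        (runs_walkDownBody hM hS hT hc hn hi) (by exact hi0) h4

end walks

/-- The heap after a new leaf `N` with the key `x` is linked at the end of a path. -/
def linkedLeaf {w : ℕ} (H : Heap w) (c : Path) (N : ℕ) (x : BitVec w) : Heap w :=
  (((H.upd c.top c.side (ad w N 0)).upd N 3 (ad w c.top 0)).upd N 0 x).upd N 9 (.ofNat w 1)

theorem linkedLeaf_of_ne {w : ℕ} {H : Heap w} {c : Path} {N : ℕ} {x : BitVec w} {i k : ℕ}
    (hi : i ≠ N) (h : i ≠ c.top ∨ k ≠ c.side) : linkedLeaf H c N x i k = H i k := by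
  rw [linkedLeaf, Heap.upd_apply, Heap.upd_apply, Heap.upd_apply, Heap.upd_apply,
    if_neg (by omega), if_neg (by omega), if_neg (by omega), if_neg (by omega)]

theorem linkedLeaf_new {w : ℕ} {H : Heap w} {c : Path} {N : ℕ} {x : BitVec w} (hN : c.top ≠ N)
    (k : ℕ) : linkedLeaf H c N x N k = if k = 9 then .ofNat w 1 else if k = 0 then x else
      if k = 3 then ad w c.top 0 else H N k := by
  simp [linkedLeaf, Heap.upd_apply, hN.symm]

theorem linkedLeaf_key {w : ℕ} {H : Heap w} {c : Path} {N : ℕ} {x : BitVec w} {i : ℕ}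
    (hi : i ≠ N) (h0 : i ≠ 0) : linkedLeaf H c N x i 0 = H i 0 := by
  refine linkedLeaf_of_ne hi ?_
  by_cases h : i = c.top
  · have := Path.side_pos (c := c) (by omega); omega
  · exact .inl h

theorem linkedLeaf_four {w : ℕ} {H : Heap w} {c : Path} {N : ℕ} {x : BitVec w} {i : ℕ} :
    linkedLeaf H c N x i 4 = H i 4 := by
  have := c.side_lt
  simp [linkedLeaf, Heap.upd_apply, show 4 ≠ c.side by omega]

/-! ### The new leaf, and single steps up. -/

section link

variable {S w M : ℕ} (hM : 16 * (M + 1) ≤ 2 ^ w) (hS : 16 * (M + 1) ≤ S) {H : Heap w}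
  {x : BitVec w} {N : ℕ}
include hM hS

/-- The keys on the path are unchanged by the new leaf, so `dir` run backwards in the new heap still
clears the side; the new parent pointer of `N` then clears the position. -/
theorem runs_link {c : Path} (hc : c.Follows H x) (hn : ∀ j ∈ c.nodes, 1 ≤ j ∧ j ≤ M)
    (hN : N ≤ M) (hNc : N ∉ c.nodes) (hN0 : N ≠ 0)
    (h0 : H c.top c.side = 0#w) (h1 : ∀ k, H N k = 0#w) :
    Runs S link 40
      (st [x, ad w N 0, ad w c.top 0, .ofNat w c.side, 0#w, 0#w, 0#w, 0#w, 0#w, 0#w, 0#w] H)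
      (st [x, ad w N 0, 0#w, 0#w, 0#w, 0#w, 0#w, 0#w, 0#w, 0#w, 0#w] (linkedLeaf H c N x)) := by
  have hcN : c.top ≠ N := by
    rcases c.top_mem with h | h
    · omega
    · rintro rfl; exact hNc h
  have hcM : c.top ≤ M := by
    rcases c.top_mem with h | h
    · omega
    · exact (hn _ h).2
  have hs := c.side_lt
  refine .cons (runs_store_zero hM hS (a := c.top) (k := c.side) (.mk rfl rfl hcM (by omega)) rfl
    h0) ?_
  refine .cons (runs_store_zero hM hS (a := N) (k := 3) (v := ad w c.top 0)
    (.mk rfl rfl hN (by omega)) rfl (by simp [Heap.upd_apply, hcN.symm, h1])) ?_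
  refine .cons (runs_store_zero hM hS (a := N) (k := 0) (v := x)
    (.mk rfl rfl hN (by omega)) rfl (by simp [Heap.upd_apply, hcN.symm, h1])) ?_
  refine .cons (runs_addC_to 5 1 rfl (BitVec.zero_add _)) ?_
  refine .cons (runs_store_zero hM hS (a := N) (k := 9) (v := .ofNat w 1)
    (.mk rfl rfl hN (by omega)) rfl (by simp [Heap.upd_apply, hcN.symm, h1])) ?_
  refine .cons (runs_subC_to 5 1 rfl (BitVec.sub_self _)) ?_
  refine .cons ((runs_dir_2 hM hS (H := linkedLeaf H c N x) (hc.congr fun i hi => ?_) hn).inv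
    (isRev_dir _ _)) ?_
  · exact linkedLeaf_key (by rintro rfl; exact hNc hi) (by have := (hn i hi).1; omega)
  exact .cons (runs_unload_zero hM hS (a := N) (k := 3) (v := ad w c.top 0)
    (.mk rfl rfl hN (by omega)) rfl (by simp [linkedLeaf_new hcN])) (.nil _)

theorem runs_startUp {c : Path} {u : BitVec w} (hn : ∀ j ∈ c.nodes, 1 ≤ j ∧ j ≤ M) (hN : N ≤ M)
    (h3 : H N 3 = ad w c.top 0) (h4 : H c.top 4 = u) :
    Runs S startUp 10
      (st [x, ad w N 0, 0#w, 0#w, 0#w, 0#w, 0#w, 0#w, 0#w, 0#w, 0#w] H)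
      (st [x, ad w N 0, ad w c.top 0, 0#w, ad w N 0, u, 0#w, 0#w, 0#w, 0#w, 0#w] H) := by
  have hcM : c.top ≤ M := by
    rcases c.top_mem with h | h
    · omega
    · exact (hn _ h).2
  refine .cons (runs_addV_to 4 1 rfl rfl (BitVec.zero_add _)) ?_
  refine .cons (runs_load_zero hM hS (a := N) (k := 3) (.mk rfl rfl hN (by omega)) rfl h3) ?_
  exact .cons (runs_load_zero hM hS (a := c.top) (k := 4) (.mk rfl rfl hcM (by omega)) rfl h4)
    (.nil _)

/-- The loop has not ended, so the balance in field 4, and its copy in variable 5, are 0: the new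
balance can be added without loss, and variable 5 needs no clearing. The child left behind is found
again on the side of `x`. -/
theorem runs_walkUpBody {c : Path} {i : ℕ} {t b : BinaryTree ℕ}
    (hT : Linked H (plug c (nd (sideOf H x i) i t b)))
    (hn : ∀ j ∈ c.nodes, 1 ≤ j ∧ j ≤ M) (hi : 1 ≤ i ∧ i ≤ M) (h4 : H i 4 = 0#w) :
    Runs S walkUpBody 30
      (st [x, ad w N 0, ad w i 0, 0#w, ad w (rt t) 0, 0#w, 0#w, 0#w, 0#w, 0#w, 0#w] H)
      (st [x, ad w N 0, ad w c.top 0, 0#w, ad w i 0,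
        H.upd i 4 (.ofNat w (fld (sideOf H x i))) c.top 4, 0#w, 0#w, 0#w, 0#w, 0#w]
        (H.upd i 4 (.ofNat w (fld (sideOf H x i))))) := by
  have hcM : c.top ≤ M := by
    rcases c.top_mem with h | h
    · omega
    · exact (hn _ h).2
  have hd := fld_lt (sideOf H x i)
  rw [linked_plug, links_nd] at hT
  obtain ⟨-, hT1, -, hT3, -⟩ := hT
  have hs : sideOf (H.upd i 4 (.ofNat w (fld (sideOf H x i)))) x i = sideOf H x i := by
    simp [sideOf, Heap.upd_apply]
  have hdir := runs_dirNode_2 hM hS (H := H.upd i 4 (.ofNat w (fld (sideOf H x i)))) (x := x)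
    (N := ad w N 0) (v := 0#w) (E := 0#w) (p := 0#w) (F := 0#w) (g := 0#w) (h := 0#w) hi.2
  rw [hs] at hdir
  refine .cons (runs_dirNode_2 hM hS hi.2) ?_
  refine .cons (runs_store_zero hM hS (a := i) (k := 4) (.mk rfl rfl hi.2 (by omega)) rfl h4) ?_
  refine .cons (runs_unload_zero hM hS (a := i) (k := fld (sideOf H x i)) (v := ad w (rt t) 0)
    (.mk rfl rfl hi.2 (by omega)) rfl
    (by simpa [Heap.upd_apply, show fld (sideOf H x i) ≠ 4 by omega] using hT1)) ?_
  refine .cons (hdir.inv (isRev_dirNode _ _)) ?_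
  refine .cons (runs_swapV_to 4 2 rfl rfl) ?_
  refine .cons (runs_load_zero hM hS (a := i) (k := 3) (v := ad w c.top 0)
    (.mk rfl rfl hi.2 (by omega)) rfl (by simpa [Heap.upd_apply] using hT3)) ?_
  exact .cons (runs_load_zero hM hS (a := c.top) (k := 4) (.mk rfl rfl hcM (by omega)) rfl rfl)
    (.nil _)

theorem runs_stopUp {c : Path} {t : BinaryTree ℕ} {u : BitVec w} (hT : Linked H (plug c t))
    (hc : c.Follows H x) (hn : ∀ j ∈ c.nodes, 1 ≤ j ∧ j ≤ M) (hN : N ≤ M)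
    (h4 : H c.top 4 = u) (h5 : H N 5 = 0#w) :
    Runs S stopUp 20
      (st [x, ad w N 0, ad w c.top 0, 0#w, ad w (rt t) 0, u, 0#w, 0#w, 0#w, 0#w, 0#w] H)
      (st [x, ad w N 0, ad w c.top 0, .ofNat w c.side, 0#w, 0#w, 0#w, 0#w, 0#w, 0#w, 0#w]
        (H.upd N 5 (ad w c.top 0))) := by
  have hcM : c.top ≤ M := by
    rcases c.top_mem with h | h
    · omega
    · exact (hn _ h).2
  have hs := c.side_lt
  refine .cons (runs_unload_zero hM hS (a := c.top) (k := 4) (.mk rfl rfl hcM (by omega)) rfl h4) ?_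
  refine .cons (runs_dir_2 hM hS hc hn) ?_
  refine .cons (runs_unload_zero hM hS (a := c.top) (k := c.side) (v := ad w (rt t) 0)
    (.mk rfl rfl hcM (by omega)) rfl (linked_plug.1 hT).1.hole) ?_
  exact .cons (runs_store_zero hM hS (a := N) (k := 5) (.mk rfl rfl hN (by omega)) rfl h5) (.nil _)

end link

/-! ### The whole way up, and its end. -/

section up

variable {S w M : ℕ} (hM : 16 * (M + 1) ≤ 2 ^ w) (hS : 16 * (M + 1) ≤ S)
  {x : BitVec w} {N : ℕ}
include hM hS

/-- The invariant: off the subtree, the balances still account for its old height `h`, while it now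
has height `h + 1`. At a balanced node the sibling also has height `h`, so this node comes to lean
towards `t` and grows by one itself; this is `htall` for the next step. The entry test, that the
child is `N`, fails from then on, as `N` is not on the path. `J` collects the nodes passed, so its
length counts the iterations. The header ends the loop by `h0`. -/
theorem iterates_walkUp {H : Heap w} {c : Path} {t : BinaryTree ℕ} {h : ℕ}
    (hT : Linked H (plug c t)) (hn : (lab (plug c t)).Nodup)
    (hl : ∀ i ∈ lab (plug c t), 1 ≤ i ∧ i ≤ M) (hN : N ≤ M) (hNc : N ∉ c.nodes) (h0 : H 0 4 ≠ 0#w)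
    (hBC : BalC H c h) (hBt : Bal H t) (ht : t.height = h + 1) (htall : 1 ≤ h → H (rt t) 4 ≠ 0#w)
    (hF : c.Follows H x) :
    ∃ (c' : Path) (t' : BinaryTree ℕ) (H' : Heap w) (J : List ℕ) (h' : ℕ),
      Iterates S (.eq (.var 4) (.var 1)) (.not (.eqc (.var 5) 0)) walkUpBody 30 J.length
        (st [x, ad w N 0, ad w c.top 0, 0#w, ad w (rt t) 0, H c.top 4, 0#w, 0#w, 0#w, 0#w, 0#w] H)
        (st [x, ad w N 0, ad w c'.top 0, 0#w, ad w (rt t') 0, H' c'.top 4, 0#w, 0#w, 0#w, 0#w, 0#w]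
          H') ∧
      plug c' t' = plug c t ∧ c'.length + J.length = c.length ∧ c'.nodes ⊆ c.nodes ∧
      H' c'.top 4 ≠ 0#w ∧ Linked H' (plug c t) ∧ BalC H' c' h' ∧ Bal H' t' ∧ t'.height = h' + 1 ∧
      (1 ≤ h' → H' (rt t') 4 ≠ 0#w) ∧ c'.Follows H' x ∧ Frame H H' (lab (plug c t)) N J ∧ ∀ j k, k ≠ 4 → H' j k = H j k := by
  induction c generalizing H t h with
  | nil =>
    refine ⟨[], t, H, [], h, ?_, rfl, rfl, fun _ h => h, h0, hT, hBC, hBt, ht, htall, hF, .refl,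
      fun _ _ _ => rfl⟩
    refine .done (inBounds_var_var _ _ _) ?_ ?_
    · intro j hj; simp [Test.operands] at hj
    · exact h0
  | cons f c ih =>
    obtain ⟨i, d, b⟩ := f
    have hInB : ∀ s : State w, (Test.not (.eqc (.var 5) 0)).InBounds S s := by
      intro s j hj; simp [Test.operands] at hj
    by_cases hi4 : H i 4 = 0#w
    · have hd : d = sideOf H x i := hF _ List.mem_cons_self
      have hiL : i ∈ lab (plug ((i, d, b) :: c) t) :=
        (lab_plug_perm _ _).mem_iff.2 (by simp [Path.labs])
      have hi := hl i hiL
      have hcL : ∀ j ∈ Path.nodes c, j ∈ lab (plug ((i, d, b) :: c) t) := fun j hj =>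
        (lab_plug_perm _ _).mem_iff.2 (List.mem_append_left _
          (Path.nodes_subset_labs _ (List.mem_cons_of_mem _ hj)))
      have hn' := (lab_plug_perm _ _).nodup_iff.1 hn
      obtain ⟨n1, -, n3⟩ := List.nodup_append.1 hn'
      simp only [Path.labs, List.nodup_cons, List.mem_append, not_or] at n1
      obtain ⟨⟨n4, n5⟩, -⟩ := n1
      have hit : i ∉ lab t := fun h => n3 i (by simp [Path.labs]) i h rfl
      have hiN : i ≠ N := by rintro rfl; exact hNc (by simp [Path.nodes])
      obtain ⟨hcode, hBb, hBc⟩ := hBC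
      have hhb : h = b.height := by
        have := fld_lt d; have := fld_lt !d; have := fld_pos d; have := fld_pos !d
        rw [BalCode, hi4, ofNat_inj hM (by omega) (by omega), ofNat_inj hM (by omega) (by omega),
          ofNat_inj hM (by omega) (by omega)] at hcode
        omega
      set H₁ := H.upd i 4 (.ofNat w (fld d)) with hH₁
      have h14 : H₁ i 4 = .ofNat w (fld d) := by simp [hH₁, Heap.upd_apply]
      have h1 : ∀ j, j ≠ i → H₁ j 4 = H j 4 := fun j hj => by simp [hH₁, Heap.upd_apply, hj]
      have hne : H₁ i 4 ≠ 0#w := by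
        have := fld_lt d; have := fld_pos d
        rw [h14, Ne, ofNat_inj hM (by omega) (by omega)]; omega
      have hT₁ : Linked H₁ (plug c (nd d i t b)) := hT.congr (by simp [hH₁, Heap.upd_apply])
        fun j _ k _ hk => by simp [hH₁, Heap.upd_apply, show k ≠ 4 by omega]
      obtain ⟨c', t', H', J, h', q1, q2, q3, q4, q5, q6, q7, q8, q9, q10, q11, q12, q13⟩ :=
        ih (H := H₁) (t := nd d i t b) (h := h + 1) hT₁ hn hl
          (fun hN => hNc (List.mem_cons_of_mem _ hN)) (by rw [h1 0 (by omega)]; exact h0)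
          (by
            rw [← hhb, max_self] at hBc
            exact hBc.congr fun j hj => h1 j (by rintro rfl; exact n5 hj))
          (by
            rw [bal_nd, h14]
            exact ⟨.inr (.inl ⟨rfl, by omega⟩),
              hBt.congr fun j hj => h1 j (by rintro rfl; exact hit hj),
              hBb.congr fun j hj => h1 j (by rintro rfl; exact n4 hj)⟩)
          (by rw [height_nd]; omega) (fun _ => by rw [rt_nd]; exact hne)
          (Path.Follows.congr (H := H) (fun f hf => hF f (List.mem_cons_of_mem _ hf))
            fun j _ => by simp [hH₁, Heap.upd_apply])
      rw [rt_nd] at q1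
      refine ⟨c', t', H', i :: J, h', ?_, q2, by simp; omega,
        fun j hj => List.mem_cons_of_mem _ (q4 hj), q5, q6, q7, q8, q9, q10, q11,
        (Frame.upd_bal hiL _).trans q12, fun j k hk => ?_⟩
      swap
      · rw [q13 j k hk, hH₁, Heap.upd_apply, if_neg (by omega)]
      refine .step (inBounds_var_var _ _ _) (hInB _) ?_ ?_ ?_ q1
      · intro h; exact h hi4
      · have := runs_walkUpBody hM hS (N := N) (x := x) (H := H) (c := c) (i := i) (t := t) (b := b)
          (by rw [← hd]; exact hT) (fun j hj => hl j (hcL j hj)) hi hi4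
        rw [← hd] at this
        rw [show H (Path.top ((i, d, b) :: c)) 4 = 0#w from hi4]
        exact this
      · intro h
        exact hiN ((ad_inj hM hi.2 (by omega) hN (by omega)).1 h).1
    · refine ⟨(i, d, b) :: c, t, H, [], h, ?_, rfl, rfl, fun _ h => h, hi4, hT, hBC, hBt, ht, htall,
        hF, .refl, fun _ _ _ => rfl⟩
      exact .done (inBounds_var_var _ _ _) (hInB _) hi4

/-- A way up that ends at the header means that the root has grown, which needs no repair. In all
cases variable 2 still points to the node where the way up ended, even if that has been rotated
down, and its key is unchanged; this clears the side, and then the log and the header clear the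
variables 2 and 1. -/
theorem exists_finish {H : Heap w} {c : Path} {t : BinaryTree ℕ} {h : ℕ}
    (hT : Linked H (plug c t)) (hn : (lab (plug c t)).Nodup)
    (hl : ∀ i ∈ lab (plug c t), 1 ≤ i ∧ i ≤ M) (hN : N ∈ lab (plug c t))
    (h6 : H N 6 = 0#w) (h7 : H N 7 = 0#w) (h8 : H N 8 = 0#w) (h5 : H N 5 = ad w c.top 0)
    (h0 : H 0 4 = ad w N 0) (h4 : H c.top 4 ≠ 0#w)
    (hBC : BalC H c h) (hBt : Bal H t) (ht : t.height = h + 1) (htall : 1 ≤ h → H (rt t) 4 ≠ 0#w)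
    (hF : c.Follows H x) :
    ∃ T' H' J, Runs S finish 580
      (st [x, ad w N 0, ad w c.top 0, .ofNat w c.side, 0#w, 0#w, 0#w, 0#w, 0#w, 0#w, 0#w] H)
      (st [x, 0#w, 0#w, 0#w, 0#w, 0#w, 0#w, 0#w, 0#w, 0#w, 0#w] H') ∧
      Linked H' T' ∧ Bal H' T' ∧ lab T' = lab (plug c t) ∧
      Frame H H' (lab (plug c t)) N J ∧ J.length ≤ 10 := by
  obtain ⟨T', H', J, h1, h2, h3, h4, h5', h6'⟩ : ∃ T' H' J,
      Runs S (.ifRev (.eqc (.var 2) 0) .skip settle (.eqc (.var 2) 0)) 552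
      (st [x, ad w N 0, ad w c.top 0, .ofNat w c.side, 0#w, 0#w, 0#w, 0#w, 0#w, 0#w, 0#w] H)
      (st [x, ad w N 0, ad w c.top 0, .ofNat w c.side, 0#w, 0#w, 0#w, 0#w, 0#w, 0#w, 0#w] H') ∧
      Linked H' T' ∧ Bal H' T' ∧ lab T' = lab (plug c t) ∧
      Frame H H' (lab (plug c t)) N J ∧ J.length ≤ 10 := by
    cases c with
    | nil =>
      exact ⟨t, H, [], (runs_ifEqc_true (by exact ad_zero w) (.skip _) (by exact ad_zero w)).mono
        (by omega), hT, hBt, rfl, .refl, by simp⟩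
    | cons f c =>
      obtain ⟨i, d, b⟩ := f
      have hi := hl i ((lab_plug_perm _ _).mem_iff.2 (by simp [Path.labs]))
      have hi0 : ¬ ad w i 0 = 0#w := fun h => absurd ((ad_eq_zero hM hi.2).1 h) (by omega)
      obtain ⟨t', H', J, h1, h2⟩ := exists_settle hM hS (x := x) hn hl hN h6 h7 h8 hT hBC hBt ht h4
        htall (fun f hf => hF f (List.mem_cons_of_mem _ hf))
      exact ⟨_, H', J, runs_ifEqc_false (by exact hi0) h1 (by exact hi0), h2⟩
  have hcL : ∀ j ∈ c.nodes, j ∈ lab (plug c t) := fun j hj =>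
    (lab_plug_perm _ _).mem_iff.2 (List.mem_append_left _ (c.nodes_subset_labs hj))
  have hNM := (hl N hN).2
  refine ⟨T', H', J, ?_, h2, h3, h4, h5', h6'⟩
  refine .cons h1 ?_
  refine .cons ((runs_dir_2 hM hS (c := c) (H := H') (hF.congr fun i hi => h5'.key i ?_)
    fun j hj => hl j (hcL j hj)).inv (isRev_dir _ _)) ?_
  · have := (hl i (hcL i hi)).1; omega
  refine .cons (runs_unload_zero hM hS (a := N) (k := 5) (v := ad w c.top 0)
    (.mk rfl rfl hNM (by omega)) rfl ?_) ?_
  · rw [h5'.log N 5 le_rfl (.inr (.inl rfl)), h5]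
  refine .cons (runs_unload_zero hM hS (a := 0) (k := 4) (v := ad w N 0)
    (.mk rfl rfl (by omega) (by omega)) rfl ?_) (.nil _)
  rw [h5'.out 0 (fun h => absurd (hl 0 h).1 (by omega)) 4 (.inr (by omega)), h0]

end up

/-! ### Insertion -/

/-- Each turn puts a node of the path, and with it the subtree beyond, on one side of `x`. So a leaf
at the end of the path takes its proper place in the symmetric order. -/
theorem Path.Follows.lt_of_mem {w : ℕ} {H : Heap w} {x : BitVec w} {c : Path} (hc : c.Follows H x)
    (hs : (c.before ++ c.after).Pairwise fun i j => H i 0 < H j 0)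
    (hx : ∀ j ∈ c.before ++ c.after, H j 0 ≠ x) :
    (∀ j ∈ c.before, H j 0 < x) ∧ ∀ j ∈ c.after, x < H j 0 := by
  induction c with
  | nil => simp [before, after]
  | cons f c ih =>
    obtain ⟨i, d, b⟩ := f
    have hd : d = sideOf H x i := hc _ List.mem_cons_self
    have hc' : Path.Follows H x c := fun f hf => hc f (List.mem_cons_of_mem _ hf)
    cases d with
    | true =>
      simp only [before, after, cond_true, List.append_nil] at hs hx ⊢
      have hle : x ≤ H i 0 := by simpa [sideOf] using hd.symm
      have hlt : x < H i 0 := BitVec.lt_of_le_ne hle (hx i (by simp)).symm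
      obtain ⟨h1, h2⟩ := ih hc' (hs.sublist (by simp)) fun j hj => hx j (by
        simp only [List.mem_append] at hj ⊢; tauto)
      refine ⟨h1, fun j hj => ?_⟩
      simp only [List.cons_append, List.mem_cons, List.mem_append] at hj
      rcases hj with rfl | hj | hj
      · exact hlt
      · rw [List.pairwise_append] at hs
        have := hs.2.1
        simp only [List.cons_append, List.pairwise_cons] at this
        exact BitVec.lt_trans hlt (this.1 j (by simp [hj]))
      · exact h2 j hj
    | false =>
      simp only [before, after, cond_false, List.nil_append] at hs hx ⊢
      have hlt : H i 0 < x := by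
        have : ¬ x ≤ H i 0 := by simpa [sideOf] using hd.symm
        exact BitVec.not_le.1 this
      obtain ⟨h1, h2⟩ := ih hc' (hs.sublist (by simp)) fun j hj => hx j (by
        simp only [List.mem_append] at hj ⊢; tauto)
      refine ⟨fun j hj => ?_, h2⟩
      simp only [List.mem_cons, List.mem_append, List.not_mem_nil, or_false] at hj
      rcases hj with hj | hj | rfl
      · exact h1 j hj
      · rw [List.pairwise_append, List.pairwise_append, List.pairwise_append] at hs
        exact BitVec.lt_trans (hs.1.2.1.2.2 j hj i (by simp)) hlt
      · exact hlt

/-- The heap `H` holds a balanced search tree with the shape `T`, whose nodes are the records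
`1, …, n`. -/
structure Heap.Rep {w : ℕ} (H : Heap w) (T : BinaryTree ℕ) (n : ℕ) : Prop where
  linked : Linked H T
  bal : Bal H T
  nodup : (lab T).Nodup
  mem : ∀ i, i ∈ lab T ↔ 1 ≤ i ∧ i ≤ n
  sorted : (lab T).Pairwise fun i j => H i 0 < H j 0
  count : H 0 4 = ad w n 0
  blank : ∀ i, n < i → ∀ k, H i k = 0#w
  mark : n ≠ 0 → H n 9 = .ofNat w 1

/-- The changes to a heap by the insertion of the record `N`; the balances of the nodes in `J` may
change. -/
structure InsertFrame {w : ℕ} (H H' : Heap w) (N : ℕ) (J : List ℕ) : Prop where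
  out : ∀ k, k ≠ 0 → k ≠ 4 → H' 0 k = H 0 k
  key : ∀ j, j ≠ 0 → j ≠ N → H' j 0 = H j 0
  bal : ∀ j, j ≠ 0 → j ∉ J → H' j 4 = H j 4
  log : ∀ j k, 5 ≤ k → j ≠ N → H' j k = H j k
  five : ∃ q ≤ N, H' N 5 = ad w q 0
  new : ∀ k, 6 ≤ k → ∃ e < 3, H' N k = BitVec.ofNat w e

/-- The initial and final state of an operation with argument `x`. -/
def stArg {w : ℕ} (x : BitVec w) (H : Heap w) : State w :=
  st [x, 0#w, 0#w, 0#w, 0#w, 0#w, 0#w, 0#w, 0#w, 0#w, 0#w] H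

/-- Here `k` is the length of the search path, and the list of changed balances joins the nodes
passed on the way up with at most ten from rebalancing. -/
theorem exists_insert {S w n : ℕ} (hM : 16 * (n + 1 + 1) ≤ 2 ^ w) (hS : 16 * (n + 1 + 1) ≤ S)
    {H : Heap w} {T : BinaryTree ℕ} (hR : H.Rep T n) {x : BitVec w}
    (hx : ∀ i ∈ lab T, H i 0 ≠ x) :
    ∃ T' H' J k t e, H'.Rep T' (n + 1) ∧ H' (n + 1) 0 = x ∧ InsertFrame H H' (n + 1) J ∧
      Exec S insertProg (stArg x H) t e (stArg x H') ∧ T.height ≤ 2 * k ∧ k ≤ T.height ∧ k < t ∧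
      t ≤ 700 + 64 * k ∧ J.length ≤ k + 10 := by
  obtain ⟨ta, ea, hta, ha⟩ := runs_alloc hM hS (x := x) hR.count hR.linked.1
  set N := n + 1 with hNdef
  set H₁ := H.upd 0 4 (ad w N 0) with hH₁
  have hlT : ∀ i ∈ lab T, 1 ≤ i ∧ i ≤ n := fun i hi => (hR.mem i).1 hi
  have h₁ : ∀ i k, i ≠ 0 ∨ k ≠ 4 → H₁ i k = H i k := fun i k h => by
    rw [hH₁, Heap.upd_apply, if_neg (by omega)]
  have hT₁ : Linked H₁ T := hR.linked.congr (h₁ _ _ (by omega)) fun i _ k _ hk => h₁ i k (by omega)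
  obtain ⟨c, k, hcT, hcF, hck, hit⟩ := iterates_walkDown hM hS (N := ad w N 0) (x := x) (c := [])
    hT₁.2 (by intro f hf; simp at hf) (by intro j hj; simp [Path.nodes] at hj)
    fun j hj => ⟨(hlT j hj).1, by have := (hlT j hj).2; omega⟩
  simp only [List.length_nil, zero_add] at hck
  change plug c .nil = T at hcT
  subst hcT
  obtain ⟨tb, eb, htb, htb', hb⟩ := hit.exec (by exact ad_zero w)
  -- the path
  have hperm := lab_plug_perm c .nil
  simp only [lab, List.append_nil] at hperm
  have hcl : ∀ i ∈ c.labs, 1 ≤ i ∧ i ≤ n := fun i hi => hlT i (hperm.mem_iff.2 hi)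
  have hcn : ∀ i ∈ c.nodes, 1 ≤ i ∧ i ≤ n := fun i hi => hcl i (c.nodes_subset_labs hi)
  have hcnM : ∀ i ∈ c.nodes, 1 ≤ i ∧ i ≤ N := fun i hi =>
    ⟨(hcn i hi).1, by have := (hcn i hi).2; omega⟩
  have hNc : N ∉ c.nodes := fun h => by have := (hcn N h).2; omega
  have hN0 : N ≠ 0 := by omega
  have hcN : c.top ≠ N := by
    rcases c.top_mem with h | h
    · omega
    · rintro h'; exact hNc (h' ▸ h)
  have hs := c.side_lt
  have hLC := (linked_plug.1 hT₁).1
  -- the new leaf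
  set leaf : BinaryTree ℕ := .node N .nil .nil
  set H₂ := linkedLeaf H₁ c N x with hH₂
  have hNz : ∀ k, H₁ N k = 0#w := fun k => by rw [h₁ N k (.inl hN0), hR.blank N (by omega)]
  have h₂N : ∀ k, H₂ N k = if k = 9 then .ofNat w 1 else if k = 0 then x else
      if k = 3 then ad w c.top 0 else 0#w := fun k => by
    rw [hH₂, linkedLeaf_new hcN, hNz]
  have hlab : lab (plug c leaf) = c.before ++ N :: c.after := by rw [lab_plug]; simp [leaf, lab]
  have hlab0 : lab (plug c .nil) = c.before ++ c.after := by rw [lab_plug]; simp [lab]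
  have hmem : ∀ i, i ∈ lab (plug c leaf) ↔ 1 ≤ i ∧ i ≤ N := by
    intro i
    have : i ∈ lab (plug c leaf) ↔ i ∈ lab (plug c .nil) ∨ i = N := by
      rw [hlab, hlab0]; simp only [List.mem_append, List.mem_cons]; tauto
    rw [this, hR.mem i]; omega
  have hn : (lab (plug c leaf)).Nodup := by
    rw [hlab, List.perm_middle.nodup_iff, List.nodup_cons, ← hlab0]
    exact ⟨fun h => by have := (hlT N h).2; omega, hR.nodup⟩
  have hT₂ : Linked H₂ (plug c leaf) := by
    rw [linked_plug]
    refine ⟨hLC.redirect N (hperm.nodup_iff.1 hR.nodup)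
      (fun h => absurd (hcl 0 h).1 (by omega)) ?_ ?_, ?_⟩
    · simp [hH₂, linkedLeaf, Heap.upd_apply, hcN]
    · intro i hi k _ _
      by_cases h : i = c.top ∧ k = c.side
      · exact .inl h
      · refine .inr (linkedLeaf_of_ne ?_ (by omega))
        rcases hi with rfl | hi
        · omega
        · have := (hcl i hi).2; omega
    · exact ⟨by rw [h₂N]; rfl, by rw [h₂N]; rfl, by rw [h₂N]; rfl, trivial, trivial⟩
  have hB := bal_plug.1 hR.bal
  have h₂4 : ∀ i, H₂ i 4 = H₁ i 4 := fun i => linkedLeaf_four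
  -- The leaf replaces an empty subtree, so the way up starts with old height 0.
  have hBC₂ : BalC H₂ c 0 := hB.1.congr fun i hi => by
    rw [h₂4, h₁ i 4 (.inl (by have := (hcl i hi).1; omega))]
  have hF₂ : c.Follows H₂ x := hcF.congr fun i hi =>
    linkedLeaf_key (by have := (hcn i hi).2; omega) (by have := (hcn i hi).1; omega)
  have hNne : ¬ ad w N 0 = 0#w := fun h => hN0 ((ad_eq_zero hM le_rfl).1 h)
  -- Read as a balance, this word is nonzero, and so it stops the way up above the root.
  have h₂04 : H₂ 0 4 = ad w N 0 := by rw [h₂4]; simp [hH₁, Heap.upd_apply]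
  obtain ⟨c', t', H₃, J, h', q1, q2, q3, q4, q5, q6, q7, q8, q9, q10, q11, q12, q13⟩ :=
    iterates_walkUp hM hS (x := x) (N := N) hT₂ hn (fun i hi => (hmem i).1 hi) le_rfl hNc
      (by rw [h₂04]; exact hNne) hBC₂ (t := leaf) (h := 0)
      ⟨.inl ⟨by rw [h₂N]; rfl, rfl⟩, trivial, trivial⟩ rfl (by omega) hF₂
  -- storing the end of the way up
  set H₄ := H₃.upd N 5 (ad w c'.top 0) with hH₄
  have h₄ : ∀ i k, i ≠ N ∨ k ≠ 5 → H₄ i k = H₃ i k := fun i k h => by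
    rw [hH₄, Heap.upd_apply, if_neg (by omega)]
  have h45 : H₄ N 5 = ad w c'.top 0 := by simp [hH₄, Heap.upd_apply]
  have hc'n : ∀ i ∈ c'.nodes, 1 ≤ i ∧ i ≤ N := fun i hi => hcnM i (q4 hi)
  have hc'M : c'.top ≤ N := by
    rcases c'.top_mem with h | h
    · omega
    · exact (hc'n _ h).2
  have h0L : 0 ∉ lab (plug c leaf) := fun h => absurd ((hmem 0).1 h).1 (by omega)
  have hNL : N ∈ lab (plug c leaf) := (hmem N).2 ⟨by omega, le_rfl⟩
  have h₄N : ∀ k, 6 ≤ k → k < 9 → H₄ N k = 0#w := by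
    intro k hk hk'
    rw [h₄ N k (by omega), q13 N k (by omega), h₂N, if_neg (by omega), if_neg (by omega),
      if_neg (by omega)]
  have h₄0 : H₄ 0 4 = ad w N 0 := by
    rw [h₄ 0 4 (by omega), q12.out 0 h0L 4 (by omega), h₂04]
  obtain ⟨T', H₅, J', r1, r2, r3, r4, r5, r6⟩ := exists_finish hM hS (x := x) (N := N) (H := H₄)
    (c := c') (t := t') (h := h')
    (by rw [q2]; exact q6.congr (h₄ _ _ (by omega)) fun i _ k _ hk => h₄ i k (by omega))
    (by rw [q2]; exact hn) (by rw [q2]; exact fun i hi => (hmem i).1 hi) (by rw [q2]; exact hNL)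
    (h₄N 6 (by omega) (by omega)) (h₄N 7 (by omega) (by omega)) (h₄N 8 (by omega) (by omega)) h45
    h₄0 (by rw [h₄ _ _ (by omega)]; exact q5) (q7.congr fun i _ => h₄ i 4 (by omega))
    (q8.congr fun i _ => h₄ i 4 (by omega)) q9 (by rw [h₄ _ _ (by omega)]; exact q10)
    (q11.congr fun i _ => h₄ i 0 (by omega))
  rw [q2] at r4 r5
  have g0 : ∀ j, j ≠ 0 → H₅ j 0 = H₂ j 0 := fun j hj => by
    rw [r5.key j hj, h₄ j 0 (by omega), q13 j 0 (by omega)]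
  have g1 : ∀ j, j ≠ 0 → j ≠ N → H₅ j 0 = H j 0 := fun j hj hjN => by
    rw [g0 j hj, hH₂, linkedLeaf_key hjN hj, h₁ j 0 (.inl hj)]
  have gN : H₅ N 0 = x := by rw [g0 N hN0, h₂N]; rfl
  have gl : ∀ j k, 5 ≤ k → j ≠ N → H₅ j k = H j k := fun j k hk hj => by
    rw [r5.log j k hk (.inl hj), h₄ j k (.inl hj), q13 j k (by omega), hH₂,
      linkedLeaf_of_ne hj (by omega), h₁ j k (by omega)]
  have g9 : H₅ N 9 = .ofNat w 1 := by
    rw [r5.log N 9 (by omega) (by omega), h₄ N 9 (by omega), q13 N 9 (by omega), h₂N]; rfl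
  have hsorted := hR.sorted
  rw [hlab0] at hsorted hx
  have hne : ∀ j ∈ c.before ++ c.after, j ≠ 0 ∧ j ≠ N := fun j hj => by
    have := hlT j (hlab0 ▸ hj); omega
  have hcFH : c.Follows H x := hcF.congr fun i hi =>
    (h₁ i 0 (by omega)).symm
  obtain ⟨s1, s2⟩ := hcFH.lt_of_mem hsorted hx
  have g5 : H₅ N 5 = ad w c'.top 0 := by rw [r5.log N 5 le_rfl (by omega), h45]
  have gout : ∀ j, j ≠ N → j ∉ lab (plug c leaf) → ∀ k, j ≠ 0 ∨ (k ≠ 0 ∧ k ≠ 4) →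
      H₅ j k = H j k := fun j hjN hj k hk => by
    have hjc : j ≠ c.top ∨ k ≠ c.side := by
      rcases c.eq_nil_or_top_mem with h | h
      · rw [h]; simp only [Path.top, Path.side]; omega
      · refine .inl ?_
        rintro rfl
        have := hcn _ h
        exact hj ((hmem _).2 (by omega))
    rw [r5.out j hj k (by omega), h₄ j k (by omega), q12.out j hj k (by omega), hH₂,
      linkedLeaf_of_ne hjN hjc, h₁ j k (by omega)]
  obtain ⟨tl, el, htl, hL⟩ := runs_link hM hS hcF hcnM le_rfl hNc hN0 hLC.hole hNz
  obtain ⟨ts, es, hts, hSt⟩ := runs_startUp hM hS (x := x) (N := N) (H := H₂) (c := c) hcnM le_rfl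
    (by rw [h₂N]; rfl) rfl
  obtain ⟨tu, eu, -, htu, hU⟩ := q1.exec (by exact rfl)
  obtain ⟨tp, ep, htp, hP⟩ := runs_stopUp hM hS (x := x) (N := N) (H := H₃) (c := c') (t := t')
    (by rw [q2]; exact q6) q11 hc'n le_rfl rfl (by rw [q13 N 5 (by omega), h₂N]; rfl)
  obtain ⟨tf, ef, htf, hFi⟩ := r1
  have hexec := ha.seq ((hb.seq (hL.seq (hSt.seq (hU.seq (hP.seq (hFi.seq (.skip _))))))).seq
    (.skip _))
  have hheight : (plug c .nil).height ≤ 2 * k := by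
    have := hB.1.height_plug_le
    simp only [BinaryTree.height] at this
    omega
  have hheight' : k ≤ (plug c .nil).height := by
    have := length_add_height_le c .nil
    omega
  -- With its tests, a step down costs at most 29 and a step up at most 33, hence the 64; the 700
  -- covers the remaining blocks and the last tests of the loops.
  simp only [Test.size] at htb' htu
  refine ⟨T', H₅, J ++ J', k, _, _, ⟨r2, r3, r4 ▸ hn, fun i => by rw [r4, hmem i], ?_, ?_, ?_, ?_⟩,
    gN, ⟨?_, g1, ?_, gl, ⟨c'.top, hc'M, g5⟩, ?_⟩, hexec, hheight, hheight', by omega, by omega, by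
      simp only [List.length_append]; omega⟩
  · rw [r4, hlab]
    rw [List.pairwise_append, List.pairwise_cons]
    rw [List.pairwise_append] at hsorted
    have e : ∀ j ∈ c.before ++ c.after, H₅ j 0 = H j 0 := fun j hj =>
      g1 j (hne j hj).1 (hne j hj).2
    have eb : ∀ j ∈ c.before, H₅ j 0 = H j 0 := fun j hj => e j (List.mem_append_left _ hj)
    have ea : ∀ j ∈ c.after, H₅ j 0 = H j 0 := fun j hj => e j (List.mem_append_right _ hj)
    refine ⟨hsorted.1.imp_of_mem fun hi hj h => by rwa [eb _ hi, eb _ hj],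
      ⟨fun j hj => by rw [gN, ea j hj]; exact s2 j hj,
        hsorted.2.1.imp_of_mem fun hi hj h => by rwa [ea _ hi, ea _ hj]⟩, fun i hi j hj => ?_⟩
    rw [eb i hi]
    rcases List.mem_cons.1 hj with rfl | hj
    · rw [gN]; exact s1 i hi
    · rw [ea j hj]; exact hsorted.2.2 i hi j hj
  · rw [r5.out 0 h0L 4 (by omega), h₄0]
  · intro i hi k
    rw [gout i (by omega) (fun h => by have := (hmem i).1 h; omega) k (by omega)]
    exact hR.blank i (by omega) k
  · exact fun _ => g9
  · exact fun k hk hk' => gout 0 (Ne.symm hN0) h0L k (.inr ⟨hk, hk'⟩)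
  · intro j hj hjJ
    simp only [List.mem_append, not_or] at hjJ
    rw [r5.bal j hjJ.2, h₄ j 4 (by omega), q12.bal j hjJ.1, h₂4, h₁ j 4 (.inl hj)]
  · intro k hk
    by_cases hk9 : k < 9
    · rcases r5.new k (by omega) with h | h
      · exact ⟨0, by omega, by rw [h, h₄N k hk hk9]⟩
      · exact h
    · rw [r5.log N k (by omega) (by omega), h₄ N k (by omega), q13 N k (by omega), h₂N]
      by_cases h : k = 9
      · exact ⟨1, by omega, by rw [if_pos h]⟩
      · exact ⟨0, by omega, by rw [if_neg h, if_neg (by omega), if_neg (by omega)]⟩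

/-! ### Space, and the size of the log -/

theorem eq_ad {w : ℕ} (a : BitVec w) : a = ad w (a.toNat / 16) (a.toNat % 16) := by
  rw [ad, Nat.div_add_mod, BitVec.ofNat_toNat, BitVec.setWidth_eq]

/-- `L` lists the words of the log that may have changed, each with a bound on its new size;
repeated addresses do no harm, as their bounds just add up. -/
theorem logBits_le {w : ℕ} {m m' : Memory w} {T T' : BinaryTree (BitVec w)}
    (L : List (BitVec w × ℕ))
    (h : ∀ a, a ∉ treeCells m' T' → a ∉ treeCells m T ∧
      (m' a = m a ∨ ∃ s, (a, s) ∈ L ∧ Nat.size (m' a).toNat ≤ s)) :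
    logBits m' T' ≤ logBits m T + (L.map Prod.snd).sum := by
  have hsum : ∀ L : List (BitVec w × ℕ), ∑ i : Fin (2 ^ w),
      (L.map fun p => if p.1 = BitVec.ofFin i then p.2 else 0).sum = (L.map Prod.snd).sum := by
    intro L
    induction L with
    | nil => simp
    | cons p L ih =>
      simp only [List.map_cons, List.sum_cons, Finset.sum_add_distrib, ih]
      congr 1
      rw [Finset.sum_eq_single p.1.toFin]
      · simp
      · intro i _ hi
        rw [if_neg]
        rintro h
        exact hi (by rw [h])
      · simp
  rw [← hsum L, logBits, logBits, ← Finset.sum_add_distrib]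
  refine Finset.sum_le_sum fun i _ => ?_
  by_cases hi : BitVec.ofFin i ∈ treeCells m' T'
  · rw [if_pos hi]; exact Nat.zero_le _
  · obtain ⟨h1, h2⟩ := h _ hi
    rw [if_neg hi, if_neg h1]
    rcases h2 with h2 | ⟨s, hs, h2⟩
    · rw [h2]; exact Nat.le_add_right _ _
    · refine h2.trans (le_trans ?_ (Nat.le_add_left _ _))
      refine List.le_sum_of_mem (List.mem_map.2 ⟨_, hs, ?_⟩)
      simp

section rep

variable {w n : ℕ} {H H' : Heap w} {T T' : BinaryTree ℕ}

theorem Heap.Rep.numNodes (hR : H.Rep T n) : T.numNodes = n := by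
  have h : (lab T).toFinset = Finset.Icc 1 n := by
    ext i
    rw [List.mem_toFinset, hR.mem, Finset.mem_Icc]
  rw [← length_lab, ← List.toFinset_card_of_nodup hR.nodup, h, Nat.card_Icc]
  omega

theorem Heap.Rep.mem_keys_insert {x : BitVec w} {J : List ℕ} (hR : H.Rep T n)
    (hR' : H'.Rep T' (n + 1)) (hF : InsertFrame H H' (n + 1) J) (hx : H' (n + 1) 0 = x)
    (k : BitVec w) : k ∈ keys (T'.map (H' · 0)) ↔ k = x ∨ k ∈ keys (T.map (H · 0)) := by
  simp only [keys_map, List.mem_map]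
  constructor
  · rintro ⟨i, hi, rfl⟩
    have hi := (hR'.mem i).1 hi
    by_cases h : i = n + 1
    · rw [h, hx]; exact .inl rfl
    · exact .inr ⟨i, (hR.mem i).2 (by omega), (hF.key i (by omega) h).symm⟩
  · rintro (rfl | ⟨i, hi, rfl⟩)
    · exact ⟨n + 1, (hR'.mem _).2 (by omega), hx⟩
    · have hi := (hR.mem i).1 hi
      exact ⟨i, (hR'.mem i).2 (by omega), hF.key i (by omega) (by omega)⟩

theorem Heap.Rep.spaceUsed_le (hR : H.Rep T n) : spaceUsed H.mem ≤ 16 * (n + 1) :=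
  Nat.sInf_le fun a ha => hR.blank (a.toNat / 16) (by omega) (a.toNat % 16)

variable (hM : 16 * (n + 1) ≤ 2 ^ w)
include hM

theorem Heap.Rep.holdsTree (hR : H.Rep T n) : HoldsTree H.mem (T.map (H · 0)) ∧
    IsAVL (T.map (H · 0)) ∧
    treeCells H.mem (T.map (H · 0)) = 0#w :: (preorder T).flatMap (cells w) := by
  obtain ⟨h1, h2⟩ := hR.linked.holdsTree hM (fun i hi => (hR.mem i).1 hi) hR.nodup
  refine ⟨h1, ⟨?_, hR.bal.isBalanced _⟩, h2⟩
  rw [isSearchTree_iff, keys_map, List.pairwise_map]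
  exact hR.sorted

theorem Heap.Rep.le_spaceUsed (hR : H.Rep T n) : n ≤ spaceUsed H.mem := by
  have h : spaceUsed H.mem ∈ {S : ℕ | ∀ a : BitVec w, S ≤ a.toNat → H.mem a = 0} :=
    Nat.sInf_mem ⟨16 * (n + 1), fun a (ha : _ ≤ a.toNat) =>
      hR.blank (a.toNat / 16) (by omega) (a.toNat % 16)⟩
  -- All other words of the last record can be zero, for instance if it is the only node and has key
  -- 0; the mark in field 9 is not.
  by_contra hlt
  have h9 := h (ad w n 9) (by rw [ad_toNat hM le_rfl (by omega)]; omega)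
  rw [Heap.mem_ad hM H le_rfl (by omega), hR.mark (by omega)] at h9
  exact absurd ((ofNat_inj hM (k := 1) (k' := 0) (by omega) (by omega)).1 h9) one_ne_zero

end rep

theorem size_ofNat_le {w e : ℕ} (he : e < 3) : Nat.size (BitVec.ofNat w e).toNat ≤ 2 := by
  rw [Nat.size_le, BitVec.toNat_ofNat]
  have := Nat.mod_le e (2 ^ w)
  omega

/-- The allocation counter and field 5 of the new record hold one address each. The other log words
of the new record, and the balances in `J`, are codes below 3 and have at most two bits; two bits
for each of the 16 fields give the 32. -/
theorem logBits_insert_le {w n : ℕ} {H H' : Heap w} {T T' : BinaryTree ℕ} {J : List ℕ}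
    (hM : 16 * (n + 1 + 1) ≤ 2 ^ w) (hR : H.Rep T n) (hR' : H'.Rep T' (n + 1))
    (hF : InsertFrame H H' (n + 1) J) :
    logBits H'.mem (T'.map (H' · 0)) ≤
      logBits H.mem (T.map (H · 0)) + (2 * Nat.size (16 * (n + 1)) + 32 + 2 * J.length) := by
  obtain ⟨-, -, hc⟩ := hR.holdsTree (by omega)
  obtain ⟨-, -, hc'⟩ := hR'.holdsTree hM
  have hpm : ∀ i, i ∈ preorder T ↔ 1 ≤ i ∧ i ≤ n := fun i => by
    rw [(preorder_perm T).mem_iff, hR.mem]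
  have hpm' : ∀ i, i ∈ preorder T' ↔ 1 ≤ i ∧ i ≤ n + 1 := fun i => by
    rw [(preorder_perm T').mem_iff, hR'.mem]
  set B := Nat.size (16 * (n + 1)) with hB
  have hsize : ∀ q ≤ n + 1, Nat.size (ad w q 0).toNat ≤ B := fun q hq => by
    rw [ad_toNat hM hq (by omega)]
    exact Nat.size_le_size (by omega)
  have hcode : ∀ i, 1 ≤ i → i ≤ n + 1 → Nat.size (H' i 4).toNat ≤ 2 := fun i h1 h2 => by
    obtain ⟨e, he, h⟩ := hR'.bal.code_lt i ((hR'.mem i).2 ⟨h1, h2⟩)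
    rw [h]; exact size_ofNat_le he
  refine (logBits_le (m := H.mem) (T := T.map (H · 0)) ((ad w 0 4, B) :: (ad w (n + 1) 5, B) ::
    ((List.range 16).map (fun k => (ad w (n + 1) k, 2)) ++ J.map fun j => (ad w j 4, 2)))
    fun a ha => ?_).trans (le_of_eq ?_)
  · rw [hc', List.mem_cons, not_or] at ha
    obtain ⟨ha0, ha⟩ := ha
    refine ⟨?_, ?_⟩
    · rw [hc, List.mem_cons, not_or]
      refine ⟨ha0, fun h => ha ?_⟩
      obtain ⟨i, hi, h⟩ := List.mem_flatMap.1 h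
      have := (hpm i).1 hi
      exact List.mem_flatMap.2 ⟨i, (hpm' i).2 (by omega), h⟩
    have hk : a.toNat % 16 < 16 := Nat.mod_lt _ (by omega)
    have hae := eq_ad a
    have hma : ∀ H : Heap w, H.mem a = H (a.toNat / 16) (a.toNat % 16) := fun H => rfl
    rw [hma, hma]
    generalize a.toNat / 16 = i at *
    generalize a.toNat % 16 = k at *
    subst hae
    by_cases hi : n + 1 < i
    · exact .inl (by rw [hR.blank i (by omega), hR'.blank i hi])
    · have hiM : i ≤ n + 1 := by omega
      rw [mem_flatMap_cells hM (fun i hi => ((hpm' i).1 hi).2) hiM hk, hpm'] at ha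
      by_cases hi0 : i = 0
      · subst hi0
        by_cases hk4 : k = 4
        · subst hk4
          exact .inr ⟨B, by simp, by rw [hR'.count]; exact hsize _ le_rfl⟩
        · refine .inl (hF.out k ?_ hk4)
          rintro rfl
          exact ha0 rfl
      · by_cases hiN : i = n + 1
        · subst hiN
          by_cases hk5 : k = 5
          · subst hk5
            obtain ⟨q, hq, h5⟩ := hF.five
            exact .inr ⟨B, by simp, by rw [h5]; exact hsize q hq⟩
          · refine .inr ⟨2, ?_, ?_⟩
            · simp only [List.mem_cons, List.mem_append, List.mem_map, List.mem_range]
              exact .inr (.inr (.inl ⟨k, hk, rfl⟩))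
            by_cases hk4 : k = 4
            · subst hk4; exact hcode _ (by omega) le_rfl
            · obtain ⟨e, he, h⟩ := hF.new k (by omega)
              rw [h]; exact size_ofNat_le he
        · by_cases hk4 : k = 4
          · subst hk4
            by_cases hJ : i ∈ J
            · refine .inr ⟨2, ?_, hcode i (by omega) hiM⟩
              simp only [List.mem_cons, List.mem_append, List.mem_map]
              exact .inr (.inr (.inr ⟨i, hJ, rfl⟩))
            · exact .inl (hF.bal i hi0 hJ)
          · exact .inl (hF.log i k (by omega) hiN)
  · simp only [List.map_cons, List.map_append, List.map_map, Function.comp_def, List.map_const',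
      List.sum_cons, List.sum_append, List.sum_replicate, List.length_range, smul_eq_mul]
    omega

/-! ### The theorem -/

theorem withArg_mem {w : ℕ} (H : Heap w) (x : BitVec w) : withArg H.mem x = stArg x H := by
  funext l
  cases l with
  | var i =>
    rcases i with _ | i
    · rfl
    · simp only [withArg, stArg, st]
      rw [if_neg (by omega)]
      by_cases h : i < 10
      · interval_cases i <;> rfl
      · rw [List.getD_eq_default]; simpa using h
  | mem a => rfl

/-- By determinism, each run in `Built` ends in the memory that `exists_insert` constructs, whatever
memory bound it was given. -/
theorem Built.exists_rep {w : ℕ} {xs : List (BitVec w)} {m : Memory w}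
    (h : Built insertProg xs m) (hw : 32 * (xs.length + 1) ≤ 2 ^ w) :
    ∃ H T, m = H.mem ∧ Heap.Rep H T xs.length ∧ ∀ k, k ∈ keys (T.map (H · 0)) ↔ k ∈ xs := by
  induction h with
  | blank =>
    exact ⟨fun _ _ => 0, .nil, rfl, ⟨⟨rfl, trivial⟩, trivial, by simp [lab], by simp [lab]; omega,
      by simp [lab], rfl, fun _ _ _ => rfl, fun h => absurd rfl h⟩, by simp [BinaryTree.map, keys]⟩
  | @insert xs m m' x S t e _ hx h ih =>
    simp only [List.length_cons] at hw ⊢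
    obtain ⟨H, T, rfl, hR, hk⟩ := ih (by omega)
    have hx' : ∀ i ∈ lab T, H i 0 ≠ x := by
      rintro i hi rfl
      refine hx ((hk _).1 ?_)
      rw [keys_map]
      exact List.mem_map_of_mem hi
    obtain ⟨T', H', J, k, t', e', hR', hN, hF, hE, -⟩ :=
      exists_insert (S := 16 * (xs.length + 1 + 1)) (by omega) le_rfl hR hx'
    rw [withArg_mem] at h
    have hm := h.det hE
    rw [← withArg_mem] at hm
    refine ⟨H', T', ?_, hR', fun k => ?_⟩
    · funext a
      exact congrFun hm (.mem a)
    · rw [hR.mem_keys_insert hR' hF hN, hk, List.mem_cons]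

theorem Heap.Rep.height_le {w n : ℕ} {H : Heap w} {T : BinaryTree ℕ} (hR : H.Rep T n) :
    T.height ≤ 2 * Nat.log 2 (n + 2) + 1 := by
  have h1 := hR.bal.two_pow_height_le
  rw [hR.numNodes] at h1
  have h2 : n + 2 < 2 ^ (Nat.log 2 (n + 2) + 1) := Nat.lt_pow_succ_log_self (by omega) _
  have h3 : (n + 1) ^ 2 < (2 ^ (Nat.log 2 (n + 2) + 1)) ^ 2 := Nat.pow_lt_pow_left (by omega) (by omega)
  rw [← pow_mul] at h3
  have := (Nat.pow_lt_pow_iff_right (by omega)).1 (h1.trans_lt h3)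
  omega

theorem size_le_log {n : ℕ} : Nat.size (16 * (n + 1)) ≤ Nat.log 2 (n + 2) + 5 := by
  rw [Nat.size_le]
  have h2 : n + 2 < 2 ^ (Nat.log 2 (n + 2) + 1) := Nat.lt_pow_succ_log_self (by omega) _
  rw [show Nat.log 2 (n + 2) + 5 = Nat.log 2 (n + 2) + 1 + 4 by omega, pow_add]
  omega

theorem logb_le_of_height {w n k : ℕ} {H : Heap w} {T : BinaryTree ℕ} (hR : H.Rep T n)
    (hk : T.height ≤ 2 * k) : Real.logb 2 (n + 2) ≤ 2 * k + 1 := by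
  have h1 := numNodes_lt_two_pow_height T
  rw [hR.numNodes] at h1
  have h2 : 2 ^ T.height ≤ 2 ^ (2 * k) := Nat.pow_le_pow_right (by omega) hk
  have h3 : n + 2 ≤ 2 ^ (2 * k + 1) := by rw [pow_succ]; omega
  have h4 : (n + 2 : ℝ) ≤ 2 ^ (2 * k + 1) := by exact_mod_cast h3
  have h5 := Real.logb_le_logb_of_le (b := 2) (by norm_num) (by positivity) h4
  rw [Real.logb_pow, Real.logb_self_eq_one (by norm_num)] at h5
  push_cast at h5
  linarith

end EnergyRAM

theorem mainTheorem7 :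
    ∃ (insert uninsert : EnergyRAM.Prog) (c : ℝ) (C : ℕ), 0 < c ∧
      ∀ (w : ℕ) (xs : List (BitVec w)) (m : EnergyRAM.Memory w) (x : BitVec w),
        EnergyRAM.Built insert xs m → x ∉ xs → C * (xs.length + 1) ≤ 2 ^ w →
        ∃ (T T' : BinaryTree (BitVec w)) (m' : EnergyRAM.Memory w) (t t' : ℕ),
          -- before the insertion, the memory holds an AVL tree with the keys `xs`
          EnergyRAM.HoldsTree m T ∧ EnergyRAM.IsAVL T ∧ (∀ k, k ∈ EnergyRAM.keys T ↔ k ∈ xs) ∧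
          -- the insertion runs with no energy and ends with an AVL tree with the keys `x :: xs`
          EnergyRAM.Exec (C * (xs.length + 1)) insert
            (EnergyRAM.withArg m x) t 0 (EnergyRAM.withArg m' x) ∧
          EnergyRAM.HoldsTree m' T' ∧ EnergyRAM.IsAVL T' ∧
          (∀ k, k ∈ EnergyRAM.keys T' ↔ k = x ∨ k ∈ xs) ∧
          -- the reverse operation restores the memory, with no energy
          EnergyRAM.Exec (C * (xs.length + 1)) uninsert
            (EnergyRAM.withArg m' x) t' 0 (EnergyRAM.withArg m x) ∧
          -- both take logarithmic time
          c * Real.logb 2 (xs.length + 2) ≤ t ∧ t ≤ C * Real.logb 2 (xs.length + 2) ∧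
          c * Real.logb 2 (xs.length + 2) ≤ t' ∧ t' ≤ C * Real.logb 2 (xs.length + 2) ∧
          -- the space is linear in the number of elements, before and after
          c * xs.length ≤ EnergyRAM.spaceUsed m ∧ EnergyRAM.spaceUsed m ≤ C * xs.length ∧
          c * (xs.length + 1) ≤ EnergyRAM.spaceUsed m' ∧
          EnergyRAM.spaceUsed m' ≤ C * (xs.length + 1) ∧
          -- the log grows by a logarithmic number of bits
          (EnergyRAM.logBits m' T' : ℝ) ≤
            EnergyRAM.logBits m T + C * Real.logb 2 (xs.length + 2) := by
  open EnergyRAM in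
  -- The factor `1 / 2` reflects that the height is at most `2 * k` while the run takes more than
  -- `k` steps; 1024 is generous.
  refine ⟨insertProg, insertProg.inv, 1 / 2, 1024, by norm_num, fun w xs m x hB hx hw => ?_⟩
  obtain ⟨H, T, rfl, hR, hk⟩ := hB.exists_rep (by omega)
  have hx' : ∀ i ∈ lab T, H i 0 ≠ x := by
    rintro i hi rfl
    refine hx ((hk _).1 ?_)
    rw [keys_map]
    exact List.mem_map_of_mem hi
  obtain ⟨T', H', J, k, t, e, hR', hN, hF, hE, hk1, hk2, ht1, ht2, hJ⟩ :=
    exists_insert (S := 1024 * (xs.length + 1)) (by omega) (by omega) hR hx'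
  obtain ⟨he, hE'⟩ := hE.inv isRev_insertProg
  subst he
  -- The general bound `16 * (n + 1)` does not vanish for `n = 0`; then the memory is blank.
  have hs0 : spaceUsed H.mem ≤ 1024 * xs.length := by
    by_cases h0 : xs.length = 0
    · rw [List.length_eq_zero_iff] at h0
      subst h0
      have : H.mem = fun _ => 0 := by
        generalize H.mem = m at hB
        cases hB
        rfl
      rw [this]
      exact Nat.sInf_le fun _ _ => rfl
    · have := hR.spaceUsed_le
      omega
  have hlog := logBits_insert_le (by omega) hR hR' hF
  have hh := hR.height_le
  -- This absorbs the additive constants into multiples of the logarithm.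
  have hL1 : 1 ≤ Nat.log 2 (xs.length + 2) := Nat.le_log_of_pow_le (by omega) (by omega)
  have hL : (Nat.log 2 (xs.length + 2) : ℝ) ≤ Real.logb 2 (xs.length + 2) := by
    have := Real.natLog_le_logb (xs.length + 2) 2
    push_cast at this
    exact this
  have hsize := size_le_log (n := xs.length)
  have hlow := logb_le_of_height hR hk1
  have ht3 : t ≤ 1024 * Nat.log 2 (xs.length + 2) := by omega
  have hlog' : logBits H'.mem (T'.map (H' · 0)) ≤
      logBits H.mem (T.map (H · 0)) + 1024 * Nat.log 2 (xs.length + 2) := by omega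
  have hup : (t : ℝ) ≤ (1024 : ℕ) * Real.logb 2 (xs.length + 2) := by
    have : (t : ℝ) ≤ 1024 * (Nat.log 2 (xs.length + 2) : ℝ) := by exact_mod_cast ht3
    push_cast
    linarith
  have hdown : 1 / 2 * Real.logb 2 (xs.length + 2) ≤ t := by
    have : (k : ℝ) + 1 ≤ t := by exact_mod_cast ht1
    linarith
  obtain ⟨a1, a2, -⟩ := hR.holdsTree (by omega)
  obtain ⟨b1, b2, -⟩ := hR'.holdsTree (by omega)
  have c1 : (xs.length : ℝ) ≤ spaceUsed H.mem := by exact_mod_cast hR.le_spaceUsed (by omega)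
  have c2 : (xs.length : ℝ) + 1 ≤ spaceUsed H'.mem := by
    exact_mod_cast hR'.le_spaceUsed (by omega)
  have c3 := hR'.spaceUsed_le
  have c0 : (0 : ℝ) ≤ xs.length := Nat.cast_nonneg _
  rw [withArg_mem]
  refine ⟨_, _, H'.mem, t, t, a1, a2, hk, ?_, b1, b2, fun k => ?_, ?_, hdown, hup, hdown, hup,
    by linarith, ?_, by linarith, ?_, ?_⟩
  · rw [withArg_mem]; exact hE
  · rw [hR.mem_keys_insert hR' hF hN, hk]
  · rw [withArg_mem]; exact hE'
  · exact_mod_cast hs0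
  · exact_mod_cast (show spaceUsed H'.mem ≤ 1024 * (xs.length + 1) by omega)
  · have : (logBits H'.mem (T'.map (H' · 0)) : ℝ) ≤
        logBits H.mem (T.map (H · 0)) + 1024 * (Nat.log 2 (xs.length + 2) : ℝ) := by
      exact_mod_cast hlog'
    push_cast
    linarith
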